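/- Throughout, $G$ is a finite group, $H=\mathrm{Cay}(G,S,w)$ is an undirected weighted Cayley graph ($S=S^{-1}\subseteq G$, $w:S\to\mathbb R_{\ge 0}$, $w_s=w_{s^{-1}}$; $u,v\in G$ are joined by an edge of weight $w_{u^{-1}v}$ iff $u^{-1}v\in S$; $S$ need not generate $G$), and $\varepsilon\in(0,1)$. A $(1\pm\varepsilon)$ Cayley sparsifier of $H$ is $\mathrm{Cay}(G,\tilde S,\tilde w)$ with $\tilde S=\tilde S^{-1}\subseteq S$ and symmetric $\tilde w:\tilde S\to\mathbb R_{\ge0}$ such that for all $x\in\mathbb R^G$ $$(1-\varepsilon)\sum_{\{u,v\}\in H}w_{u^{-1}v}(x_u-x_v)^2\le\sum_{\{u,v\}\in\tilde H}\tilde w_{u^{-1}v}(x_u-x_v)^2\le(1+\varepsilon)\sum_{\{u,v\}\in H}w_{u^{-1}v}(x_u-x_v)^2 .$$ "In polynomial time with high probability" means: for every $c$ there is one randomized real-RAM program (exact real arithmetic and comparisons, index additions and subtractions, memory access and fair coin flips at unit cost; no rounding to integers) which, given $\varepsilon$, the multiplication table of $G$, $S$ and $w$, always halts within $\mathrm{poly}(|G|)$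 steps and succeeds with probability at least $1-|G|^{-c}$; the polynomial and the $O$-constants below may depend on $c$ (and, in (1), on the polynomial that bounds the weights), and on nothing else. (1) If the weights are polynomially bounded (any two positive weights have ratio at most $a|G|^a$, for a fixed $a$), then $H$ has a $(1\pm\varepsilon)$ Cayley sparsifier with $|\tilde S|=O(\log^5|G|/\varepsilon^2)$, and such a sparsifier can be computed in polynomial time with high probability. (2) Let $H=\mathrm{Cay}(G,S)$ be unweighted, with Laplacian $L_H$; let $L_s$ be the Laplacian of $\mathrm{Cay}(G,\{s,s^{-1}\})$, let $\mathrm{imp}(s)=\max_x \frac{x^\top L_s x}{x^\top L_H x}$ (maximum over $x$ with $x^\top L_Hx\neq0$, and $0$ if there is no such $x$), and let $p_s^{(C)}=\min\{C\,\mathrm{imp}(s)\log|G|/\varepsilon^2,1\}$. For every $c$ and every sufficiently large constant $C$, the following importance sampling yields a $(1\pm\varepsilon)$ Cayley sparsifier of $H$ with $|\tilde S|=O(\log^4|G|\cdot\log(|S|+1)/\varepsilon^2)$ with probability at least $1-|G|^{-c}$: from each pair $\{s,s^{-1}\}\subseteq S$ choose one representative $s$, keep it, together with its inverse, independently with probability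 $p_s^{(C)}$, and give the kept generators the weight $1/p_s^{(C)}$. Moreover there are constants $0<C\le C'$ (depending on $c$) and a program that performs this sampling with some probabilities $q_s\in[p_s^{(C)},p_s^{(C')}]$ (and weights $1/q_s$) in polynomial time, and obtains such a sparsifier with high probability. (3) If all weights are at least $1$ and at most $w_{\max}$, then a $(1\pm\varepsilon)$ Cayley sparsifier of $H$ with $|\tilde S|=O\left(\log^4|G|\cdot\log\left(\frac{|S|\,w_{\max}}{\varepsilon}+1\right)/\varepsilon^2\right)$ can be computed in polynomial time with high probability. -/

import Mathlib

open Finset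

universe u

noncomputable section

/-! ### Weighted Cayley graphs and spectral sparsifiers -/

/-- The data of a weighted Cayley graph over `G`: a finite set of generators and their weights
(the values of `weight` outside `gens` play no role in the graph). -/
@[ext] structure CayleyGraph (G : Type*) where
  gens : Finset G
  weight : G → ℝ

namespace CayleyGraph

variable {G : Type*} [Group G] [Fintype G] [DecidableEq G]

/-- The generating set is closed under inverses, and the weights are nonnegative and symmetric.
It need not generate `G`, and it may contain `1` (which only contributes loops). -/
def IsUndirected (H : CayleyGraph G) : Prop :=
  ∀ s ∈ H.gens, 0 ≤ H.weight s ∧ s⁻¹ ∈ H.gens ∧ H.weight s⁻¹ = H.weight s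

/-- The Laplacian quadratic form, that is, the sum of `w_e (x_u - x_v) ^ 2` over the edges of an
undirected Cayley graph: `u` and `v` are joined iff `u⁻¹ * v` is a generator, with its weight.
Every edge `{u, v}` is met twice, as `(u, v)` and as `(v, u)`, hence the factor `1 / 2`. -/
def energy (H : CayleyGraph G) (x : G → ℝ) : ℝ :=
  (1 / 2) * ∑ u : G, ∑ v : G,
    if u⁻¹ * v ∈ H.gens then H.weight (u⁻¹ * v) * (x u - x v) ^ 2 else 0

/-- `H'` is a `(1 ± ε)` spectral sparsifier of `H`. -/
def IsSpectralSparsifier (H' H : CayleyGraph G) (ε : ℝ) : Prop :=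
  ∀ x : G → ℝ, (1 - ε) * H.energy x ≤ H'.energy x ∧ H'.energy x ≤ (1 + ε) * H.energy x

/-- `H'` lives on a reweighted symmetric subset of at most `m` of the generators of `H` and is a
`(1 ± ε)` spectral sparsifier of `H`. -/
def IsSparsifierOfSize (H' H : CayleyGraph G) (ε m : ℝ) : Prop :=
  H'.gens ⊆ H.gens ∧ H'.IsUndirected ∧ (#H'.gens : ℝ) ≤ m ∧ H'.IsSpectralSparsifier H ε

/-- The weights are polynomially bounded, with polynomial `a * |G| ^ a`. Sparsification is
invariant under rescaling all weights, so this bounds the ratio of any two positive weights; weights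
between `1` and `a * |G| ^ a` are a special case. -/
def HasPolyWeights (H : CayleyGraph G) (a : ℕ) : Prop :=
  ∀ s ∈ H.gens, ∀ t ∈ H.gens, 0 < H.weight t →
    H.weight s ≤ a * (Fintype.card G : ℝ) ^ a * H.weight t

/-- The unweighted Cayley graph `Cay(G, S)`. -/
def unweighted (S : Finset G) : CayleyGraph G := ⟨S, fun _ => 1⟩

/-! ### Importance sampling of generators -/

/-- `xᵀ L_s x / xᵀ L_H x` for `H = Cay(G, S)`, where `L_s` is the Laplacian of `Cay(G, {s, s⁻¹})`,
namely `2 I - A_s - A_{s⁻¹}` if `s ≠ s⁻¹` and `I - A_s` if `s = s⁻¹`. -/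
def score (S : Finset G) (s : G) (x : G → ℝ) : ℝ :=
  (unweighted {s, s⁻¹}).energy x / (unweighted S).energy x

/-- The importance of a generator. The score is invariant under scaling of `x`. For `s ∈ S` it is at
most `1`, and its numerator vanishes where its denominator does; such vectors get score `0`, so this
is the operator norm of `L_H^{†/2} L_s L_H^{†/2}`. -/
def importance (S : Finset G) (s : G) : ℝ := ⨆ x : G → ℝ, score S s x

/-- The probability with which importance sampling keeps `s`. -/
def keepProb (C : ℝ) (S : Finset G) (ε : ℝ) (s : G) : ℝ :=
  min (C * importance S s * Real.log (Fintype.card G) / ε ^ 2) 1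

/-- `R` contains exactly one element of every pair `{s, s⁻¹} ⊆ S`. -/
def IsHalf (R S : Finset G) : Prop :=
  R ⊆ S ∧ (∀ s ∈ S, s ∈ R ∨ s⁻¹ ∈ R) ∧ ∀ s ∈ R, s⁻¹ ∈ R → s⁻¹ = s

/-- The graph produced when the representatives in `T` are the ones that are kept: they come with
their inverses, and a generator kept with probability `q s` has weight `1 / q s`. -/
def sampled (q : G → ℝ) (T : Finset G) : CayleyGraph G where
  gens := T ∪ T.image (·⁻¹)
  weight s := if s ∈ T ∪ T.image (·⁻¹) then 1 / q s else 0

open Classical in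
/-- The probability that the sampled graph satisfies `E`, if every representative `s ∈ R` is kept
with probability `q s`, independently of the others. -/
def sampleProb (R : Finset G) (q : G → ℝ) (E : CayleyGraph G → Prop) : ℝ :=
  ∑ T ∈ R.powerset with E (sampled q T), (∏ s ∈ T, q s) * ∏ s ∈ R \ T, (1 - q s)

end CayleyGraph

/-! ### A randomized real random access machine

Programs of a structured language over natural-number registers (used as indices) and real
registers, with named two-dimensional arrays of both kinds. Exact arithmetic operations on reals,
comparisons, additions and (truncated) subtractions of indices, memory accesses and fair coin
flips cost one step each. There is no rounding of reals to integers, and the only constants are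
natural numbers. -/

namespace RealRAM

structure State where
  reg : ℕ → ℕ
  freg : ℕ → ℝ
  tab : ℕ → ℕ → ℕ → ℕ
  arr : ℕ → ℕ → ℕ → ℝ
  /-- the outcomes of the coin flips still to come -/
  coins : List Bool

/-- Basic instructions; the first argument(s) say where the result goes. -/
inductive Op where
  | const (r n : ℕ)
  | add (r a b : ℕ)
  | sub (r a b : ℕ)
  | load (r k a b : ℕ)
  | store (k a b r : ℕ)
  | fcast (x r : ℕ)
  | fadd (x y z : ℕ)
  | fsub (x y z : ℕ)
  | fmul (x y z : ℕ)
  | fdiv (x y z : ℕ)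
  | fload (x k a b : ℕ)
  | fstore (k a b x : ℕ)

/-- `write m k i j v` replaces entry `(i, j)` of array `k` by `v`. -/
def write {α : Type} (m : ℕ → ℕ → ℕ → α) (k i j : ℕ) (v : α) : ℕ → ℕ → ℕ → α :=
  Function.update m k (Function.update (m k) i (Function.update (m k i) j v))

/-- The effect of an instruction. Division by `0` returns `0`. -/
def Op.run (σ : State) : Op → State
  | const r n => { σ with reg := Function.update σ.reg r n }
  | add r a b => { σ with reg := Function.update σ.reg r (σ.reg a + σ.reg b) }
  | sub r a b => { σ with reg := Function.update σ.reg r (σ.reg a - σ.reg b) }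
  | load r k a b => { σ with reg := Function.update σ.reg r (σ.tab k (σ.reg a) (σ.reg b)) }
  | store k a b r => { σ with tab := write σ.tab k (σ.reg a) (σ.reg b) (σ.reg r) }
  | fcast x r => { σ with freg := Function.update σ.freg x (σ.reg r : ℝ) }
  | fadd x y z => { σ with freg := Function.update σ.freg x (σ.freg y + σ.freg z) }
  | fsub x y z => { σ with freg := Function.update σ.freg x (σ.freg y - σ.freg z) }
  | fmul x y z => { σ with freg := Function.update σ.freg x (σ.freg y * σ.freg z) }
  | fdiv x y z => { σ with freg := Function.update σ.freg x (σ.freg y / σ.freg z) }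
  | fload x k a b => { σ with freg := Function.update σ.freg x (σ.arr k (σ.reg a) (σ.reg b)) }
  | fstore k a b x => { σ with arr := write σ.arr k (σ.reg a) (σ.reg b) (σ.freg x) }

inductive Test where
  | lt (a b : ℕ)
  | fle (x y : ℕ)

def Test.Holds (σ : State) : Test → Prop
  | lt a b => σ.reg a < σ.reg b
  | fle x y => σ.freg x ≤ σ.freg y

inductive Program where
  | op (o : Op)
  | coin (r : ℕ)
  | seq (p q : Program)
  | ite (b : Test) (p q : Program)
  | loop (b : Test) (p : Program)

/-- `Exec p σ τ t`: started in `σ`, the program `p` halts in `τ` after exactly `t` steps. -/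
inductive Exec : Program → State → State → ℕ → Prop where
  | op (o : Op) (σ : State) : Exec (.op o) σ (o.run σ) 1
  | coin (r : ℕ) (σ : State) (b : Bool) (bs : List Bool) (h : σ.coins = b :: bs) :
      Exec (.coin r) σ
        { σ with reg := Function.update σ.reg r (if b then 1 else 0), coins := bs } 1
  | seq {p q : Program} {σ τ υ : State} {t u : ℕ} (hp : Exec p σ τ t) (hq : Exec q τ υ u) :
      Exec (.seq p q) σ υ (t + u)
  | ite_true {b : Test} {p q : Program} {σ τ : State} {t : ℕ} (hb : b.Holds σ)
      (hp : Exec p σ τ t) : Exec (.ite b p q) σ τ (t + 1)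
  | ite_false {b : Test} {p q : Program} {σ τ : State} {t : ℕ} (hb : ¬ b.Holds σ)
      (hq : Exec q σ τ t) : Exec (.ite b p q) σ τ (t + 1)
  | loop_done {b : Test} {p : Program} {σ : State} (hb : ¬ b.Holds σ) :
      Exec (.loop b p) σ σ 1
  | loop_step {b : Test} {p : Program} {σ τ υ : State} {t u : ℕ} (hb : b.Holds σ)
      (hp : Exec p σ τ t) (hl : Exec (.loop b p) τ υ u) : Exec (.loop b p) σ υ (t + u + 1)

/-- Started in `init ω`, the program halts within `T` steps whatever the coin flips `ω` are.
(`T` flips suffice, since a flip costs a step.) -/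
def HaltsWithin (p : Program) (init : List Bool → State) (T : ℕ) : Prop :=
  ∀ ω : Fin T → Bool, ∃ τ t, Exec p (init (List.ofFn ω)) τ t ∧ t ≤ T

open Classical in
/-- The probability, over `T` independent fair coin flips, that the program halts in a state that
satisfies `E`. -/
def prob (p : Program) (init : List Bool → State) (T : ℕ) (E : State → Prop) : ℝ :=
  (#{ω : Fin T → Bool | ∃ τ t, Exec p (init (List.ofFn ω)) τ t ∧ E τ} : ℝ) / 2 ^ T

variable {G : Type*} [Group G] [Fintype G] [DecidableEq G]

/-- The input: the group elements are numbered by `e`; register `0` holds `|G|`, integer array `0`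
the multiplication table, integer array `1` the indicator of the generating set, real array `0` the
weights of the generators, real register `0` the accuracy `ε`. Everything else is `0`. -/
def input (e : G ≃ Fin (Fintype.card G)) (H : CayleyGraph G) (ε : ℝ) (ω : List Bool) : State where
  reg r := if r = 0 then Fintype.card G else 0
  freg x := if x = 0 then ε else 0
  tab k i j :=
    if h : i < Fintype.card G ∧ j < Fintype.card G then
      if k = 0 then (e (e.symm ⟨i, h.1⟩ * e.symm ⟨j, h.2⟩) : ℕ)
      else if k = 1 ∧ j = 0 ∧ e.symm ⟨i, h.1⟩ ∈ H.gens then 1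
      else 0
    else 0
  arr k i j :=
    if h : i < Fintype.card G then
      if k = 0 ∧ j = 0 ∧ e.symm ⟨i, h⟩ ∈ H.gens then H.weight (e.symm ⟨i, h⟩) else 0
    else 0
  coins := ω

/-- The output: integer array `2` marks the generators by nonzero entries, and real array `1` holds
their weights. -/
def output (e : G ≃ Fin (Fintype.card G)) (τ : State) : CayleyGraph G where
  gens := {g : G | τ.tab 2 (e g) 0 ≠ 0}
  weight g := if τ.tab 2 (e g) 0 ≠ 0 then τ.arr 1 (e g) 0 else 0

/-- On the input `(G, H, ε)`, `G` numbered by `e`, the program halts within `d * |G| ^ d` steps, and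
with probability at least `1 - 1 / |G| ^ c` it outputs a `(1 ± ε)` sparsifier of `H` on a reweighted
symmetric subset of at most `m` of its generators. -/
def Sparsifies (p : Program) (c d : ℕ) (e : G ≃ Fin (Fintype.card G)) (H : CayleyGraph G)
    (ε m : ℝ) : Prop :=
  HaltsWithin p (input e H ε) (d * Fintype.card G ^ d) ∧
    1 - 1 / (Fintype.card G : ℝ) ^ c ≤
      prob p (input e H ε) (d * Fintype.card G ^ d)
        fun τ => (output e τ).IsSparsifierOfSize H ε m

end RealRAM

end

/-! Everything rests on one count: if `2 ^ r > |G|`, at most `8 r ^ 3 / θ` generators `s` have, for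
some `x`, weighted energy `w_s * genEnergy s x` above `θ` times the energy of `x`
(`card_important_le`). The displacement of `x` under translation by `g` is a length function on the
group (`genDist_mul_le`). In a family of such generators let `s` be the lightest and `x` its
witness. Only O(r²/θ) members displace `x` by at least a `1 / (2 r)` part of what `s` does, because
each of these carries a `θ / (4 r ^ 2)` share of the energy; they are discarded. Products of fewer
than `r` survivors displace `x` by less than half as much as `s`, so left multiplication by `s`
moves a set of such products off itself and doubles it; `r` doublings would exceed `|G|`
(`exists_products`). Comparing with the lightest generator keeps the bound free of the weights. A
weak-type bound sums up at the cost of a harmonic number (`sum_le_harmonic`), so the importances add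
up to O(log³|G| log(|S|+1)).

Sampling with probabilities of order importance times log|G|/ε² then keeps few generators by a
Chernoff bound, and preserves the energy by matrix concentration. After `exists_normalization` the
total form is dominated by the identity. `moment_le` bounds a high trace moment of the deviation
`X`: one factor `X` is split off, each generator is resampled conditionally on the others, and
`trace_sub_mul_pow_sub_le` turns the difference of powers into lower moments, which `trace_absorb`
feeds back into the higher one. Markov's inequality with an exponent of order `(c + 2) log|G|`
finishes.

The program finds for every `g` the largest `k ≤ ⌈log₂|G|⌉` for which `ε² 2⁻ᵏ` times the energy of
the graph dominates `C ⌈log₂|G|⌉` times the weighted energy of `g`, flips `k` coins, and keeps `g`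
with weight `2ᵏ w_g` if all show heads. Domination is decided by exact symmetric elimination
(`elimDefect_nonpos_iff`). These probabilities are optimal up to constants (`acceptProb_lower`,
`acceptProb_upper`), except for the truncation at about `1 / |G|`, which costs at most one expected
generator. `prob_sampler` identifies the law of the output with the product measure.

The single bound of `sampler_sparsifies` gives all weighted claims: `|S| ≤ |G|` for polynomial
weights, `|S| ≤ |S| W / ε` for weights in `[1, W]`, and existence because the success probability is
positive (`Sparsifies.exists`). -/

noncomputable section

namespace RealRAM

/-! ### Reasoning about programs -/

/-- The coins are part of the state, so nothing is left to chance once they are fixed. Hence one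
exhibited run decides whether a coin sequence belongs to the event in `prob`. -/
theorem Exec.deterministic {p : Program} {σ τ τ' : State} {t t' : ℕ} (h : Exec p σ τ t)
    (h' : Exec p σ τ' t') : τ = τ' ∧ t = t' := by
  induction h generalizing τ' t' with
  | op o σ => cases h'; exact ⟨rfl, rfl⟩
  | coin r σ b bs hb =>
    cases h' with
    | coin _ _ b' bs' hb' =>
      rw [hb] at hb'
      obtain ⟨rfl, rfl⟩ := List.cons.inj hb'
      exact ⟨rfl, rfl⟩
  | seq hp hq ihp ihq =>
    cases h' with
    | seq hp' hq' =>
      obtain ⟨rfl, rfl⟩ := ihp hp'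
      obtain ⟨rfl, rfl⟩ := ihq hq'
      exact ⟨rfl, rfl⟩
  | ite_true hb hp ih =>
    cases h' with
    | ite_true _ hp' => obtain ⟨rfl, rfl⟩ := ih hp'; exact ⟨rfl, rfl⟩
    | ite_false hb' _ => exact absurd hb hb'
  | ite_false hb hp ih =>
    cases h' with
    | ite_true hb' _ => exact absurd hb' hb
    | ite_false _ hp' => obtain ⟨rfl, rfl⟩ := ih hp'; exact ⟨rfl, rfl⟩
  | loop_done hb =>
    cases h' with
    | loop_done => exact ⟨rfl, rfl⟩
    | loop_step hb' _ _ => exact absurd hb' hb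
  | loop_step hb hp hl ihp ihl =>
    cases h' with
    | loop_done hb' => exact absurd hb hb'
    | loop_step _ hp' hl' =>
      obtain ⟨rfl, rfl⟩ := ihp hp'
      obtain ⟨rfl, rfl⟩ := ihl hl'
      exact ⟨rfl, rfl⟩

/-- Started in `σ`, the program halts within `T` steps in a state that satisfies `Q`. -/
def Runs (p : Program) (σ : State) (T : ℕ) (Q : State → Prop) : Prop :=
  ∃ τ t, Exec p σ τ t ∧ t ≤ T ∧ Q τ

theorem Runs.mono {p : Program} {σ : State} {T T' : ℕ} {Q Q' : State → Prop} (h : Runs p σ T Q)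
    (hT : T ≤ T') (hQ : ∀ τ, Q τ → Q' τ) : Runs p σ T' Q' := by
  obtain ⟨τ, t, he, ht, hq⟩ := h
  exact ⟨τ, t, he, ht.trans hT, hQ _ hq⟩

theorem Runs.op {o : Op} {σ : State} {Q : State → Prop} (h : Q (o.run σ)) :
    Runs (.op o) σ 1 Q :=
  ⟨_, _, .op o σ, le_rfl, h⟩

theorem Runs.seq {p q : Program} {σ : State} {T U : ℕ} {Q : State → Prop}
    (h : Runs p σ T fun τ => Runs q τ U Q) : Runs (.seq p q) σ (T + U) Q := by
  obtain ⟨τ, t, he, ht, υ, u, he', hu, hq⟩ := h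
  exact ⟨υ, t + u, .seq he he', by omega, hq⟩

theorem Runs.ite {b : Test} {p q : Program} {σ : State} {T : ℕ} {Q : State → Prop}
    (h : b.Holds σ → Runs p σ T Q) (h' : ¬ b.Holds σ → Runs q σ T Q) :
    Runs (.ite b p q) σ (T + 1) Q := by
  by_cases hb : b.Holds σ
  · obtain ⟨τ, t, he, ht, hq⟩ := h hb
    exact ⟨τ, t + 1, .ite_true hb he, by omega, hq⟩
  · obtain ⟨τ, t, he, ht, hq⟩ := h' hb
    exact ⟨τ, t + 1, .ite_false hb he, by omega, hq⟩

theorem Runs.coin {r : ℕ} {σ : State} {b : Bool} {bs : List Bool} {Q : State → Prop}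
    (hc : σ.coins = b :: bs)
    (h : Q { σ with reg := Function.update σ.reg r (if b then 1 else 0), coins := bs }) :
    Runs (.coin r) σ 1 Q :=
  ⟨_, _, .coin r σ b bs hc, le_rfl, h⟩

/-- A straight-line program. -/
def ops (o : Op) : List Op → Program
  | [] => .op o
  | o' :: l => .seq (.op o) (ops o' l)

theorem Runs.ops {o : Op} {l : List Op} {σ : State} {Q : State → Prop}
    (h : Q (l.foldl Op.run (o.run σ))) : Runs (ops o l) σ (l.length + 1) Q := by
  induction l generalizing o σ with
  | nil => exact Runs.op h
  | cons o' l ih =>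
    refine (Runs.seq (T := 1) (U := l.length + 1) (Runs.op (ih h))).mono ?_ fun _ => id
    simp; omega

/-! The registers and arrays that a program may change. -/

def Op.regs : Op → List ℕ
  | const r _ | add r _ _ | sub r _ _ | load r _ _ _ => [r]
  | _ => []

def Op.fregs : Op → List ℕ
  | fcast x _ | fadd x _ _ | fsub x _ _ | fmul x _ _ | fdiv x _ _ | fload x _ _ _ => [x]
  | _ => []

def Op.tabs : Op → List ℕ
  | store k _ _ _ => [k]
  | _ => []

def Op.arrs : Op → List ℕ
  | fstore k _ _ _ => [k]
  | _ => []

namespace Program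

def regs : Program → List ℕ
  | op o => o.regs
  | coin r => [r]
  | seq p q | ite _ p q => p.regs ++ q.regs
  | loop _ p => p.regs

def fregs : Program → List ℕ
  | op o => o.fregs
  | coin _ => []
  | seq p q | ite _ p q => p.fregs ++ q.fregs
  | loop _ p => p.fregs

def tabs : Program → List ℕ
  | op o => o.tabs
  | coin _ => []
  | seq p q | ite _ p q => p.tabs ++ q.tabs
  | loop _ p => p.tabs

def arrs : Program → List ℕ
  | op o => o.arrs
  | coin _ => []
  | seq p q | ite _ p q => p.arrs ++ q.arrs
  | loop _ p => p.arrs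

def coinFree : Program → Bool
  | op _ => true
  | coin _ => false
  | seq p q | ite _ p q => p.coinFree && q.coinFree
  | loop _ p => p.coinFree

end Program

/-- `τ` differs from `σ` only in what `p` may change. -/
structure Agree (p : Program) (σ τ : State) : Prop where
  reg : ∀ r, r ∉ p.regs → τ.reg r = σ.reg r
  freg : ∀ x, x ∉ p.fregs → τ.freg x = σ.freg x
  tab : ∀ k, k ∉ p.tabs → τ.tab k = σ.tab k
  arr : ∀ k, k ∉ p.arrs → τ.arr k = σ.arr k
  coins : p.coinFree = true → τ.coins = σ.coins

theorem Agree.refl (p : Program) (σ : State) : Agree p σ σ :=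
  ⟨fun _ _ => rfl, fun _ _ => rfl, fun _ _ => rfl, fun _ _ => rfl, fun _ => rfl⟩

theorem Agree.trans {p : Program} {σ τ υ : State} (h : Agree p σ τ) (h' : Agree p τ υ) :
    Agree p σ υ :=
  ⟨fun r hr => (h'.reg r hr).trans (h.reg r hr), fun r hr => (h'.freg r hr).trans (h.freg r hr),
    fun r hr => (h'.tab r hr).trans (h.tab r hr), fun r hr => (h'.arr r hr).trans (h.arr r hr),
    fun hc => (h'.coins hc).trans (h.coins hc)⟩

theorem Agree.weaken {p q : Program} {σ τ : State} (h : Agree p σ τ) (hr : p.regs ⊆ q.regs)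
    (hf : p.fregs ⊆ q.fregs) (ht : p.tabs ⊆ q.tabs) (ha : p.arrs ⊆ q.arrs)
    (hc : q.coinFree = true → p.coinFree = true) : Agree q σ τ :=
  ⟨fun r hr' => h.reg r fun hh => hr' (hr hh), fun r hr' => h.freg r fun hh => hr' (hf hh),
    fun r hr' => h.tab r fun hh => hr' (ht hh), fun r hr' => h.arr r fun hh => hr' (ha hh),
    fun hh => h.coins (hc hh)⟩

theorem Op.agree (o : Op) (σ : State) : Agree (.op o) σ (o.run σ) := by
  constructor
  · intro r hr
    cases o <;> simp_all [Op.run, Program.regs, Op.regs]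
  · intro r hr
    cases o <;> simp_all [Op.run, Program.fregs, Op.fregs]
  · intro r hr
    cases o <;> simp_all [Op.run, Program.tabs, Op.tabs, write]
  · intro r hr
    cases o <;> simp_all [Op.run, Program.arrs, Op.arrs, write]
  · intro _
    cases o <;> rfl

/-- A syntactic frame rule: whatever the program text never names as a target survives, and for
concrete programs this is checked by `decide`. -/
theorem Exec.agree {p : Program} {σ τ : State} {t : ℕ} (h : Exec p σ τ t) : Agree p σ τ := by
  induction h with
  | op o σ => exact o.agree σ
  | coin r σ b bs hb =>
    refine ⟨fun r' hr => ?_, fun _ _ => rfl, fun _ _ => rfl, fun _ _ => rfl, fun h => by cases h⟩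
    simp only [Program.regs, List.mem_singleton] at hr
    simp [hr]
  | seq hp hq ihp ihq =>
    refine (ihp.weaken ?_ ?_ ?_ ?_ ?_).trans (ihq.weaken ?_ ?_ ?_ ?_ ?_) <;>
      simp +contextual [Program.regs, Program.fregs, Program.tabs, Program.arrs, Program.coinFree]
  | ite_true hb hp ih =>
    refine ih.weaken ?_ ?_ ?_ ?_ ?_ <;>
      simp +contextual [Program.regs, Program.fregs, Program.tabs, Program.arrs, Program.coinFree]
  | ite_false hb hp ih =>
    refine ih.weaken ?_ ?_ ?_ ?_ ?_ <;>
      simp +contextual [Program.regs, Program.fregs, Program.tabs, Program.arrs, Program.coinFree]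
  | loop_done hb => exact Agree.refl _ _
  | loop_step hb hp hl ihp ihl =>
    exact (ihp.weaken (q := .loop _ _) (fun _ => id) (fun _ => id) (fun _ => id) (fun _ => id)
      id).trans ihl

theorem Runs.agree {p : Program} {σ : State} {T : ℕ} {Q : State → Prop} (h : Runs p σ T Q) :
    Runs p σ T fun τ => Q τ ∧ Agree p σ τ := by
  obtain ⟨τ, t, he, ht, hq⟩ := h
  exact ⟨τ, t, he, ht, hq, he.agree⟩

/-- Sequential composition, remembering what the first program leaves unchanged. -/
theorem Runs.seq_agree {p q : Program} {σ : State} {T U : ℕ} {Q R : State → Prop}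
    (h : Runs p σ T R) (h' : ∀ τ, R τ → Agree p σ τ → Runs q τ U Q) :
    Runs (.seq p q) σ (T + U) Q :=
  Runs.seq (h.agree.mono le_rfl fun τ hτ => h' τ hτ.1 hτ.2)

/-- `for r < b do p`, provided that register `2` holds `1`. -/
def forLoop (r b : ℕ) (p : Program) : Program :=
  .seq (.op (.const r 0)) (.loop (.lt r b) (.seq p (.op (.add r r 2))))

/-- The state with the index register `r` set to `v`. -/
def State.setReg (σ : State) (r v : ℕ) : State := { σ with reg := Function.update σ.reg r v }

@[simp] theorem State.setReg_freg (σ : State) (r v : ℕ) : (σ.setReg r v).freg = σ.freg := rfl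
@[simp] theorem State.setReg_arr (σ : State) (r v : ℕ) : (σ.setReg r v).arr = σ.arr := rfl
@[simp] theorem State.setReg_coins (σ : State) (r v : ℕ) : (σ.setReg r v).coins = σ.coins := rfl
theorem State.setReg_reg (σ : State) (r v r' : ℕ) :
    (σ.setReg r v).reg r' = if r' = r then v else σ.reg r' := by
  simp [setReg, Function.update_apply]

/-- The invariant `I j` is read when the counter already holds `j`, hence the `setReg` after the
body. Each round costs two steps beyond the body (test and increment); the final `+ 2` is the
initialization and the failing test. -/
theorem Runs.forLoop {r b : ℕ} {p : Program} {σ : State} {T : ℕ} (I : ℕ → State → Prop)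
    (hone : σ.reg 2 = 1) (hr : r ∉ p.regs ∧ 2 ∉ p.regs ∧ b ∉ p.regs ∧ r ≠ 2 ∧ b ≠ r)
    (h0 : I 0 (σ.setReg r 0))
    (hstep : ∀ j < σ.reg b, ∀ τ, Agree (forLoop r b p) σ τ → τ.reg r = j → I j τ →
      Runs p τ T fun υ => I (j + 1) (υ.setReg r (j + 1))) :
    Runs (forLoop r b p) σ (σ.reg b * (T + 2) + 2) (I (σ.reg b)) := by
  obtain ⟨hr, h2, hb, hr2, hbr⟩ := hr
  have hregs : ∀ x, x ∉ p.regs → x ≠ r → x ∉ (RealRAM.forLoop r b p).regs := by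
    intro x hx hxr
    simp [RealRAM.forLoop, Program.regs, Op.regs, hx, hxr]
  have key : ∀ m j τ, j + m = σ.reg b → Agree (RealRAM.forLoop r b p) σ τ → τ.reg r = j → I j τ →
      Runs (.loop (.lt r b) (.seq p (.op (.add r r 2)))) τ (m * (T + 2) + 1) (I (σ.reg b)) := by
    intro m
    induction m with
    | zero =>
      intro j τ hj ha hτ hI
      refine ⟨τ, 1, .loop_done ?_, by omega, by simpa [← hj] using hI⟩
      simp only [Test.Holds, ha.reg b (hregs b hb hbr)]
      omega
    | succ m ih =>
      intro j τ hj ha hτ hI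
      have hb' := ha.reg b (hregs b hb hbr)
      obtain ⟨υ, t, he, ht, hQ⟩ := hstep j (by omega) τ ha hτ hI
      have hag := he.agree
      have e1 : (Op.add r r 2).run υ = υ.setReg r (j + 1) := by
        simp [Op.run, State.setReg, hag.reg r hr, hag.reg 2 h2, hτ,
          ha.reg 2 (hregs 2 h2 (Ne.symm hr2)), hone]
      have hseq := Exec.seq he (.op (.add r r 2) υ)
      have ha2 : Agree (RealRAM.forLoop r b p) σ (υ.setReg r (j + 1)) := by
        rw [← e1]
        refine ha.trans (hseq.agree.weaken ?_ ?_ ?_ ?_ ?_) <;>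
          simp +contextual [RealRAM.forLoop, Program.regs, Program.fregs, Program.tabs,
            Program.arrs, Program.coinFree]
      obtain ⟨ω, u, he', hu, hQ'⟩ := ih (j + 1) _ (by omega) ha2 (by simp [State.setReg]) hQ
      rw [← e1] at he'
      refine ⟨ω, _, .loop_step ?_ hseq he', ?_, hQ'⟩
      · simp only [Test.Holds, hb']; omega
      · rw [Nat.succ_mul]; omega
  refine (Runs.seq (T := 1) (Runs.op (o := .const r 0)
    (show Runs _ (σ.setReg r 0) _ _ from key (σ.reg b) 0 _ (by omega) ?_ ?_ h0))).mono (by omega)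
    fun _ => id
  · refine (Op.agree (.const r 0) σ).weaken ?_ ?_ ?_ ?_ ?_ <;>
      simp +contextual [RealRAM.forLoop, Program.regs, Program.fregs, Program.tabs,
            Program.arrs, Program.coinFree]
  · simp [State.setReg]

theorem write_apply {α : Type} (m : ℕ → ℕ → ℕ → α) (k i j : ℕ) (v : α) (k' i' j' : ℕ) :
    write m k i j v k' i' j' = if k' = k ∧ i' = i ∧ j' = j then v else m k' i' j' := by
  unfold write
  by_cases h1 : k' = k
  · subst h1
    by_cases h2 : i' = i
    · subst h2
      by_cases h3 : j' = j
      · subst h3; simp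
      · simp [h3]
    · simp [h2]
  · simp [h1]

end RealRAM

namespace RealRAM

/-! ### A program for testing positive semidefiniteness -/

/-- The matrix of the quadratic form `(x u - x v) ^ 2`. -/
def edgeMat (u v a b : ℕ) : ℝ :=
  ((if a = u then 1 else 0) - (if a = v then 1 else 0)) *
    ((if b = u then 1 else 0) - (if b = v then 1 else 0))

/-- Adds the multiple `freg 6` of the edge from `reg 10` to `reg 11` to the matrix `arr 2`. -/
def addEdge : Program :=
  ops (.fload 7 2 10 10) [.fadd 7 7 6, .fstore 2 10 10 7, .fload 7 2 11 11, .fadd 7 7 6,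
    .fstore 2 11 11 7, .fload 7 2 10 11, .fsub 7 7 6, .fstore 2 10 11 7, .fload 7 2 11 10,
    .fsub 7 7 6, .fstore 2 11 10 7]

theorem addEdge_runs (σ : State) : Runs addEdge σ 12 fun τ => τ.arr 2 = fun a b =>
    σ.arr 2 a b + σ.freg 6 * edgeMat (σ.reg 10) (σ.reg 11) a b := by
  refine Runs.ops ?_
  funext a b
  simp only [List.foldl, Op.run, write_apply, Function.update_apply, edgeMat]
  generalize σ.reg 10 = u
  generalize σ.reg 11 = v
  by_cases huv : u = v
  -- For a loop, all four updates hit the same diagonal entry and cancel.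
  · subst huv
    by_cases h1 : a = u <;> by_cases h2 : b = u <;> simp [h1, h2]
  · by_cases h1 : a = u
    · subst h1
      by_cases h2 : b = a
      · subst h2; simp [huv]
      · by_cases h3 : b = v
        · subst h3; simp [huv, Ne.symm huv]; ring
        · simp [h2, h3, huv]
    · by_cases h1' : a = v
      · subst h1'
        by_cases h2 : b = u
        · subst h2; simp [huv, Ne.symm huv]; ring
        · by_cases h3 : b = a
          · subst h3; simp [Ne.symm huv]
          · simp [h2, h3, h1]
      · simp [h1, h1']

/-- Sets the matrix `arr 2` to zero. -/
def clearMatrix : Program := forLoop 10 0 (forLoop 11 0 (ops (.fstore 2 10 11 1) []))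

theorem clearMatrix_runs (σ : State) (h2 : σ.reg 2 = 1) (hf : σ.freg 1 = 0) :
    Runs clearMatrix σ (σ.reg 0 * (σ.reg 0 * 3 + 4) + 2) fun τ =>
      ∀ a < σ.reg 0, ∀ b < σ.reg 0, τ.arr 2 a b = 0 := by
  refine Runs.forLoop (fun j τ => ∀ a < j, ∀ b < σ.reg 0, τ.arr 2 a b = 0) h2 (by decide)
    (by simp) fun j hj τ hτ hτj hI => ?_
  have r0 := hτ.reg 0 (by decide)
  have r2 := hτ.reg 2 (by decide)
  have f1 := hτ.freg 1 (by decide)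
  rw [← r0]
  refine Runs.forLoop (T := 1) (fun i υ => (∀ b < i, υ.arr 2 j b = 0) ∧
    ∀ a < j, ∀ b < τ.reg 0, υ.arr 2 a b = 0) (by omega) (by decide) ?_ ?_ |>.mono (by omega) ?_
  · simpa [r0] using hI
  · intro i hi υ hυ hυi hI'
    have e10 := hυ.reg 10 (by decide)
    have g1 := hυ.freg 1 (by decide)
    refine Runs.ops ?_
    simp only [List.foldl, Op.run, write_apply, State.setReg_arr, e10, hυi, g1, f1, hτj, hf]
    refine ⟨fun b hb => ?_, fun a ha b hb => ?_⟩
    · rcases Nat.lt_succ_iff_lt_or_eq.1 hb with hb | rfl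
      · simp [hI'.1 b hb]
      · simp
    · simp [hI'.2 a ha b hb]
  · rintro υ ⟨h, h'⟩ a ha b hb
    simp only [State.setReg_arr]
    rcases Nat.lt_succ_iff_lt_or_eq.1 ha with ha | rfl
    · exact h' a ha b hb
    · exact h b hb

/-- Adds the multiple `freg 6` of the graph of the generator `reg 9` to the matrix. -/
def addGen : Program := forLoop 10 0 (.seq (.op (.load 11 0 10 9)) addEdge)

theorem addGen_runs (σ : State) (h2 : σ.reg 2 = 1) :
    Runs addGen σ (σ.reg 0 * 15 + 2) fun τ => ∀ a b, τ.arr 2 a b = σ.arr 2 a b +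
      σ.freg 6 * ∑ u ∈ range (σ.reg 0), edgeMat u (σ.tab 0 u (σ.reg 9)) a b := by
  refine Runs.forLoop (T := 13) (fun j τ => ∀ a b, τ.arr 2 a b = σ.arr 2 a b +
      σ.freg 6 * ∑ u ∈ range j, edgeMat u (σ.tab 0 u (σ.reg 9)) a b) h2 (by decide)
    (by simp) fun j hj τ hτ hτj hI => ?_
  have t0 := hτ.tab 0 (by decide)
  have r9 := hτ.reg 9 (by decide)
  have f6 := hτ.freg 6 (by decide)
  refine (Runs.seq (T := 1) (U := 12) (Runs.op ((addEdge_runs _).mono le_rfl ?_)))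
  intro υ hυ a b
  rw [State.setReg_arr, hυ]
  simp [Op.run, hI, sum_range_succ, t0, r9, f6, hτj]
  ring

/-- Adds the generators, with `freg 2` times their weights, to the matrix. -/
def addGraph : Program := forLoop 9 0 (.seq (ops (.fload 6 0 9 1) [.fmul 6 6 2]) addGen)

theorem addGraph_runs (σ : State) (h1 : σ.reg 1 = 0) (h2 : σ.reg 2 = 1) :
    Runs addGraph σ (σ.reg 0 * (σ.reg 0 * 15 + 6) + 2) fun τ => ∀ a b, τ.arr 2 a b =
      σ.arr 2 a b + ∑ t ∈ range (σ.reg 0), σ.arr 0 t 0 * σ.freg 2 *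
        ∑ u ∈ range (σ.reg 0), edgeMat u (σ.tab 0 u t) a b := by
  refine Runs.forLoop (fun j τ => ∀ a b, τ.arr 2 a b =
      σ.arr 2 a b + ∑ t ∈ range j, σ.arr 0 t 0 * σ.freg 2 *
        ∑ u ∈ range (σ.reg 0), edgeMat u (σ.tab 0 u t) a b) h2 (by decide)
    (by simp) fun j hj τ hτ hτj hI => ?_
  have t0 := hτ.tab 0 (by decide)
  have a0 := hτ.arr 0 (by decide)
  have r0 := hτ.reg 0 (by decide)
  have r1 := hτ.reg 1 (by decide)
  have r2 := hτ.reg 2 (by decide)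
  have f2 := hτ.freg 2 (by decide)
  refine (Runs.seq (T := 2) (U := σ.reg 0 * 15 + 2) (Runs.ops ((addGen_runs _ ?_).mono ?_ ?_))).mono
    (by omega) fun _ => id
  · simp [Op.run, r2, h2]
  · simp [Op.run, r0]
  intro υ hυ a b
  rw [State.setReg_arr, hυ]
  simp [Op.run, hI, sum_range_succ, t0, a0, f2, r0, hτj, r1, h1]
  ring

/-- Sets the matrix to `freg 2` times the graph minus `freg 3` times the generator `reg 5`. -/
def buildMatrix : Program :=
  .seq clearMatrix (.seq addGraph
    (.seq (ops (.add 9 5 1) [.fload 6 0 9 1, .fmul 6 6 3, .fsub 6 1 6]) addGen))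

/-- The matrix of the difference of `θ` times a graph and `c` times a generator `i`. -/
def diffMat (n : ℕ) (mul : ℕ → ℕ → ℕ) (w : ℕ → ℝ) (θ c : ℝ) (i a b : ℕ) : ℝ :=
  ∑ t ∈ range n, w t * θ * (∑ u ∈ range n, edgeMat u (mul u t) a b) -
    w i * c * ∑ u ∈ range n, edgeMat u (mul u i) a b

/-- The subtraction reuses `addGen` with a negated coefficient, formed as `freg 1 - freg 6` with the
constant `freg 1 = 0`. -/
theorem buildMatrix_runs (σ : State) (h1 : σ.reg 1 = 0) (h2 : σ.reg 2 = 1) (hf : σ.freg 1 = 0) :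
    Runs buildMatrix σ (18 * (σ.reg 0 + 1) ^ 2) fun τ =>
      ∀ a < σ.reg 0, ∀ b < σ.reg 0, τ.arr 2 a b =
        diffMat (σ.reg 0) (σ.tab 0) (fun t => σ.arr 0 t 0) (σ.freg 2) (σ.freg 3) (σ.reg 5) a b := by
  refine (Runs.seq_agree (clearMatrix_runs σ h2 hf) fun τ hτ hτa => Runs.seq_agree
    (U := 4 + (σ.reg 0 * 15 + 2))
    ((addGraph_runs τ (by rw [hτa.reg 1 (by decide), h1]) (by rw [hτa.reg 2 (by decide), h2])).mono
    (T' := σ.reg 0 * (σ.reg 0 * 15 + 6) + 2) ?_ fun _ => id) fun υ hυ hυa => ?_).mono ?_ fun _ => id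
  · rw [hτa.reg 0 (by decide)]
  · have r0 := hτa.reg 0 (by decide)
    have r0' := hυa.reg 0 (by decide)
    refine (Runs.seq (T := 4) (U := σ.reg 0 * 15 + 2) (Runs.ops ((addGen_runs _ ?_).mono ?_ ?_)))
    · simp [Op.run, hυa.reg 2 (by decide), hτa.reg 2 (by decide), h2]
    · simp [Op.run, r0, r0']
    intro ω hω a ha b hb
    rw [hω]
    simp [Op.run, hυ, hτ a ha b hb, diffMat, r0, r0', hυa.reg 1 (by decide), hτa.reg 1 (by decide),
      h1, hυa.freg 1 (by decide), hτa.freg 1 (by decide), hf, hυa.freg 3 (by decide),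
      hτa.freg 3 (by decide), hυa.reg 5 (by decide), hτa.reg 5 (by decide), hυa.arr 0 (by decide),
      hτa.arr 0 (by decide), hυa.tab 0 (by decide), hτa.tab 0 (by decide), hτa.freg 2 (by decide)]
    ring
  · nlinarith [sq_nonneg (σ.reg 0)]

/-- The matrix after elimination of the first `j` variables. -/
def elim (M : ℕ → ℕ → ℝ) : ℕ → ℕ → ℕ → ℝ
  | 0, a, b => M a b
  | p + 1, a, b => elim M p a b - elim M p p a * elim M p p b / elim M p p p

/-- Vanishes iff elimination shows that the matrix is positive semidefinite. -/
def elimDefect (n : ℕ) (M : ℕ → ℕ → ℝ) : ℝ :=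
  ∑ p ∈ range n, (if 0 ≤ elim M p p p then 0 else 1) +
    ∑ a ∈ range n, ∑ b ∈ range n, elim M n a b ^ 2

/-- Register `16` is never read. -/
def skip : Program := .op (.const 16 0)

/-- Copies row `reg 9` of the matrix. -/
def copyRow : Program := forLoop 10 0 (ops (.fload 7 2 9 10) [.fstore 3 10 1 7])

theorem copyRow_runs (σ : State) (h1 : σ.reg 1 = 0) (h2 : σ.reg 2 = 1) :
    Runs copyRow σ (σ.reg 0 * 4 + 2) fun τ =>
      ∀ a < σ.reg 0, τ.arr 3 a 0 = σ.arr 2 (σ.reg 9) a := by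
  refine Runs.forLoop (T := 2) (fun j τ => ∀ a < j, τ.arr 3 a 0 = σ.arr 2 (σ.reg 9) a) h2
    (by decide) (by simp) fun j hj τ hτ hτj hI => Runs.ops ?_
  have a2 := hτ.arr 2 (by decide)
  have r9 := hτ.reg 9 (by decide)
  have r1 := hτ.reg 1 (by decide)
  intro a ha
  simp only [List.foldl, Op.run, write_apply, State.setReg_arr, hτj, a2, r9, r1, h1]
  rcases Nat.lt_succ_iff_lt_or_eq.1 ha with ha | rfl
  · simp [hI a ha, ha.ne]
  · simp

/-- Subtracts the rank one matrix of the pivot `freg 5`. -/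
def subtractPivot : Program := forLoop 10 0 (forLoop 11 0 (ops (.fload 6 3 10 1)
  [.fload 7 3 11 1, .fmul 6 6 7, .fdiv 6 6 5, .fload 7 2 10 11, .fsub 7 7 6, .fstore 2 10 11 7]))

/-- The pivot row is read from its copy in array `3`, because the update in place destroys that row
before all other rows have used it. -/
theorem subtractPivot_runs (σ : State) (h1 : σ.reg 1 = 0) (h2 : σ.reg 2 = 1) :
    Runs subtractPivot σ (σ.reg 0 * (σ.reg 0 * 9 + 4) + 2) fun τ =>
      ∀ a < σ.reg 0, ∀ b < σ.reg 0, τ.arr 2 a b =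
        σ.arr 2 a b - σ.arr 3 a 0 * σ.arr 3 b 0 / σ.freg 5 := by
  refine (Runs.forLoop (T := σ.reg 0 * 9 + 2)
    (fun j τ => ∀ a b, τ.arr 2 a b = if a < j ∧ b < σ.reg 0 then
      σ.arr 2 a b - σ.arr 3 a 0 * σ.arr 3 b 0 / σ.freg 5 else σ.arr 2 a b) h2
    (by decide) (by simp) fun j hj τ hτ hτj hI => ?_).mono (le_of_eq (by ring))
    fun τ hτ a ha b hb => by rw [hτ, if_pos ⟨ha, hb⟩]
  have a3 := hτ.arr 3 (by decide)
  have r0 := hτ.reg 0 (by decide)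
  have r1 := hτ.reg 1 (by decide)
  have r2 := hτ.reg 2 (by decide)
  have f5 := hτ.freg 5 (by decide)
  refine (Runs.forLoop (T := 7) (fun i υ => ∀ a b, υ.arr 2 a b =
    if (a < j ∧ b < σ.reg 0) ∨ (a = j ∧ b < i) then
      σ.arr 2 a b - σ.arr 3 a 0 * σ.arr 3 b 0 / σ.freg 5 else σ.arr 2 a b) (by omega)
    (by decide) ?_ fun i hi υ hυ hυi hI' => Runs.ops ?_).mono (by rw [r0]) fun υ hυ a b => ?_
  · intro a b; simp [hI]
  · have b3 := hυ.arr 3 (by decide)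
    have s1 := hυ.reg 1 (by decide)
    have s10 := hυ.reg 10 (by decide)
    have g5 := hυ.freg 5 (by decide)
    intro a b
    simp only [List.foldl, Op.run, State.setReg_arr, Function.update_apply, write_apply]
    simp only [hυi, s10, s1, hτj, b3, a3, g5, f5, r1, h1, hI']
    by_cases hab : a = j ∧ b = i
    · obtain ⟨rfl, rfl⟩ := hab
      simp
    · have e : (a < j ∧ b < σ.reg 0 ∨ a = j ∧ b < i + 1) ↔
          (a < j ∧ b < σ.reg 0 ∨ a = j ∧ b < i) := by
        constructor
        · rintro (h | h)
          · exact .inl h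
          · exact .inr ⟨h.1, by omega⟩
        · rintro (h | h)
          · exact .inl h
          · exact .inr ⟨h.1, by omega⟩
      rw [if_neg (by simpa using hab)]
      exact (if_congr e rfl rfl).symm
  · rw [State.setReg_arr, hυ]
    refine if_congr ?_ rfl rfl
    constructor
    · rintro (h | h)
      · exact ⟨by omega, h.2⟩
      · exact ⟨by omega, by omega⟩
    · rintro ⟨h, h'⟩
      rcases Nat.lt_succ_iff_lt_or_eq.1 h with h | rfl
      · exact .inl ⟨h, h'⟩
      · exact .inr ⟨rfl, by omega⟩

/-- Symmetric Gaussian elimination; `freg 4` counts the negative pivots. -/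
def eliminate : Program :=
  forLoop 9 0 (.seq copyRow (.seq (.op (.fload 5 2 9 9))
    (.seq (.ite (.fle 1 5) skip (.op (.fadd 4 4 8))) subtractPivot)))

theorem eliminate_runs (σ : State) (h1 : σ.reg 1 = 0) (h2 : σ.reg 2 = 1) (hf : σ.freg 1 = 0)
    (hf8 : σ.freg 8 = 1) :
    Runs eliminate σ (σ.reg 0 * (σ.reg 0 * (σ.reg 0 * 9 + 8) + 9) + 2) fun τ =>
      τ.freg 4 = σ.freg 4 + ∑ p ∈ range (σ.reg 0), (if 0 ≤ elim (σ.arr 2) p p p then 0 else 1) ∧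
      ∀ a < σ.reg 0, ∀ b < σ.reg 0, τ.arr 2 a b = elim (σ.arr 2) (σ.reg 0) a b := by
  refine (Runs.forLoop (T := σ.reg 0 * (σ.reg 0 * 9 + 8) + 7)
    (fun j τ => τ.freg 4 = σ.freg 4 +
      ∑ p ∈ range j, (if 0 ≤ elim (σ.arr 2) p p p then 0 else 1) ∧
      ∀ a < σ.reg 0, ∀ b < σ.reg 0, τ.arr 2 a b = elim (σ.arr 2) j a b) h2
    (by decide) (by simp [elim]) fun j hj τ hτ hτj hI => ?_)
  have r0 := hτ.reg 0 (by decide)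
  have r1 := hτ.reg 1 (by decide)
  have r2 := hτ.reg 2 (by decide)
  have f1 := hτ.freg 1 (by decide)
  have f8 := hτ.freg 8 (by decide)
  rw [h1] at r1
  rw [h2] at r2
  rw [hf] at f1
  rw [hf8] at f8
  refine (Runs.seq_agree (copyRow_runs τ r1 r2) fun υ hυ hυa => ?_).mono
    (T := (τ.reg 0 * 4 + 2) + (1 + (2 + (σ.reg 0 * (σ.reg 0 * 9 + 4) + 2))))
    (by rw [r0]; nlinarith) fun _ => id
  refine Runs.seq (Runs.op ?_)
  have s0 := hυa.reg 0 (by decide)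
  have s1 := hυa.reg 1 (by decide)
  have s2 := hυa.reg 2 (by decide)
  have s9 := hυa.reg 9 (by decide)
  have a2 := hυa.arr 2 (by decide)
  have g1 := hυa.freg 1 (by decide)
  have g4 := hυa.freg 4 (by decide)
  have g8 := hυa.freg 8 (by decide)
  rw [hτj] at s9
  rw [r0] at s0
  have piv : υ.arr 2 j j = elim (σ.arr 2) j j j := by rw [a2, hI.2 j hj j hj]
  refine Runs.seq_agree (T := 2) (R := fun ω => ω.freg 4 = υ.freg 4 +
    if 0 ≤ elim (σ.arr 2) j j j then 0 else 1) (Runs.ite (T := 1) (fun hb => Runs.op ?_)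
      fun hb => Runs.op ?_) fun ω hω hωa => ?_
  · simp only [Test.Holds, Op.run] at hb
    simp only [Function.update_apply, s9, piv, g1, f1] at hb
    norm_num at hb
    simp [Op.run, hb]
  · simp only [Test.Holds, Op.run] at hb
    simp only [Function.update_apply, s9, piv, g1, f1] at hb
    norm_num at hb
    simp [Op.run, hb.not_ge, g8, f8]
  · have c0 := hωa.reg 0 (by decide)
    have c1 := hωa.reg 1 (by decide)
    have c2 := hωa.reg 2 (by decide)
    have d2 := hωa.arr 2 (by decide)
    have d3 := hωa.arr 3 (by decide)
    have k5 := hωa.freg 5 (by decide)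
    simp only [Op.run] at c0 c1 c2 d2 d3 k5
    simp only [Function.update_self, s9, piv] at k5
    refine (subtractPivot_runs ω (by omega) (by omega)).agree.mono (by rw [c0, s0])
      fun ρ ⟨hρ, hρa⟩ => ⟨?_, fun a ha b hb => ?_⟩
    · rw [State.setReg_freg, hρa.freg 4 (by decide), hω, g4, hI.1, sum_range_succ, add_assoc]
    · rw [State.setReg_arr, hρ a (by omega) b (by omega), d2, d3, k5, a2, hI.2 a ha b hb,
        hυ a (by omega), hυ b (by omega), hτj, hI.2 j hj a ha, hI.2 j hj b hb]
      rfl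

/-- Adds the squares of the entries of the matrix to `freg 4`. -/
def sumSquares : Program :=
  forLoop 10 0 (forLoop 11 0 (ops (.fload 7 2 10 11) [.fmul 7 7 7, .fadd 4 4 7]))

theorem sumSquares_runs (σ : State) (h2 : σ.reg 2 = 1) :
    Runs sumSquares σ (σ.reg 0 * (σ.reg 0 * 5 + 4) + 2) fun τ => τ.freg 4 = σ.freg 4 +
      ∑ a ∈ range (σ.reg 0), ∑ b ∈ range (σ.reg 0), σ.arr 2 a b ^ 2 := by
  refine (Runs.forLoop (T := σ.reg 0 * 5 + 2) (fun j τ => τ.freg 4 = σ.freg 4 +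
      ∑ a ∈ range j, ∑ b ∈ range (σ.reg 0), σ.arr 2 a b ^ 2) h2
    (by decide) (by simp) fun j hj τ hτ hτj hI => ?_)
  have r0 := hτ.reg 0 (by decide)
  have r2 := hτ.reg 2 (by decide)
  have a2 := hτ.arr 2 (by decide)
  refine (Runs.forLoop (T := 3) (fun i υ => υ.freg 4 = τ.freg 4 +
      ∑ b ∈ range i, σ.arr 2 j b ^ 2) (by omega)
    (by decide) (by simp) fun i hi υ hυ hυi hI' => Runs.ops ?_).mono (by rw [r0]) fun υ hυ => ?_
  · have s10 := hυ.reg 10 (by decide)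
    have b2 := hυ.arr 2 (by decide)
    simp [Op.run, hI', s10, hυi, hτj, b2, a2, sum_range_succ]
    ring
  · rw [State.setReg_freg, hυ, hI, sum_range_succ, r0, add_assoc]

end RealRAM

namespace RealRAM

/-- Elimination within the first `n` indices never leaves them, so the entries outside, about which
the program guarantees nothing, are harmless. -/
theorem elim_congr {n : ℕ} {M M' : ℕ → ℕ → ℝ} (h : ∀ a < n, ∀ b < n, M a b = M' a b) :
    ∀ p ≤ n, ∀ a < n, ∀ b < n, elim M p a b = elim M' p a b := by
  intro p
  induction p with
  | zero => exact fun _ => h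
  | succ p ih =>
    intro hp a ha b hb
    have hp' : p < n := hp
    simp only [elim]
    rw [ih hp'.le a ha b hb, ih hp'.le p hp' a ha, ih hp'.le p hp' b hb, ih hp'.le p hp' p hp']

theorem elimDefect_congr {n : ℕ} {M M' : ℕ → ℕ → ℝ} (h : ∀ a < n, ∀ b < n, M a b = M' a b) :
    elimDefect n M = elimDefect n M' := by
  unfold elimDefect
  congr 1
  · refine sum_congr rfl fun p hp => ?_
    have hp := mem_range.1 hp
    rw [elim_congr h p hp.le p hp p hp]
  · refine sum_congr rfl fun a ha => sum_congr rfl fun b hb => ?_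
    rw [elim_congr h n le_rfl a (mem_range.1 ha) b (mem_range.1 hb)]

/-- The last `k ≤ l` for which `P k` holds, or `0`. -/
def lastPass (P : ℕ → Prop) : ℕ → ℕ
  | 0 => 0
  | l + 1 => open Classical in if P (l + 1) then l + 1 else lastPass P l

/-! ### The sampling program -/

/-- Determines the last `k ≤ reg 3` such that `freg 2 / 2 ^ k` times the graph dominates `freg 3`
times the generator `reg 5`. -/
def chooseExp : Program :=
  forLoop 8 3 (.seq (ops (.fdiv 2 2 9) [.fsub 4 4 4]) (.seq buildMatrix (.seq eliminate
    (.seq sumSquares (.ite (.fle 4 1) (.op (.add 7 8 2)) skip)))))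

/-- The outcome of the test for the exponent `k`. -/
def Passes (n : ℕ) (mul : ℕ → ℕ → ℕ) (w : ℕ → ℝ) (θ c : ℝ) (i k : ℕ) : Prop :=
  elimDefect n (diffMat n mul w (θ / 2 ^ k) c i) ≤ 0

theorem chooseExp_runs (σ : State) (h1 : σ.reg 1 = 0) (h2 : σ.reg 2 = 1) (h7 : σ.reg 7 = 0)
    (hf : σ.freg 1 = 0) (hf8 : σ.freg 8 = 1) (hf9 : σ.freg 9 = 2) :
    Runs chooseExp σ (σ.reg 3 * (60 * (σ.reg 0 + 1) ^ 3) + 2) fun τ =>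
      τ.reg 7 = lastPass (Passes (σ.reg 0) (σ.tab 0) (fun t => σ.arr 0 t 0) (σ.freg 2) (σ.freg 3)
        (σ.reg 5)) (σ.reg 3) := by
  set P := Passes (σ.reg 0) (σ.tab 0) (fun t => σ.arr 0 t 0) (σ.freg 2) (σ.freg 3) (σ.reg 5)
    with hP
  -- The subtracted `2` is the overhead of the loop per round. The halving precedes the test, so
  -- round `j` tests the exponent `j + 1`; exponent `0` is never tested and is the default.
  refine (Runs.forLoop (T := 60 * (σ.reg 0 + 1) ^ 3 - 2) (fun j τ => τ.freg 2 = σ.freg 2 / 2 ^ j ∧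
    τ.reg 7 = lastPass P j) h2
    (by decide) ?_ fun j hj τ hτ hτj hI => ?_).mono ?_ fun τ hτ => hτ.2
  · simp [State.setReg_reg, h7, lastPass]
  · have r0 := hτ.reg 0 (by decide)
    have r1 := (hτ.reg 1 (by decide)).trans h1
    have r2 := (hτ.reg 2 (by decide)).trans h2
    have r5 := hτ.reg 5 (by decide)
    have t0 := hτ.tab 0 (by decide)
    have a0 := hτ.arr 0 (by decide)
    have f1 := (hτ.freg 1 (by decide)).trans hf
    have f8 := (hτ.freg 8 (by decide)).trans hf8
    have f9 := (hτ.freg 9 (by decide)).trans hf9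
    have f3 := hτ.freg 3 (by decide)
    set M := diffMat (σ.reg 0) (σ.tab 0) (fun t => σ.arr 0 t 0) (σ.freg 2 / 2 ^ (j + 1)) (σ.freg 3)
      (σ.reg 5) with hM
    set n := σ.reg 0 with hn
    refine (Runs.seq_agree (R := fun υ => υ.freg 2 = σ.freg 2 / 2 ^ (j + 1) ∧ υ.freg 4 = 0)
      (U := 18 * (n + 1) ^ 2 + ((n * (n * (n * 9 + 8) + 9) + 2) + ((n * (n * 5 + 4) + 2) + 2)))
      (Runs.ops ?_) fun υ hυ hυa => ?_).mono ?_ fun _ => id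
    · constructor
      · simp [Op.run, hI.1, f9]; ring
      · simp [Op.run]
    · have s0 := hυa.reg 0 (by decide)
      have s1 := hυa.reg 1 (by decide)
      have s2 := hυa.reg 2 (by decide)
      have s5 := hυa.reg 5 (by decide)
      have s7 := hυa.reg 7 (by decide)
      have s8 := hυa.reg 8 (by decide)
      have u0 := hυa.tab 0 (by decide)
      have b0 := hυa.arr 0 (by decide)
      have g1 := hυa.freg 1 (by decide)
      have g8 := hυa.freg 8 (by decide)
      have g3 := hυa.freg 3 (by decide)
      refine Runs.seq_agree ((buildMatrix_runs υ (by omega) (by omega) (by rw [g1, f1])).mono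
        (by rw [s0, r0]) fun _ => id) fun ω hω hωa => ?_
      have k0 := hωa.reg 0 (by decide)
      have k1 := hωa.reg 1 (by decide)
      have k2 := hωa.reg 2 (by decide)
      have k7 := hωa.reg 7 (by decide)
      have k8 := hωa.reg 8 (by decide)
      have e1 := hωa.freg 1 (by decide)
      have e8 := hωa.freg 8 (by decide)
      have e4 := hωa.freg 4 (by decide)
      rw [s0, r0, u0, t0, b0, a0, hυ.1, g3, f3, s5, r5, ← hM] at hω
      refine Runs.seq_agree ((eliminate_runs ω (by omega) (by omega) (by rw [e1, g1, f1])
        (by rw [e8, g8, f8])).mono (by rw [k0, s0, r0]) fun _ => id) fun ρ hρ hρa => ?_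
      have l0 := hρa.reg 0 (by decide)
      have l2 := hρa.reg 2 (by decide)
      have l7 := hρa.reg 7 (by decide)
      have l8 := hρa.reg 8 (by decide)
      have x1 := hρa.freg 1 (by decide)
      refine Runs.seq_agree ((sumSquares_runs ρ (by omega)).mono (by rw [l0, k0, s0, r0])
        fun _ => id) fun π hπ hπa => ?_
      have y1 := hπa.freg 1 (by decide)
      have m2 := hπa.reg 2 (by decide)
      have m7 := hπa.reg 7 (by decide)
      have m8 := hπa.reg 8 (by decide)
      have z2 : π.freg 2 = σ.freg 2 / 2 ^ (j + 1) := by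
        rw [hπa.freg 2 (by decide), hρa.freg 2 (by decide), hωa.freg 2 (by decide), hυ.1]
      have key : π.freg 4 = elimDefect n M := by
        rw [← elimDefect_congr (M := ω.arr 2) hω, hπ, hρ.1, e4, hυ.2, elimDefect, zero_add, l0, k0,
          s0, r0]
        congr 1
        refine sum_congr rfl fun a ha => sum_congr rfl fun b hb => ?_
        have ha := mem_range.1 ha
        have hb := mem_range.1 hb
        rw [hρ.2 a (by omega) b (by omega), k0, s0, r0]
      have hol : (Test.fle 4 1).Holds π ↔ P (j + 1) := by
        simp only [Test.Holds, key, y1, x1, e1, g1, f1, hP, Passes, ← hM]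
      refine Runs.ite (T := 1) (fun hb => Runs.op ?_) fun hb => Runs.op ?_
      · rw [hol] at hb
        refine ⟨by simpa [Op.run] using z2, ?_⟩
        simp [Op.run, State.setReg_reg, lastPass, hb]
        omega
      · rw [hol] at hb
        refine ⟨by simpa [Op.run] using z2, ?_⟩
        simp [Op.run, State.setReg_reg, lastPass, hb]
        omega
    · have : (n + 1) ^ 3 = n ^ 3 + 3 * n ^ 2 + 3 * n + 1 := by ring
      have : n * (n * (n * 9 + 8) + 9) = 9 * n ^ 3 + 8 * n ^ 2 + 9 * n := by ring
      have : n * (n * 5 + 4) = 5 * n ^ 2 + 4 * n := by ring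
      have : (n + 1) ^ 2 = n ^ 2 + 2 * n + 1 := by ring
      simp only [List.length]
      omega
  · have : 2 ≤ 60 * (σ.reg 0 + 1) ^ 3 := by
      have := Nat.one_le_pow 3 (σ.reg 0 + 1) (by omega)
      omega
    rw [Nat.sub_add_cancel this]

/-- Finds the inverse of the element `reg 5`. -/
def findInv : Program :=
  forLoop 10 0 (.seq (ops (.load 11 0 5 10) [.load 12 0 11 11])
    (.ite (.lt 12 11) skip (.ite (.lt 11 12) skip (.op (.add 6 10 1)))))

/-- The only idempotent of a group is `1`, so squaring the product recognizes the inverse without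
knowing the index of the identity. The invariant says nothing until `j₀` has been met and is not
disturbed afterwards. -/
theorem findInv_runs (σ : State) (h1 : σ.reg 1 = 0) (h2 : σ.reg 2 = 1) {j₀ : ℕ}
    (hj₀ : j₀ < σ.reg 0)
    (h : ∀ j < σ.reg 0, σ.tab 0 (σ.tab 0 (σ.reg 5) j) (σ.tab 0 (σ.reg 5) j) =
      σ.tab 0 (σ.reg 5) j ↔ j = j₀) :
    Runs findInv σ (σ.reg 0 * 7 + 2) fun τ => τ.reg 6 = j₀ := by
  refine (Runs.forLoop (T := 5) (fun j τ => j₀ < j → τ.reg 6 = j₀) h2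
    (by decide) (by simp) fun j hj τ hτ hτj hI => ?_).mono le_rfl fun τ hτ => hτ hj₀
  have r1 := (hτ.reg 1 (by decide)).trans h1
  have r5 := hτ.reg 5 (by decide)
  have t0 := hτ.tab 0 (by decide)
  have hj' := h j hj
  refine Runs.seq (T := 2) (U := 3) (Runs.ops (Runs.ite (T := 2) (fun hb => (Runs.op ?_).mono
    one_le_two fun _ => id) fun hb => Runs.ite (T := 1) (fun hb' => Runs.op ?_)
      fun hb' => Runs.op ?_))
  · simp [Test.Holds, Op.run, hτj, r5, t0] at hb
    have : j ≠ j₀ := fun hh => hb.ne (hj'.2 hh)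
    intro hjj
    simpa [Op.run, State.setReg_reg] using hI (by omega)
  · simp [Test.Holds, Op.run, hτj, r5, t0] at hb'
    have : j ≠ j₀ := fun hh => hb'.ne' (hj'.2 hh)
    intro hjj
    simpa [Op.run, State.setReg_reg] using hI (by omega)
  · simp [Test.Holds, Op.run, hτj, r5, t0] at hb hb'
    simp [Op.run, State.setReg_reg, hτj, r1, hj'.1 (le_antisymm hb' hb)]

/-- Flips `reg 7` coins; `reg 13` records whether all of them show heads, and `freg 6` becomes the
weight of the element `reg 5`, doubled with every coin. -/
def flip : Program :=
  .seq (ops (.const 13 1) [.fload 6 0 5 1]) (forLoop 15 7 (.seq (.coin 14)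
    (.seq (.ite (.lt 14 2) (.op (.const 13 0)) skip) (.op (.fadd 6 6 6)))))

theorem flip_runs (σ : State) (h1 : σ.reg 1 = 0) (h2 : σ.reg 2 = 1)
    (hc : σ.reg 7 ≤ σ.coins.length) :
    Runs flip σ (σ.reg 7 * 6 + 4) fun τ => τ.coins = σ.coins.drop (σ.reg 7) ∧
      τ.reg 13 = (if (σ.coins.take (σ.reg 7)).all id then 1 else 0) ∧
      τ.freg 6 = σ.arr 0 (σ.reg 5) 0 * 2 ^ σ.reg 7 := by
  refine (Runs.seq_agree (R := fun τ => τ.reg 13 = 1 ∧ τ.freg 6 = σ.arr 0 (σ.reg 5) 0)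
    (U := σ.reg 7 * 6 + 2) (Runs.ops ?_) fun τ hτ hτa => ?_).mono (by simp only [List.length]; omega)
      fun _ => id
  · simp [Op.run, h1]
  have r2 := (hτa.reg 2 (by decide)).trans h2
  have r7 := hτa.reg 7 (by decide)
  have c := hτa.coins (by decide)
  refine (Runs.forLoop (T := 4) (fun j υ => υ.coins = σ.coins.drop j ∧
      υ.reg 13 = (if (σ.coins.take j).all id then 1 else 0) ∧
      υ.freg 6 = σ.arr 0 (σ.reg 5) 0 * 2 ^ j) r2 (by decide) ?_ fun j hj υ hυ hυj hI => ?_).mono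
      (by rw [r7]) fun υ hυ => by rwa [r7] at hυ
  · simp [State.setReg_reg, c, hτ.1, hτ.2]
  · have s2 := (hυ.reg 2 (by decide)).trans r2
    have hjl : j < σ.coins.length := by omega
    rw [List.drop_eq_getElem_cons hjl] at hI
    have htake : (σ.coins.take (j + 1)).all id = ((σ.coins.take j).all id && σ.coins[j]) := by
      rw [List.take_succ_eq_append_getElem hjl, List.all_append]; simp
    refine Runs.seq (T := 1) (U := 3) (Runs.coin hI.1 (Runs.seq (T := 2) (U := 1) (Runs.ite (T := 1)
      (fun hb => Runs.op (Runs.op ?_)) fun hb => Runs.op (Runs.op ?_))))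
    · simp [Test.Holds, s2] at hb
      simp [Op.run, State.setReg_reg, hI.2.2, htake, hb]
      ring
    · simp [Test.Holds, s2] at hb
      simp only [Op.run, State.setReg_reg, State.setReg_coins, State.setReg_freg, htake, hb]
      simp [hI.2]
      ring

/-- Outputs the elements `reg 5` and `reg 6` with weight `freg 6`. -/
def emit : Program :=
  ops (.store 2 5 1 2) [.store 2 6 1 2, .fstore 1 5 1 6, .fstore 1 6 1 6]

/-- Outputs the pair, if it was kept, `reg 5` is the representative of its pair in the generating
set, and `reg 5` is not the identity. -/
def emitIf : Program :=
  .seq (ops (.load 12 1 5 1) [.load 11 0 5 5]) (.ite (.lt 1 12) (.ite (.lt 6 5) skip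
    (.ite (.lt 13 2) skip (.ite (.lt 11 5) emit (.ite (.lt 5 11) emit skip)))) skip)

theorem emitIf_runs (σ : State) (h1 : σ.reg 1 = 0) (h2 : σ.reg 2 = 1) :
    Runs emitIf σ 11 fun τ => ∀ a,
      (τ.tab 2 a 0 = if ((0 < σ.tab 1 (σ.reg 5) 0 ∧ σ.reg 5 ≤ σ.reg 6 ∧
        σ.tab 0 (σ.reg 5) (σ.reg 5) ≠ σ.reg 5) ∧ 1 ≤ σ.reg 13) ∧ (a = σ.reg 5 ∨ a = σ.reg 6)
        then 1 else σ.tab 2 a 0) ∧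
      (τ.arr 1 a 0 = if ((0 < σ.tab 1 (σ.reg 5) 0 ∧ σ.reg 5 ≤ σ.reg 6 ∧
        σ.tab 0 (σ.reg 5) (σ.reg 5) ≠ σ.reg 5) ∧ 1 ≤ σ.reg 13) ∧ (a = σ.reg 5 ∨ a = σ.reg 6)
        then σ.freg 6 else σ.arr 1 a 0) := by
  have hskip : ∀ (b : ℕ) (P : State → Prop) τ, 1 ≤ b → P (Op.run τ (.const 16 0)) →
      Runs skip τ b P := fun b P τ hb h => (Runs.op h).mono hb fun _ => id
  have hemit : ∀ (b : ℕ) (P : State → Prop) τ, 4 ≤ b →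
      P ([Op.store 2 6 1 2, .fstore 1 5 1 6, .fstore 1 6 1 6].foldl Op.run
        (Op.run τ (.store 2 5 1 2))) →
      Runs emit τ b P := fun b P τ hb h => (Runs.ops h).mono hb fun _ => id
  have aux : ∀ {A : Type} (a i j : ℕ) (x y : A), (if a = j then x else if a = i then x else y) =
      if a = i ∨ a = j then x else y := by
    intros; split_ifs <;> simp_all
  refine Runs.seq (T := 2) (U := 9) (Runs.ops (Runs.ite (T := 8) (fun hb => Runs.ite (T := 7)
    (fun hb' => hskip _ _ _ (by norm_num) ?_) fun hb' => Runs.ite (T := 6)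
      (fun hc => hskip _ _ _ (by norm_num) ?_) fun hc => Runs.ite (T := 5)
      (fun hd => hemit _ _ _ (by norm_num) ?_) fun hd => Runs.ite (T := 4)
      (fun he => hemit _ _ _ (by norm_num) ?_) fun he => hskip _ _ _ (by norm_num) ?_)
    fun hb => hskip _ _ _ (by norm_num) ?_))
  all_goals simp [Test.Holds, Op.run, h1, h2] at *
  · simp [hb'.not_ge]
  · simp [hc]
  · intro a
    simp [write_apply, hb, hb', hd.ne, hc, Nat.one_le_iff_ne_zero, aux]
  · intro a
    simp [write_apply, hb, hb', he.ne', hc, Nat.one_le_iff_ne_zero, aux]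
  · simp [le_antisymm he hd]
  · simp [hb]

end RealRAM

namespace RealRAM

/-- Processes every element `reg 5` of the group. -/
def processItem : Program :=
  .seq findInv (.seq (ops (.fmul 2 0 0) [.const 7 0]) (.seq chooseExp (.seq flip emitIf)))

/-- Computes the constants; `reg 3` becomes the logarithm of `reg 0`. -/
def setup (C : ℕ) : Program :=
  .seq (ops (.const 2 1) [.const 4 1, .const 12 2, .fcast 8 2, .fcast 9 12])
    (.seq (forLoop 15 0 (.ite (.lt 4 0) (ops (.add 4 4 4) [.add 3 3 2]) skip))
      (ops (.const 12 (2 * C)) [.fcast 6 12, .fcast 7 3, .fmul 3 6 7]))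

/-- The importance sampling program. -/
def sampler (C : ℕ) : Program := .seq (setup C) (forLoop 5 0 processItem)

theorem clog_two_le (n : ℕ) : Nat.clog 2 n ≤ n :=
  Nat.clog_le_of_le_pow Nat.lt_two_pow_self.le

/-- Doubling a register as long as it is below `|G|` counts up to the rounded logarithm and then
stalls; `|G|` rounds are enough by `clog_two_le`. -/
theorem setup_runs (C : ℕ) (σ : State) (h3 : σ.reg 3 = 0) :
    Runs (setup C) σ (σ.reg 0 * 5 + 11) fun τ => τ.reg 2 = 1 ∧ τ.reg 3 = Nat.clog 2 (σ.reg 0) ∧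
      τ.freg 8 = 1 ∧ τ.freg 9 = 2 ∧ τ.freg 3 = 2 * C * Nat.clog 2 (σ.reg 0) := by
  refine (Runs.seq_agree (U := (σ.reg 0 * 5 + 2) + 4) (R := fun τ => τ.reg 2 = 1 ∧ τ.reg 3 = 0 ∧
    τ.reg 4 = 1 ∧ τ.freg 8 = 1 ∧ τ.freg 9 = 2) (Runs.ops ?_) fun τ hτ hτa => ?_).mono ?_ fun _ => id
  · simp [Op.run, h3]
  · have r0 := hτa.reg 0 (by decide)
    refine Runs.seq_agree (R := fun υ => υ.reg 3 = Nat.clog 2 (σ.reg 0)) ?_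
      fun υ hυ hυa => Runs.ops ?_
    · refine (Runs.forLoop (T := 3) (fun j υ => υ.reg 3 = min j (Nat.clog 2 (σ.reg 0)) ∧
        υ.reg 4 = 2 ^ υ.reg 3) hτ.1 (by decide) ?_ fun j hj υ hυ hυj hI => Runs.ite (T := 2)
          (fun hb => Runs.ops ?_) fun hb => (Runs.op ?_).mono one_le_two fun _ => id).mono
          (by rw [r0]) fun υ hυ => ?_
      · simp [State.setReg_reg, hτ.2]
      · have s0 := hυ.reg 0 (by decide)
        have s2 := hυ.reg 2 (by decide)
        simp only [Test.Holds, s0, r0, hI.2] at hb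
        rw [← Nat.lt_clog_iff_pow_lt one_lt_two, hI.1] at hb
        simp [Op.run, State.setReg_reg, hI, s2, hτ.1]
        refine ⟨by omega, by ring⟩
      · have s0 := hυ.reg 0 (by decide)
        simp only [Test.Holds, s0, r0, hI.2] at hb
        rw [← Nat.lt_clog_iff_pow_lt one_lt_two, hI.1] at hb
        simp [Op.run, State.setReg_reg, hI]
        omega
      · rw [hυ.1, r0]
        exact min_eq_right (clog_two_le _)
    · simp [Op.run, hυ, hυa.reg 2 (by decide), hτ.1, hυa.freg 8 (by decide),
        hυa.freg 9 (by decide), hτ.2]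
  · simp only [List.length]; omega

theorem lastPass_le (P : ℕ → Prop) (l : ℕ) : lastPass P l ≤ l := by
  induction l with
  | zero => exact le_rfl
  | succ l ih => unfold lastPass; split_ifs <;> omega

theorem processItem_runs (σ : State) (h1 : σ.reg 1 = 0) (h2 : σ.reg 2 = 1) (hf : σ.freg 1 = 0)
    (hf8 : σ.freg 8 = 1) (hf9 : σ.freg 9 = 2) {j₀ : ℕ} (hj₀ : j₀ < σ.reg 0)
    (h : ∀ j < σ.reg 0, σ.tab 0 (σ.tab 0 (σ.reg 5) j) (σ.tab 0 (σ.reg 5) j) =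
      σ.tab 0 (σ.reg 5) j ↔ j = j₀) {k : ℕ} (hk : k = lastPass (Passes (σ.reg 0) (σ.tab 0)
        (fun t => σ.arr 0 t 0) (σ.freg 0 * σ.freg 0) (σ.freg 3) (σ.reg 5)) (σ.reg 3))
    (hc : k ≤ σ.coins.length) :
    Runs processItem σ (σ.reg 0 * 7 + σ.reg 3 * (60 * (σ.reg 0 + 1) ^ 3) + σ.reg 3 * 6 + 21)
      fun τ => τ.coins = σ.coins.drop k ∧ ∀ a,
      (τ.tab 2 a 0 = if ((0 < σ.tab 1 (σ.reg 5) 0 ∧ σ.reg 5 ≤ j₀ ∧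
        σ.tab 0 (σ.reg 5) (σ.reg 5) ≠ σ.reg 5) ∧ (σ.coins.take k).all id) ∧
          (a = σ.reg 5 ∨ a = j₀)
        then 1 else σ.tab 2 a 0) ∧
      (τ.arr 1 a 0 = if ((0 < σ.tab 1 (σ.reg 5) 0 ∧ σ.reg 5 ≤ j₀ ∧
        σ.tab 0 (σ.reg 5) (σ.reg 5) ≠ σ.reg 5) ∧ (σ.coins.take k).all id) ∧
          (a = σ.reg 5 ∨ a = j₀)
        then σ.arr 0 (σ.reg 5) 0 * 2 ^ k else σ.arr 1 a 0) := by
  have hkl : k ≤ σ.reg 3 := hk ▸ lastPass_le _ _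
  refine (Runs.seq_agree (findInv_runs σ h1 h2 hj₀ h) fun τ hτ hτa => Runs.seq_agree
    (R := fun υ => υ.freg 2 = σ.freg 0 * σ.freg 0 ∧ υ.reg 7 = 0)
    (U := (σ.reg 3 * (60 * (σ.reg 0 + 1) ^ 3) + 2) + ((σ.reg 3 * 6 + 4) + 11)) (Runs.ops ?_)
    fun υ hυ hυa => Runs.seq_agree (R := fun ω => ω.reg 7 = k) ?_ fun ω hω hωa =>
      Runs.seq_agree ((flip_runs ω ?_ ?_ ?_).mono ?_ fun _ => id) fun ρ hρ hρa =>
        (emitIf_runs ρ ?_ ?_).agree.mono ?_ fun π hπ => ?_).mono ?_ fun _ => id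
  · simp [Op.run, hτa.freg 0 (by decide)]
  · refine (chooseExp_runs υ ?_ ?_ hυ.2 ?_ ?_ ?_).mono ?_ fun ω hω => ?_
    · rw [hυa.reg 1 (by decide), hτa.reg 1 (by decide), h1]
    · rw [hυa.reg 2 (by decide), hτa.reg 2 (by decide), h2]
    · rw [hυa.freg 1 (by decide), hτa.freg 1 (by decide), hf]
    · rw [hυa.freg 8 (by decide), hτa.freg 8 (by decide), hf8]
    · rw [hυa.freg 9 (by decide), hτa.freg 9 (by decide), hf9]
    · rw [hυa.reg 3 (by decide), hτa.reg 3 (by decide), hυa.reg 0 (by decide),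
        hτa.reg 0 (by decide)]
    · rw [hω, hυa.reg 3 (by decide), hτa.reg 3 (by decide), hυa.reg 0 (by decide),
        hτa.reg 0 (by decide), hυa.reg 5 (by decide), hτa.reg 5 (by decide), hυ.1,
        hυa.tab 0 (by decide), hτa.tab 0 (by decide), hυa.arr 0 (by decide),
        hτa.arr 0 (by decide), hυa.freg 3 (by decide), hτa.freg 3 (by decide), hk]
  · rw [hωa.reg 1 (by decide), hυa.reg 1 (by decide), hτa.reg 1 (by decide), h1]
  · rw [hωa.reg 2 (by decide), hυa.reg 2 (by decide), hτa.reg 2 (by decide), h2]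
  · rwa [hω, hωa.coins (by decide), hυa.coins (by decide), hτa.coins (by decide)]
  · rw [hω]; omega
  · rw [hρa.reg 1 (by decide), hωa.reg 1 (by decide), hυa.reg 1 (by decide),
      hτa.reg 1 (by decide), h1]
  · rw [hρa.reg 2 (by decide), hωa.reg 2 (by decide), hυa.reg 2 (by decide),
      hτa.reg 2 (by decide), h2]
  · exact le_rfl
  · have hcoins : ω.coins = σ.coins := by
      rw [hωa.coins (by decide), hυa.coins (by decide), hτa.coins (by decide)]
    have h5' : ω.reg 5 = σ.reg 5 := by
      rw [hωa.reg 5 (by decide), hυa.reg 5 (by decide), hτa.reg 5 (by decide)]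
    have h5 : ρ.reg 5 = σ.reg 5 := by rw [hρa.reg 5 (by decide), h5']
    have h6 : ρ.reg 6 = j₀ := by
      rw [hρa.reg 6 (by decide), hωa.reg 6 (by decide), hυa.reg 6 (by decide), hτ]
    have ht : ∀ k, k = 0 ∨ k = 1 ∨ k = 2 → ρ.tab k = σ.tab k := by
      rintro k (rfl | rfl | rfl) <;>
      rw [hρa.tab _ (by decide), hωa.tab _ (by decide), hυa.tab _ (by decide),
        hτa.tab _ (by decide)]
    have ha0 : ω.arr 0 = σ.arr 0 := by
      rw [hωa.arr _ (by decide), hυa.arr _ (by decide), hτa.arr _ (by decide)]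
    have ha1 : ρ.arr 1 = σ.arr 1 := by
      rw [hρa.arr _ (by decide), hωa.arr _ (by decide), hυa.arr _ (by decide),
        hτa.arr _ (by decide)]
    rw [hcoins, hω, ha0, h5'] at hρ
    refine ⟨by rw [hπ.2.coins (by decide), hρ.1], fun a => ?_⟩
    have h13 : 1 ≤ ρ.reg 13 ↔ (σ.coins.take k).all id = true := by
      rw [hρ.2.1]; split_ifs with hh <;> simp [hh]
    have := hπ.1 a
    rw [h5, h6, ht 0 (by simp), ht 1 (by simp), ht 2 (by simp), ha1, hρ.2.2] at this
    simpa only [h13] using this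
  · simp only [List.length]; omega

variable {G : Type u} [Group G] [Fintype G] [DecidableEq G]

/-! ### The input -/

/-- The weights, extended by zero. -/
def _root_.CayleyGraph.extWeight (H : CayleyGraph G) (g : G) : ℝ :=
  if g ∈ H.gens then H.weight g else 0

variable (e : G ≃ Fin (Fintype.card G)) (H : CayleyGraph G) (ε : ℝ)

theorem input_mul (ω : List Bool) (g h : G) :
    (input e H ε ω).tab 0 (e g) (e h) = e (g * h) := by
  simp [input]

theorem input_gens (ω : List Bool) (g : G) :
    0 < (input e H ε ω).tab 1 (e g) 0 ↔ g ∈ H.gens := by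
  have : 0 < Fintype.card G := Fintype.card_pos
  simp only [input, this, and_self, Fin.is_lt]
  by_cases h : g ∈ H.gens <;> simp [h]

theorem input_weight (ω : List Bool) (g : G) :
    (input e H ε ω).arr 0 (e g) 0 = H.extWeight g := by
  simp [input, CayleyGraph.extWeight]

omit [Group G] [DecidableEq G] in
theorem sum_range_card {M : Type*} [AddCommMonoid M] (f : ℕ → M) :
    ∑ i ∈ range (Fintype.card G), f i = ∑ g : G, f (e g) := by
  rw [← Fin.sum_univ_eq_sum_range, ← e.sum_comp]

theorem edgeMat_comm (u v a b : ℕ) : edgeMat u v a b = edgeMat v u a b := by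
  unfold edgeMat; ring

/-- The matrix of a generator. -/
def genMat (g : G) (a b : ℕ) : ℝ := ∑ h : G, edgeMat (e h) (e (h * g)) a b

omit [DecidableEq G] in
theorem genMat_inv (g : G) : genMat e g⁻¹ = genMat e g := by
  funext a b
  unfold genMat
  refine Fintype.sum_equiv (Equiv.mulRight g⁻¹) _ _ fun h => ?_
  simp only [Equiv.coe_mulRight, inv_mul_cancel_right]
  exact edgeMat_comm _ _ _ _

/-- The matrix that is tested for the generator `g`. -/
def testMat (θ c : ℝ) (g : G) (a b : ℕ) : ℝ :=
  θ * ∑ t : G, H.extWeight t * genMat e t a b - c * (H.extWeight g * genMat e g a b)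

theorem diffMat_input (ω : List Bool) (θ c : ℝ) (g : G) :
    diffMat (Fintype.card G) ((input e H ε ω).tab 0) (fun t => (input e H ε ω).arr 0 t 0) θ c
      (e g) = testMat e H θ c g := by
  funext a b
  simp only [diffMat, sum_range_card e, input_weight, input_mul, testMat, genMat, mul_sum]
  congr 1
  · refine sum_congr rfl fun t _ => sum_congr rfl fun u _ => by ring
  · refine sum_congr rfl fun u _ => by ring

/-- The number of coins that are flipped for the generator `g`. -/
def coinCount (C : ℕ) (g : G) : ℕ :=
  lastPass (fun k => elimDefect (Fintype.card G) (testMat e H (ε * ε / 2 ^ k)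
    (2 * C * Nat.clog 2 (Fintype.card G)) g) ≤ 0) (Nat.clog 2 (Fintype.card G))

omit [Fintype G] in
variable {H} in
theorem extWeight_inv (hH : H.IsUndirected) (g : G) : H.extWeight g⁻¹ = H.extWeight g := by
  have key : g⁻¹ ∈ H.gens ↔ g ∈ H.gens :=
    ⟨fun h => by simpa using (hH _ h).2.1, fun h => (hH _ h).2.1⟩
  unfold CayleyGraph.extWeight
  by_cases hg : g ∈ H.gens
  · rw [if_pos hg, if_pos (key.2 hg), (hH g hg).2.2]
  · rw [if_neg hg, if_neg (mt key.1 hg)]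

variable {H} in
-- The tested form depends only on the pair `{g, g⁻¹}`, so the weight computed for one element may
-- be stored for both.
theorem coinCount_inv (hH : H.IsUndirected) (C : ℕ) (g : G) :
    coinCount e H ε C g⁻¹ = coinCount e H ε C g := by
  have : ∀ θ c, testMat e H θ c g⁻¹ = testMat e H θ c g := by
    intro θ c
    funext a b
    rw [testMat, testMat, genMat_inv, extWeight_inv hH]
  simp only [coinCount, this]

/-- The representatives that can be kept: the first elements of the pairs, without `1`. -/
def candidates : Finset G := {g ∈ H.gens | e g ≤ e g⁻¹ ∧ g ≠ 1}

/-- Reads the coins: `k g` of them for every element of a list. The elements of `R` all of whose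
coins show heads are kept. -/
def kept (k : G → ℕ) (R : Finset G) : List G → List Bool → Finset G
  | [], _ => ∅
  | g :: gs, l =>
    if g ∈ R ∧ (l.take (k g)).all id then insert g (kept k R gs (l.drop (k g)))
    else kept k R gs (l.drop (k g))

omit [Group G] [Fintype G] in
theorem kept_subset (k : G → ℕ) (R : Finset G) (gs : List G) (l : List Bool) :
    kept k R gs l ⊆ R := by
  induction gs generalizing l with
  | nil => simp [kept]
  | cons g gs ih =>
    unfold kept
    split_ifs with h
    · exact insert_subset h.1 (ih _)
    · exact ih _

/-- The group, listed in the order of the numbering. -/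
def items : List G := (List.finRange (Fintype.card G)).map e.symm

/-- The graph of the kept pairs, reweighted. -/
def _root_.CayleyGraph.thinned (H : CayleyGraph G) (q : G → ℝ) (T : Finset G) : CayleyGraph G where
  gens := T ∪ T.image (·⁻¹)
  weight s := if s ∈ T ∪ T.image (·⁻¹) then H.weight s / q s else 0

/-- The probability with which the program keeps a generator. -/
def acceptProb (C : ℕ) (g : G) : ℝ := if g = 1 then 0 else (1 / 2) ^ coinCount e H ε C g

omit [Fintype G] in
theorem mem_union_image_inv {T : Finset G} {g : G} : g ∈ T ∪ T.image (·⁻¹) ↔ g ∈ T ∨ g⁻¹ ∈ T := by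
  simp [inv_eq_iff_eq_inv]

/-- The output arrays describe the pairs of the elements of `T`. -/
def Describes (C : ℕ) (T : Finset G) (τ : State) : Prop :=
  ∀ g, (τ.tab 2 (e g) 0 = if g ∈ T ∨ g⁻¹ ∈ T then 1 else 0) ∧
    (g ∈ T ∨ g⁻¹ ∈ T → τ.arr 1 (e g) 0 = H.extWeight g * 2 ^ coinCount e H ε C g)

variable {H ε} in
theorem Describes.output_eq {C : ℕ} {T : Finset G} {τ : State} (h : Describes e H ε C T τ)
    (hH : H.IsUndirected) (hT : T ⊆ candidates e H) :
    output e τ = H.thinned (acceptProb e H ε C) T := by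
  have key : ∀ g, τ.tab 2 (e g) 0 ≠ 0 ↔ g ∈ T ∪ T.image (·⁻¹) := by
    intro g
    rw [(h g).1, mem_union_image_inv]
    split_ifs with hh <;> simp [hh]
  ext g
  · simp only [output, mem_filter, mem_univ, true_and, key, CayleyGraph.thinned]
  · simp only [output, CayleyGraph.thinned, key]
    refine if_ctx_congr Iff.rfl (fun hg => ?_) fun _ => rfl
    rw [mem_union_image_inv] at hg
    rw [(h g).2 hg]
    have hg' : g ∈ H.gens ∧ g ≠ 1 := by
      rcases hg with hg | hg
      · have := hT hg
        simp only [candidates, mem_filter] at this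
        exact ⟨this.1, this.2.2⟩
      · have := hT hg
        simp only [candidates, mem_filter] at this
        exact ⟨by simpa using (hH _ this.1).2.1, by simpa using this.2.2⟩
    simp [acceptProb, hg'.2, CayleyGraph.extWeight, hg'.1, div_eq_mul_inv]

theorem Describes.insert {C : ℕ} {T : Finset G} {σ τ : State} (hH : H.IsUndirected)
    (h : Describes e H ε C T σ) (g : G)
    (hτ : ∀ a, (τ.tab 2 a 0 = if a = e g ∨ a = e g⁻¹ then 1 else σ.tab 2 a 0) ∧
      (τ.arr 1 a 0 = if a = e g ∨ a = e g⁻¹ then H.extWeight g * 2 ^ coinCount e H ε C g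
        else σ.arr 1 a 0)) :
    Describes e H ε C (insert g T) τ := by
  intro x
  rw [(hτ (e x)).1, (hτ (e x)).2, (h x).1]
  have e1 : ((e x : ℕ) = e g ∨ (e x : ℕ) = e g⁻¹) ↔ (x = g ∨ x = g⁻¹) := by
    simp [Fin.val_inj]
  have e2 : (x ∈ Insert.insert g T ∨ x⁻¹ ∈ Insert.insert g T) ↔
      ((x = g ∨ x = g⁻¹) ∨ (x ∈ T ∨ x⁻¹ ∈ T)) := by
    simp only [mem_insert, inv_eq_iff_eq_inv]; tauto
  simp only [e1, e2]
  by_cases hh : x = g ∨ x = g⁻¹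
  · simp only [hh, true_or, if_true, true_and, forall_const]
    rcases hh with rfl | rfl
    · rfl
    · rw [extWeight_inv hH, coinCount_inv e ε hH]
  · simp only [hh, false_or, if_false, true_and]
    exact (h x).2

/-- The state between the processing of two elements: the input is still there, and so are the
constants. -/
structure Loaded (C : ℕ) (ω : List Bool) (σ : State) : Prop where
  card : σ.reg 0 = Fintype.card G
  zero : σ.reg 1 = 0
  one : σ.reg 2 = 1
  log : σ.reg 3 = Nat.clog 2 (Fintype.card G)
  eps : σ.freg 0 = ε
  fzero : σ.freg 1 = 0
  coef : σ.freg 3 = 2 * C * Nat.clog 2 (Fintype.card G)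
  fone : σ.freg 8 = 1
  ftwo : σ.freg 9 = 2
  mul : σ.tab 0 = (input e H ε ω).tab 0
  gens : σ.tab 1 = (input e H ε ω).tab 1
  weight : σ.arr 0 = (input e H ε ω).arr 0

theorem coinCount_le (C : ℕ) (g : G) : coinCount e H ε C g ≤ Fintype.card G :=
  (lastPass_le _ _).trans (clog_two_le _)

variable {e H ε}

theorem Loaded.coinCount_eq {C : ℕ} {ω : List Bool} {σ : State} (h : Loaded e H ε C ω σ) (g : G)
    (hg : σ.reg 5 = e g) :
    coinCount e H ε C g = lastPass (Passes (σ.reg 0) (σ.tab 0) (fun t => σ.arr 0 t 0)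
        (σ.freg 0 * σ.freg 0) (σ.freg 3) (σ.reg 5)) (σ.reg 3) := by
  rw [h.card, h.log, h.eps, h.coef, h.mul, h.weight, hg]
  unfold Passes
  simp only [diffMat_input]
  rfl

theorem Loaded.processItem_runs {C : ℕ} {ω : List Bool} {σ : State} (h : Loaded e H ε C ω σ)
    (hH : H.IsUndirected) (g : G) (hg : σ.reg 5 = e g) {T : Finset G}
    (hT : Describes e H ε C T σ) (hc : coinCount e H ε C g ≤ σ.coins.length) :
    Runs processItem σ (Fintype.card G * 7 + Fintype.card G * (60 * (Fintype.card G + 1) ^ 3) +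
      Fintype.card G * 6 + 21) fun τ => τ.coins = σ.coins.drop (coinCount e H ε C g) ∧
        Describes e H ε C (if g ∈ candidates e H ∧ (σ.coins.take (coinCount e H ε C g)).all id
          then insert g T else T) τ := by
  have hl := clog_two_le (Fintype.card G)
  refine (RealRAM.processItem_runs σ h.zero h.one h.fzero h.fone h.ftwo (j₀ := e g⁻¹)
    (by rw [h.card]; exact (e g⁻¹).2) ?_ (h.coinCount_eq g hg) hc).mono ?_ fun ρ hρ => ?_
  · intro i hi
    rw [h.card] at hi
    obtain ⟨x, rfl⟩ : ∃ x : G, i = e x := ⟨e.symm ⟨i, hi⟩, by simp⟩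
    rw [h.mul, hg, input_mul, input_mul]
    simp only [Fin.val_inj, EmbeddingLike.apply_eq_iff_eq, mul_eq_left]
    exact ⟨fun h => eq_inv_of_mul_eq_one_right h, fun h => by simp [h]⟩
  · rw [h.card, h.log]
    gcongr
  · obtain ⟨hc, hout⟩ := hρ
    refine ⟨hc, ?_⟩
    have hw : σ.arr 0 (e g) 0 = H.extWeight g := by
      rw [h.weight, input_weight]
    have hcond : (0 < σ.tab 1 (σ.reg 5) 0 ∧ σ.reg 5 ≤ e g⁻¹ ∧
        σ.tab 0 (σ.reg 5) (σ.reg 5) ≠ σ.reg 5) ↔ g ∈ candidates e H := by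
      rw [h.mul, h.gens, hg, input_mul, input_gens]
      simp [candidates, Fin.val_inj]
    simp only [hcond] at hout
    simp only [hg, hw] at hout
    by_cases hh : g ∈ candidates e H ∧ (σ.coins.take (coinCount e H ε C g)).all id
    · rw [if_pos hh]
      refine hT.insert e H ε hH g fun a => ?_
      simpa only [hh, true_and] using hout a
    · rw [if_neg hh]
      intro x
      have h1 := (hout (e x)).1
      have h2 := (hout (e x)).2
      simp only [hh, false_and, if_false] at h1 h2
      rw [h1, h2]
      exact hT x

variable (e H ε)

omit [Group G] [DecidableEq G] in
theorem drop_items (g : G) : (items e).drop (e g) = g :: (items e).drop (e g + 1) := by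
  rw [List.drop_eq_getElem_cons (by simp [items])]
  simp [items]

theorem Loaded.of_agree {C : ℕ} {ω : List Bool} {σ τ : State} (h : Loaded e H ε C ω σ)
    (ha : Agree (forLoop 5 0 processItem) σ τ) : Loaded e H ε C ω τ where
  card := (ha.reg 0 (by decide)).trans h.card
  zero := (ha.reg 1 (by decide)).trans h.zero
  one := (ha.reg 2 (by decide)).trans h.one
  log := (ha.reg 3 (by decide)).trans h.log
  eps := (ha.freg 0 (by decide)).trans h.eps
  fzero := (ha.freg 1 (by decide)).trans h.fzero
  coef := (ha.freg 3 (by decide)).trans h.coef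
  fone := (ha.freg 8 (by decide)).trans h.fone
  ftwo := (ha.freg 9 (by decide)).trans h.ftwo
  mul := (ha.tab 0 (by decide)).trans h.mul
  gens := (ha.tab 1 (by decide)).trans h.gens
  weight := (ha.arr 0 (by decide)).trans h.weight

theorem processItems_runs {C : ℕ} {ω : List Bool} {σ : State} (h : Loaded e H ε C ω σ)
    (hH : H.IsUndirected) (hT : Describes e H ε C ∅ σ)
    (hω : Fintype.card G * Fintype.card G ≤ σ.coins.length) :
    Runs (forLoop 5 0 processItem) σ (Fintype.card G * (Fintype.card G * 7 +
      Fintype.card G * (60 * (Fintype.card G + 1) ^ 3) + Fintype.card G * 6 + 21 + 2) + 2) fun τ =>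
      Describes e H ε C (kept (coinCount e H ε C) (candidates e H) (items e) σ.coins) τ := by
  have main := (Runs.forLoop (r := 5) (b := 0) (p := processItem) (σ := σ)
    (T := Fintype.card G * 7 + Fintype.card G * (60 * (Fintype.card G + 1) ^ 3) +
      Fintype.card G * 6 + 21)
    -- The invariant: what has been kept, together with what the remaining coins will keep, is the
    -- final set. A reserve of `|G|` coins for every remaining element guarantees that no flip
    -- fails.
    (fun j υ => ∃ T : Finset G, T ∪ kept (coinCount e H ε C) (candidates e H)
      ((items e).drop j) υ.coins = kept (coinCount e H ε C) (candidates e H) (items e) σ.coins ∧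
      (Fintype.card G - j) * Fintype.card G ≤ υ.coins.length ∧ Describes e H ε C T υ) h.one
      (by decide) ⟨∅, by simp, by simpa using hω, hT⟩ fun j hj υ hυ hυj ⟨T, hT, hlen, hD⟩ => ?_)
  · rw [h.card] at main
    refine main.mono le_rfl fun τ ⟨T, hT, _, hD⟩ => ?_
    have : (items e).drop (Fintype.card G) = [] := List.drop_eq_nil_of_le (by simp [items])
    rw [this, kept, union_empty] at hT
    rwa [hT] at hD
  · rw [h.card] at hj
    obtain ⟨g, rfl⟩ : ∃ g : G, j = e g := ⟨e.symm ⟨j, hj⟩, by simp⟩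
    have hkl := coinCount_le e H ε C g
    have hkc : coinCount e H ε C g ≤ υ.coins.length :=
      hkl.trans (le_trans (Nat.le_mul_of_pos_left _ (by omega)) hlen)
    refine ((h.of_agree e H ε hυ).processItem_runs hH g hυj hD hkc).mono le_rfl ?_
    rintro ρ ⟨hc, hout⟩
    refine ⟨_, ?_, ?_, hout⟩
    · rw [drop_items, kept] at hT
      rw [State.setReg_coins, hc, ← hT]
      split_ifs
      · rw [insert_union, union_insert]
      · rfl
    · rw [State.setReg_coins, hc, List.length_drop]
      have : Fintype.card G - e g = (Fintype.card G - (e g + 1)) + 1 := by omega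
      rw [this, Nat.succ_mul] at hlen
      omega

theorem sampler_time {n : ℕ} (hn1 : 1 ≤ n) :
    n * 5 + 11 + (n * (n * 7 + n * (60 * (n + 1) ^ 3) + n * 6 + 21 + 2) + 2) ≤ 6400 * n ^ 5 := by
  have h6 : (n + 1) ^ 3 ≤ 8 * n ^ 3 := by
    calc (n + 1) ^ 3 ≤ (2 * n) ^ 3 := Nat.pow_le_pow_left (by omega) 3
      _ = 8 * n ^ 3 := by ring
  have p1 : n ≤ n ^ 5 := Nat.le_self_pow (by norm_num) n
  have p2 : n ^ 2 ≤ n ^ 5 := Nat.pow_le_pow_right hn1 (by norm_num)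
  have p0 : 1 ≤ n ^ 5 := Nat.one_le_pow _ _ hn1
  have : n * (n * 7 + n * (60 * (n + 1) ^ 3) + n * 6 + 21 + 2) ≤ 516 * n ^ 5 := by
    calc n * (n * 7 + n * (60 * (n + 1) ^ 3) + n * 6 + 21 + 2)
        ≤ n * (n * 7 + n * (60 * (8 * n ^ 3)) + n * 6 + 21 + 2) := by gcongr
      _ = 13 * n ^ 2 + 480 * n ^ 5 + 23 * n := by ring
      _ ≤ _ := by omega
  omega

theorem sampler_runs (C : ℕ) (hH : H.IsUndirected) (ω : List Bool)
    (hω : Fintype.card G * Fintype.card G ≤ ω.length) :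
    Runs (sampler C) (input e H ε ω) (6400 * Fintype.card G ^ 5) fun τ =>
      output e τ = H.thinned (acceptProb e H ε C)
        (kept (coinCount e H ε C) (candidates e H) (items e) ω) := by
  refine (Runs.seq_agree (setup_runs C _ (by simp [input])) fun τ hτ hτa' =>
    -- The targets of `setup C` do not depend on `C`; with a numeral they are closed lists on which
    -- `decide` works.
    have hτa : Agree (setup 0) (input e H ε ω) τ :=
      ⟨hτa'.reg, hτa'.freg, hτa'.tab, hτa'.arr, hτa'.coins⟩
    (processItems_runs e H ε (C := C) (ω := ω) ⟨?_, ?_, hτ.1, ?_, ?_, ?_, ?_, hτ.2.2.1,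
      hτ.2.2.2.1, hτa.tab 0 (by decide), hτa.tab 1 (by decide), hτa.arr 0 (by decide)⟩ hH
      (fun g => ?_) ?_).mono le_rfl fun υ hυ => ?_).mono ?_ fun _ => id
  · rw [hτa.reg 0 (by decide)]; simp [input]
  · rw [hτa.reg 1 (by decide)]; simp [input]
  · rw [hτ.2.1]; simp [input]
  · rw [hτa.freg 0 (by decide)]; simp [input]
  · rw [hτa.freg 1 (by decide)]; simp [input]
  · rw [hτ.2.2.2.2]; simp [input]
  · simp [hτa.tab 2 (by decide), input]
  · rwa [hτa.coins (by decide)]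
  · rw [hυ.output_eq e hH (kept_subset _ _ _ _), hτa.coins (by decide)]
    rfl
  · have e0 : (input e H ε ω).reg 0 = Fintype.card G := by simp [input]
    rw [e0]
    exact sampler_time Fintype.card_pos

end RealRAM

namespace RealRAM

/-! ### Elimination decides positive semidefiniteness -/

/-- The quadratic form of the matrix `M`. -/
def quad (n : ℕ) (M : ℕ → ℕ → ℝ) (x : ℕ → ℝ) : ℝ :=
  ∑ a ∈ range n, ∑ b ∈ range n, M a b * x a * x b

/-- Row `p` of the matrix `M`, applied to `x`. -/
def rowMul (n : ℕ) (M : ℕ → ℕ → ℝ) (p : ℕ) (x : ℕ → ℝ) : ℝ := ∑ b ∈ range n, M p b * x b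

theorem elim_symm {M : ℕ → ℕ → ℝ} (hM : ∀ a b, M a b = M b a) (p a b : ℕ) :
    elim M p a b = elim M p b a := by
  cases p with
  | zero => exact hM a b
  | succ p => 
    have ih := fun a b => elim_symm hM p a b
    simp only [elim, ih a b]
    ring

/-- Elimination removes one square from the form. For a zero pivot nothing is removed, since
division by `0` gives `0` on both sides. -/
theorem quad_elim_succ (n : ℕ) (M : ℕ → ℕ → ℝ) (p : ℕ) (x : ℕ → ℝ) :
    quad n (elim M (p + 1)) x =
      quad n (elim M p) x - rowMul n (elim M p) p x ^ 2 / elim M p p p := by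
  simp only [quad, rowMul, elim, sq, sum_mul_sum, sum_div, ← sum_sub_distrib]
  refine sum_congr rfl fun a _ => sum_congr rfl fun b _ => by ring

theorem quad_add_single {n : ℕ} {M : ℕ → ℕ → ℝ} (hM : ∀ a b, M a b = M b a) {p : ℕ} (hp : p < n)
    (x : ℕ → ℝ) (t : ℝ) :
    quad n M (fun a => x a + if a = p then t else 0) =
      quad n M x + 2 * t * rowMul n M p x + t ^ 2 * M p p := by
  have hp' := mem_range.2 hp
  have e : ∀ a b, M a b * (x a + if a = p then t else 0) * (x b + if b = p then t else 0) =
      M a b * x a * x b + (if b = p then t * (M a b * x a) else 0) +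
        (if a = p then t * (M a b * x b) else 0) +
        (if a = p then (if b = p then t ^ 2 * M a b else 0) else 0) := by
    intro a b; split_ifs <;> ring
  simp only [quad, e, sum_add_distrib]
  rw [sum_comm (f := fun a b => if a = p then t * (M a b * x b) else 0)]
  have h1 : ∑ a ∈ range n, ∑ b ∈ range n, (if b = p then t * (M a b * x a) else 0) =
      t * rowMul n M p x := by
    rw [rowMul, mul_sum]
    refine sum_congr rfl fun a _ => ?_
    rw [sum_ite_eq' _ _, if_pos hp', hM a p]
  have h2 : ∑ b ∈ range n, ∑ a ∈ range n, (if a = p then t * (M a b * x b) else 0) =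
      t * rowMul n M p x := by
    rw [rowMul, mul_sum]
    refine sum_congr rfl fun a _ => ?_
    rw [sum_ite_eq' _ _, if_pos hp']
  have h3 : ∑ a ∈ range n, ∑ b ∈ range n,
      (if a = p then (if b = p then t ^ 2 * M a b else 0) else 0) = t ^ 2 * M p p := by
    simp [sum_ite_eq', hp]
  rw [h1, h2, h3]
  ring

theorem rowMul_single {n : ℕ} {M : ℕ → ℕ → ℝ} (p : ℕ) {b : ℕ} (hb : b < n) :
    rowMul n M p (fun a => if a = b then 1 else 0) = M p b := by
  simp [rowMul, hb]

theorem quad_zero_single {n : ℕ} {M : ℕ → ℕ → ℝ} (hM : ∀ a b, M a b = M b a) {p : ℕ} (hp : p < n) :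
    quad n M (fun a => if a = p then 1 else 0) = M p p := by
  have := quad_add_single hM hp (fun _ => 0) 1
  simp only [zero_add] at this
  rw [this]
  simp [quad, rowMul]

/-- A Schur complement of a positive semidefinite form is positive semidefinite, and a zero pivot in
such a form forces its whole row to vanish, so skipping it loses nothing. -/
theorem quad_elim_nonneg {n : ℕ} {M : ℕ → ℕ → ℝ} (hM : ∀ a b, M a b = M b a)
    (h : ∀ x, 0 ≤ quad n M x) :
    ∀ p ≤ n, (∀ x, 0 ≤ quad n (elim M p) x) ∧ ∀ a < p, ∀ b < n, elim M p a b = 0 := by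
  intro p
  induction p with
  | zero => exact fun _ => ⟨h, by simp⟩
  | succ p ih =>
    intro hp
    have hp' : p < n := hp
    obtain ⟨h1, h2⟩ := ih hp'.le
    have hs := elim_symm hM p
    have hpiv : 0 ≤ elim M p p p := by rw [← quad_zero_single hs hp']; exact h1 _
    rcases hpiv.eq_or_lt with h0 | hpos
    · have hrow : ∀ b < n, elim M p p b = 0 := by
        intro b hb
        by_contra hne
        -- With a zero pivot and a nonzero entry, this multiple of the pivot vector gives the form
        -- the value `-1`.
        have := h1 fun a => (if a = b then 1 else 0) +
          if a = p then -(elim M p b b + 1) / (2 * elim M p p b) else 0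
        rw [quad_add_single hs hp', rowMul_single p hb, quad_zero_single hs hb, ← h0] at this
        have e : 2 * (-(elim M p b b + 1) / (2 * elim M p p b)) * elim M p p b =
            -(elim M p b b + 1) := by field_simp
        rw [e] at this
        linarith
      have e : ∀ a b, elim M (p + 1) a b = elim M p a b := by
        intro a b; simp [elim, ← h0]
      have e' : elim M (p + 1) = elim M p := by funext a b; exact e a b
      rw [e']
      refine ⟨h1, fun a ha b hb => ?_⟩
      rcases Nat.lt_succ_iff_lt_or_eq.1 ha with ha | rfl
      · exact h2 a ha b hb
      · exact hrow b hb
    · constructor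
      · intro x
        -- The minimizer along the pivot coordinate; the minimum is the eliminated form at `x`.
        have := h1 fun a => x a + if a = p then -(rowMul n (elim M p) p x / elim M p p p) else 0
        rw [quad_add_single hs hp'] at this
        rw [quad_elim_succ]
        convert this using 1
        field_simp
        ring
      · intro a ha b hb
        rcases Nat.lt_succ_iff_lt_or_eq.1 ha with ha | rfl
        · rw [elim, h2 a ha b hb, hs p a, h2 a ha p hp']; simp
        · rw [elim]; field_simp; ring

/-- If all pivots are nonnegative and nothing remains at the end, the form has been written as a sum
of nonnegative multiples of squares. Without the second condition a zero pivot with a nonzero row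
would go unnoticed. -/
theorem elimDefect_nonpos_iff {n : ℕ} {M : ℕ → ℕ → ℝ} (hM : ∀ a b, M a b = M b a) :
    elimDefect n M ≤ 0 ↔ ∀ x, 0 ≤ quad n M x := by
  have hA : 0 ≤ ∑ p ∈ range n, (if 0 ≤ elim M p p p then (0 : ℝ) else 1) :=
    sum_nonneg fun p _ => by split_ifs <;> norm_num
  have hB : 0 ≤ ∑ a ∈ range n, ∑ b ∈ range n, elim M n a b ^ 2 :=
    sum_nonneg fun a _ => sum_nonneg fun b _ => sq_nonneg _
  constructor
  · intro h x
    have hA0 : ∑ p ∈ range n, (if 0 ≤ elim M p p p then (0 : ℝ) else 1) = 0 := by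
      unfold elimDefect at h; linarith
    have hB0 : ∑ a ∈ range n, ∑ b ∈ range n, elim M n a b ^ 2 = 0 := by
      unfold elimDefect at h; linarith
    have hpiv : ∀ p < n, 0 ≤ elim M p p p := by
      intro p hp
      have := (sum_eq_zero_iff_of_nonneg fun p _ => by split_ifs <;> norm_num).1 hA0 p
        (mem_range.2 hp)
      by_contra hneg
      simp [hneg] at this
    have hfin : quad n (elim M n) x = 0 := by
      refine sum_eq_zero fun a ha => sum_eq_zero fun b hb => ?_
      have h1 := (sum_eq_zero_iff_of_nonneg fun a _ => sum_nonneg fun b _ => sq_nonneg _).1 hB0 a ha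
      have h2 := (sum_eq_zero_iff_of_nonneg fun b _ => sq_nonneg _).1 h1 b hb
      rw [pow_eq_zero_iff two_ne_zero] at h2
      simp [h2]
    -- Backwards from the final zero matrix: every step restores a square divided by a nonnegative
    -- pivot.
    have key : ∀ p ≤ n, 0 ≤ quad n (elim M (n - p)) x := by
      intro p
      induction p with
      | zero => intro _; rw [Nat.sub_zero, hfin]
      | succ p ih =>
        intro hp
        have h1 := ih (by omega)
        have e : n - p = (n - (p + 1)) + 1 := by omega
        rw [e, quad_elim_succ] at h1
        have := div_nonneg (sq_nonneg (rowMul n (elim M (n - (p + 1))) (n - (p + 1)) x))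
          (hpiv (n - (p + 1)) (by omega))
        linarith
    simpa [quad, elim] using key n le_rfl
  · intro h
    have key := quad_elim_nonneg hM h
    refine (add_eq_zero_iff_of_nonneg hA hB).2 ⟨?_, ?_⟩ |>.le
    · refine sum_eq_zero fun p hp => if_pos ?_
      have hp := mem_range.1 hp
      rw [← quad_zero_single (elim_symm hM p) hp]
      exact (key p hp.le).1 _
    · refine sum_eq_zero fun a ha => sum_eq_zero fun b hb => ?_
      rw [(key n le_rfl).2 a (mem_range.1 ha) b (mem_range.1 hb)]
      norm_num

end RealRAM

/-! ### Independent sampling -/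

namespace CayleyGraph

variable {G : Type u} [DecidableEq G]

/-- The expectation of `F T`, if every element `s` of `R` belongs to `T` with probability `q s`,
independently of the others. -/
def sampleExp (R : Finset G) (q : G → ℝ) (F : Finset G → ℝ) : ℝ :=
  ∑ T ∈ R.powerset, (∏ s ∈ T, q s) * (∏ s ∈ R \ T, (1 - q s)) * F T

theorem sampleExp_empty (q : G → ℝ) (F : Finset G → ℝ) : sampleExp ∅ q F = F ∅ := by
  simp [sampleExp]

/-- Conditioning on a single generator; nearly everything about the product measure is derived from
this recursion. -/
theorem sampleExp_insert {R : Finset G} {q : G → ℝ} {s : G} (hs : s ∉ R) (F : Finset G → ℝ) :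
    sampleExp (insert s R) q F =
      q s * sampleExp R q (fun T => F (insert s T)) + (1 - q s) * sampleExp R q F := by
  unfold sampleExp
  rw [sum_powerset_insert hs, add_comm, mul_sum, mul_sum]
  congr 1
  · refine sum_congr rfl fun T hT => ?_
    have hT := mem_powerset.1 hT
    have hsT : s ∉ T := fun h => hs (hT h)
    rw [prod_insert hsT, insert_sdiff_insert, sdiff_insert_of_notMem hs]
    ring
  · refine sum_congr rfl fun T hT => ?_
    have hT := mem_powerset.1 hT
    have hsT : s ∉ T := fun h => hs (hT h)
    rw [insert_sdiff_of_notMem _ hsT, prod_insert (by simp [hs])]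
    ring

theorem sampleExp_congr {R : Finset G} {q q' : G → ℝ} {F F' : Finset G → ℝ}
    (hq : ∀ s ∈ R, q s = q' s) (hF : ∀ T ⊆ R, F T = F' T) : sampleExp R q F = sampleExp R q' F' := by
  refine sum_congr rfl fun T hT => ?_
  have hT := mem_powerset.1 hT
  have h1 : ∏ s ∈ T, q s = ∏ s ∈ T, q' s := prod_congr rfl fun s hs => hq s (hT hs)
  have h2 : ∏ s ∈ R \ T, (1 - q s) = ∏ s ∈ R \ T, (1 - q' s) :=
    prod_congr rfl fun s hs => by rw [hq s (sdiff_subset hs)]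
  rw [hF T hT, h1, h2]

theorem sampleExp_mono {R : Finset G} {q : G → ℝ} (hq : ∀ s ∈ R, 0 ≤ q s ∧ q s ≤ 1)
    {F F' : Finset G → ℝ} (hF : ∀ T ⊆ R, F T ≤ F' T) : sampleExp R q F ≤ sampleExp R q F' := by
  refine sum_le_sum fun T hT => ?_
  have hT := mem_powerset.1 hT
  refine mul_le_mul_of_nonneg_left (hF T hT) (mul_nonneg ?_ ?_)
  · exact prod_nonneg fun s hs => (hq s (hT hs)).1
  · exact prod_nonneg fun s hs => sub_nonneg.2 (hq s (sdiff_subset hs)).2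

theorem sampleExp_add (R : Finset G) (q : G → ℝ) (F F' : Finset G → ℝ) :
    sampleExp R q (fun T => F T + F' T) = sampleExp R q F + sampleExp R q F' := by
  simp only [sampleExp, mul_add, sum_add_distrib]

theorem sampleExp_const_mul (R : Finset G) (q : G → ℝ) (c : ℝ) (F : Finset G → ℝ) :
    sampleExp R q (fun T => c * F T) = c * sampleExp R q F := by
  simp only [sampleExp, mul_sum]
  exact sum_congr rfl fun T _ => by ring

theorem sampleExp_sum {ι : Type*} (I : Finset ι) (R : Finset G) (q : G → ℝ) (F : ι → Finset G → ℝ) :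
    sampleExp R q (fun T => ∑ i ∈ I, F i T) = ∑ i ∈ I, sampleExp R q (F i) := by
  simp only [sampleExp, mul_sum]
  exact sum_comm

theorem sampleExp_const (R : Finset G) (q : G → ℝ) (c : ℝ) : sampleExp R q (fun _ => c) = c := by
  induction R using Finset.induction_on with
  | empty => exact sampleExp_empty _ _
  | insert s R hs ih => rw [sampleExp_insert hs, ih]; ring

end CayleyGraph

/-! ### Fair coin flips and the law of the kept set -/

namespace RealRAM

open CayleyGraph

/-- The average of `F` over the outcomes of `T` coin flips. -/
def avg (T : ℕ) (F : List Bool → ℝ) : ℝ := (∑ ω : Fin T → Bool, F (List.ofFn ω)) / 2 ^ T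

theorem avg_succ (T : ℕ) (F : List Bool → ℝ) :
    avg (T + 1) F = (avg T (fun l => F (true :: l)) + avg T (fun l => F (false :: l))) / 2 := by
  unfold avg
  rw [← (Fin.consEquiv fun _ => Bool).sum_comp, Fintype.sum_prod_type, Fintype.sum_bool]
  simp [Fin.consEquiv, List.ofFn_succ, pow_succ]
  ring

/-- A block of `k` coins shows only heads with probability `2⁻ᵏ`, independently of the coins after
it. -/
theorem avg_block (k T : ℕ) (F : Bool → List Bool → ℝ) :
    avg (k + T) (fun l => F ((l.take k).all id) (l.drop k)) =
      (1 / 2) ^ k * avg T (F true) + (1 - (1 / 2) ^ k) * avg T (F false) := by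
  induction k generalizing F with
  | zero => simp
  | succ k ih =>
    rw [show k + 1 + T = (k + T) + 1 by ring, avg_succ]
    have h1 := ih F
    have h2 := ih fun _ => F false
    simp only [List.take_succ_cons, List.drop_succ_cons, List.all_cons, id, Bool.true_and,
      Bool.false_and] at h1 h2 ⊢
    rw [h1, h2, pow_succ]
    ring

variable {G : Type u} [DecidableEq G]

/-- Different elements read disjoint blocks of coins, which yields independence. Elements outside
`R` consume coins without effect, and surplus coins average out. -/
theorem avg_kept (k : G → ℕ) (R : Finset G) (gs : List G) (hgs : gs.Nodup) (T : ℕ)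
    (hT : (gs.map k).sum ≤ T) (F : Finset G → ℝ) :
    avg T (fun l => F (kept k R gs l)) =
      sampleExp {g ∈ R | g ∈ gs} (fun g => (1 / 2) ^ k g) F := by
  induction gs generalizing T F with
  | nil => simp [kept, avg, sampleExp_empty]
  | cons g gs ih =>
    rw [List.nodup_cons] at hgs
    simp only [List.map_cons, List.sum_cons] at hT
    obtain ⟨U, rfl⟩ := Nat.exists_eq_add_of_le (show k g ≤ T by omega)
    have hU : (gs.map k).sum ≤ U := by omega
    have h1 := ih hgs.2 U hU F
    have h2 := ih hgs.2 U hU fun A => F (insert g A)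
    by_cases hg : g ∈ R
    · have e : R.filter (· ∈ g :: gs) = insert g (R.filter (· ∈ gs)) := by
        ext x; simp only [mem_filter, List.mem_cons, mem_insert]
        constructor
        · tauto
        · rintro (rfl | h) <;> tauto
      rw [e, sampleExp_insert (by simp [hgs.1]), ← h1, ← h2]
      simp only [kept, hg, true_and]
      have := avg_block (k g) U fun b l => if b then F (insert g (kept k R gs l))
        else F (kept k R gs l)
      simp only [if_true, Bool.false_eq_true, if_false] at this
      rw [← this]
      congr 1
      funext l
      split_ifs <;> rfl
    · have e : R.filter (· ∈ g :: gs) = R.filter (· ∈ gs) := by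
        ext x; simp only [mem_filter, List.mem_cons]
        constructor
        · rintro ⟨h, rfl | h'⟩
          · exact absurd h hg
          · exact ⟨h, h'⟩
        · tauto
      rw [e, ← h1]
      simp only [kept, hg, false_and, if_false]
      rw [avg_block (k g) U fun _ l => F (kept k R gs l)]
      ring

end RealRAM

namespace CayleyGraph

variable {G : Type u} [Group G] [Fintype G] [DecidableEq G]

/-! ### The energy of a generator -/

omit [DecidableEq G] in
/-- The squared distance between `x` and its translate by `g`. -/
def genEnergy (g : G) (x : G → ℝ) : ℝ := ∑ u : G, (x u - x (u * g)) ^ 2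

omit [DecidableEq G] in
theorem genEnergy_nonneg (g : G) (x : G → ℝ) : 0 ≤ genEnergy g x :=
  sum_nonneg fun _ _ => sq_nonneg _

omit [DecidableEq G] in
@[simp] theorem genEnergy_one (x : G → ℝ) : genEnergy 1 x = 0 := by simp [genEnergy]

omit [DecidableEq G] in
theorem genEnergy_inv (g : G) (x : G → ℝ) : genEnergy g⁻¹ x = genEnergy g x := by
  unfold genEnergy
  refine Fintype.sum_equiv (Equiv.mulRight g⁻¹) _ _ fun u => ?_
  simp only [Equiv.coe_mulRight, inv_mul_cancel_right]
  ring

theorem energy_eq (H : CayleyGraph G) (x : G → ℝ) :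
    H.energy x = (1 / 2) * ∑ g : G, H.extWeight g * genEnergy g x := by
  unfold energy genEnergy
  congr 1
  simp only [mul_sum]
  conv_rhs => rw [sum_comm]
  refine sum_congr rfl fun u _ => (Fintype.sum_equiv (Equiv.mulLeft u) _ _ fun g => ?_).symm
  simp only [Equiv.coe_mulLeft, inv_mul_cancel_left, extWeight]
  split_ifs <;> ring

omit [Fintype G] in
theorem IsUndirected.extWeight_nonneg {H : CayleyGraph G} (hH : H.IsUndirected) (g : G) :
    0 ≤ H.extWeight g := by
  unfold extWeight
  split_ifs with h
  · exact (hH g h).1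
  · exact le_rfl

theorem IsUndirected.energy_nonneg {H : CayleyGraph G} (hH : H.IsUndirected) (x : G → ℝ) :
    0 ≤ H.energy x := by
  rw [energy_eq]
  have : 0 ≤ ∑ g : G, H.extWeight g * genEnergy g x :=
    sum_nonneg fun g _ => mul_nonneg (hH.extWeight_nonneg g) (genEnergy_nonneg g x)
  linarith

/-- The energy of the pair of `g` and its inverse, each edge counted once. -/
def pairEnergy (g : G) (x : G → ℝ) : ℝ := if g⁻¹ = g then genEnergy g x / 2 else genEnergy g x

theorem pairEnergy_nonneg (g : G) (x : G → ℝ) : 0 ≤ pairEnergy g x := by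
  have := genEnergy_nonneg g x
  unfold pairEnergy; split_ifs <;> linarith

theorem pairEnergy_le (g : G) (x : G → ℝ) : pairEnergy g x ≤ genEnergy g x := by
  have := genEnergy_nonneg g x
  unfold pairEnergy; split_ifs <;> linarith

theorem genEnergy_le (g : G) (x : G → ℝ) : genEnergy g x ≤ 2 * pairEnergy g x := by
  have := genEnergy_nonneg g x
  unfold pairEnergy; split_ifs <;> linarith

omit [Fintype G] in
theorem sum_half {R S : Finset G} (hS : ∀ s ∈ S, s⁻¹ ∈ S) (hR : IsHalf R S) (f : G → ℝ)
    (hf : ∀ s ∈ S, f s⁻¹ = f s) :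
    ∑ s ∈ S, f s = ∑ s ∈ R, if s⁻¹ = s then f s else 2 * f s := by
  obtain ⟨hRS, hcov, hinj⟩ := hR
  have e : S = R ∪ (R.filter fun s => s⁻¹ ≠ s).image (·⁻¹) := by
    ext s
    simp only [mem_union, mem_image, mem_filter]
    constructor
    · intro hs
      rcases hcov s hs with h | h
      · exact .inl h
      · by_cases hh : s⁻¹ = s
        · exact .inl (hh ▸ h)
        · exact .inr ⟨s⁻¹, ⟨h, by simpa using Ne.symm hh⟩, inv_inv s⟩
    · rintro (h | ⟨t, ⟨ht, -⟩, rfl⟩)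
      · exact hRS h
      · exact hS t (hRS ht)
  have hd : Disjoint R ((R.filter fun s => s⁻¹ ≠ s).image (·⁻¹)) := by
    rw [disjoint_left]
    intro s hs h
    simp only [mem_image, mem_filter] at h
    obtain ⟨t, ⟨ht, hne⟩, rfl⟩ := h
    exact hne (hinj t ht hs)
  rw [e, sum_union hd, sum_image (by simp), sum_filter, ← sum_add_distrib]
  refine sum_congr rfl fun s hs => ?_
  by_cases hh : s⁻¹ = s
  · simp [hh]
  · simp only [hh, ne_eq, not_false_eq_true, if_true, if_false]
    rw [hf s (hRS hs)]; ring

/-- One summand per independent decision of the sampling: an involution occurs once among the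
generators and every other pair twice, which `pairEnergy` compensates. -/
theorem energy_eq_sum_half {H : CayleyGraph G} (hH : H.IsUndirected) {R : Finset G}
    (hR : IsHalf R H.gens) (x : G → ℝ) :
    H.energy x = ∑ s ∈ R, H.weight s * pairEnergy s x := by
  have h1 : ∑ g : G, H.extWeight g * genEnergy g x = ∑ g ∈ H.gens, H.weight g * genEnergy g x := by
    simp only [extWeight, ite_mul, zero_mul, sum_ite_mem, univ_inter]
  rw [energy_eq, h1, sum_half (fun s hs => (hH s hs).2.1) hR _ fun s hs => by
    rw [(hH s hs).2.2, genEnergy_inv], mul_sum]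
  refine sum_congr rfl fun s _ => ?_
  unfold pairEnergy
  split_ifs <;> ring

/-- The complete set of representatives that come first in a numbering. -/
def firstHalf (e : G ≃ Fin (Fintype.card G)) (S : Finset G) : Finset G := {g ∈ S | e g ≤ e g⁻¹}

omit [DecidableEq G] in
theorem isHalf_firstHalf (e : G ≃ Fin (Fintype.card G)) {S : Finset G} (hS : ∀ s ∈ S, s⁻¹ ∈ S) :
    IsHalf (firstHalf e S) S := by
  refine ⟨filter_subset _ _, fun s hs => ?_, fun s hs hs' => ?_⟩
  · simp only [firstHalf, mem_filter, inv_inv]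
    rcases le_total (e s) (e s⁻¹) with h | h
    · exact .inl ⟨hs, h⟩
    · exact .inr ⟨hS s hs, h⟩
  · simp only [firstHalf, mem_filter, inv_inv] at hs hs'
    exact e.injective (le_antisymm hs'.2 hs.2)

/-- The program never outputs the identity. Giving it probability `0` reconciles this with the
complete set of representatives that importance sampling requires. -/
theorem firstHalf_candidates (e : G ≃ Fin (Fintype.card G)) (H : CayleyGraph G) (q : G → ℝ)
    (hq : q 1 = 0) (F : Finset G → ℝ) :
    sampleExp (firstHalf e H.gens) q F = sampleExp (RealRAM.candidates e H) q F := by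
  by_cases h : 1 ∈ firstHalf e H.gens
  · have : firstHalf e H.gens = insert 1 (RealRAM.candidates e H) := by
      ext g
      simp only [firstHalf, RealRAM.candidates, mem_filter, mem_insert] at h ⊢
      by_cases hg : g = 1
      · simp [hg, h]
      · simp [hg]
    rw [this, sampleExp_insert (by simp [RealRAM.candidates]), hq]
    ring
  · congr 1
    ext g
    simp only [firstHalf, RealRAM.candidates, mem_filter] at h ⊢
    constructor
    · rintro ⟨h1, h2⟩
      exact ⟨h1, h2, by rintro rfl; simp [h1] at h⟩
    · rintro ⟨h1, h2, -⟩
      exact ⟨h1, h2⟩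

end CayleyGraph

/-! ### The spectral meaning of the tests and the law of the output -/

namespace RealRAM

open CayleyGraph

variable {G : Type u} [Group G] [Fintype G] [DecidableEq G]

variable (e : G ≃ Fin (Fintype.card G)) (H : CayleyGraph G) (ε : ℝ)

omit [DecidableEq G] in
theorem quad_genMat (g : G) (x : ℕ → ℝ) :
    quad (Fintype.card G) (genMat e g) x = genEnergy g fun h => x (e h) := by
  have key : ∀ u v : G, ∑ a : G, ∑ b : G, edgeMat (e u) (e v) (e a) (e b) * x (e a) * x (e b) =
      (x (e u) - x (e v)) ^ 2 := by
    intro u v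
    have h1 : ∑ a : G, ((if (e a : ℕ) = e u then (1 : ℝ) else 0) - if (e a : ℕ) = e v then 1 else 0)
        * x (e a) = x (e u) - x (e v) := by
      classical
      simp [sub_mul, Fin.val_inj, sum_sub_distrib]
    rw [← h1, sq, sum_mul_sum]
    refine sum_congr rfl fun a _ => sum_congr rfl fun b _ => ?_
    unfold edgeMat
    ring
  unfold quad genEnergy genMat
  simp only [sum_range_card e, sum_mul]
  rw [sum_congr rfl fun a _ => sum_comm, sum_comm]
  exact sum_congr rfl fun h _ => key h (h * g)

theorem quad_testMat (θ c : ℝ) (g : G) (x : ℕ → ℝ) :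
    quad (Fintype.card G) (testMat e H θ c g) x = θ * (2 * H.energy fun h => x (e h)) -
      c * (H.extWeight g * genEnergy g fun h => x (e h)) := by
  rw [energy_eq]
  simp only [← quad_genMat, quad, testMat, sub_mul, sum_sub_distrib, mul_sum, sum_mul]
  congr 1
  · rw [sum_congr rfl fun a _ => sum_comm, sum_comm]
    refine sum_congr rfl fun g _ => sum_congr rfl fun a _ => sum_congr rfl fun b _ => by ring
  · refine sum_congr rfl fun a _ => sum_congr rfl fun b _ => by ring

theorem testMat_symm (θ c : ℝ) (g : G) (a b : ℕ) :
    testMat e H θ c g a b = testMat e H θ c g b a := by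
  have : ∀ g, genMat e g a b = genMat e g b a := fun g => by
    unfold genMat edgeMat
    exact sum_congr rfl fun _ _ => mul_comm _ _
  simp only [testMat, this]

/-- This is what the elimination test decides. The `2` appears because summing over all group
elements meets every edge of the graph twice. -/
theorem elimDefect_testMat (θ c : ℝ) (g : G) :
    elimDefect (Fintype.card G) (testMat e H θ c g) ≤ 0 ↔
      ∀ y : G → ℝ, c * (H.extWeight g * genEnergy g y) ≤ θ * (2 * H.energy y) := by
  rw [elimDefect_nonpos_iff (testMat_symm e H θ c g)]
  simp only [quad_testMat, sub_nonneg]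
  constructor
  · intro h y
    have := h fun i => if hi : i < Fintype.card G then y (e.symm ⟨i, hi⟩) else 0
    simpa using this
  · exact fun h x => h _

/-- The chosen exponent passes and its successor fails, up to the two ends of the range. No
monotonicity of the test is needed. -/
theorem lastPass_spec (P : ℕ → Prop) (l : ℕ) :
    (lastPass P l = 0 ∨ P (lastPass P l)) ∧ (lastPass P l = l ∨ ¬ P (lastPass P l + 1)) := by
  induction l with
  | zero => simp [lastPass]
  | succ l ih =>
    unfold lastPass
    split_ifs with h
    · simp [h]
    · refine ⟨ih.1, .inr ?_⟩
      rcases ih.2 with h' | h'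
      · rwa [h']
      · exact h'

theorem acceptProb_mem (C : ℕ) (g : G) :
    0 ≤ acceptProb e H ε C g ∧ acceptProb e H ε C g ≤ 1 := by
  unfold acceptProb
  split_ifs
  · norm_num
  · exact ⟨by positivity, pow_le_one₀ (by norm_num) (by norm_num)⟩

theorem acceptProb_one (C : ℕ) : acceptProb e H ε C 1 = 0 := if_pos rfl

variable {H} in
theorem acceptProb_inv (hH : H.IsUndirected) (C : ℕ) (g : G) :
    acceptProb e H ε C g⁻¹ = acceptProb e H ε C g := by
  simp [acceptProb, coinCount_inv e ε hH]

/-- The chosen exponent passed its test, unless it is the default `0`, for which the generator is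
kept for sure. -/
theorem acceptProb_lower (C : ℕ) (g : G) :
    acceptProb e H ε C g = 1 ∨ ∀ y : G → ℝ, C * Nat.clog 2 (Fintype.card G) *
      (H.extWeight g * genEnergy g y) ≤ acceptProb e H ε C g * ε ^ 2 * H.energy y := by
  by_cases hg : g = 1
  · subst hg
    right
    simp [acceptProb]
  rcases (lastPass_spec (fun k => elimDefect (Fintype.card G) (testMat e H (ε * ε / 2 ^ k)
    (2 * C * Nat.clog 2 (Fintype.card G)) g) ≤ 0) (Nat.clog 2 (Fintype.card G))).1 with h | h
  · left
    simp only [acceptProb, hg, if_false, coinCount, h, pow_zero]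
  · right
    intro y
    rw [elimDefect_testMat] at h
    have := h y
    simp only [acceptProb, hg, if_false, coinCount, one_div, inv_pow]
    rw [div_eq_mul_inv] at this
    linarith

/-- The next exponent failed its test, and a witness of the failure is a witness of importance; the
factor `2` is the lost halving. The alternative is that the range of exponents was exhausted. -/
theorem acceptProb_upper (C : ℕ) (g : G) :
    acceptProb e H ε C g ≤ (1 / 2) ^ Nat.clog 2 (Fintype.card G) ∨
      ∃ y : G → ℝ, acceptProb e H ε C g * ε ^ 2 * H.energy y <
        2 * (C * Nat.clog 2 (Fintype.card G)) * (H.extWeight g * genEnergy g y) := by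
  by_cases hg : g = 1
  · left
    subst hg
    rw [acceptProb_one]
    positivity
  rcases (lastPass_spec (fun k => elimDefect (Fintype.card G) (testMat e H (ε * ε / 2 ^ k)
    (2 * C * Nat.clog 2 (Fintype.card G)) g) ≤ 0) (Nat.clog 2 (Fintype.card G))).2 with h | h
  · left
    simp only [acceptProb, hg, if_false, coinCount, h, le_refl]
  · right
    rw [elimDefect_testMat] at h
    push Not at h
    obtain ⟨y, hy⟩ := h
    refine ⟨y, ?_⟩
    simp only [acceptProb, hg, if_false, coinCount, one_div, inv_pow]
    rw [pow_succ, div_eq_mul_inv, mul_inv] at hy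
    linarith

omit [Group G] [DecidableEq G] in
theorem items_nodup : (items e).Nodup :=
  (List.nodup_finRange _).map e.symm.injective

omit [Group G] [DecidableEq G] in
theorem mem_items (g : G) : g ∈ items e :=
  List.mem_map.2 ⟨e g, List.mem_finRange _, by simp⟩

variable {H} in
/-- The program samples every candidate independently with probability `acceptProb`. -/
theorem prob_sampler (hH : H.IsUndirected) (C : ℕ) {T : ℕ}
    (hT : Fintype.card G * Fintype.card G ≤ T) (E : CayleyGraph G → Prop) [DecidablePred E] :
    prob (sampler C) (input e H ε) T (fun τ => E (output e τ)) =
      sampleExp (firstHalf e H.gens) (acceptProb e H ε C)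
        fun A => if E (H.thinned (acceptProb e H ε C) A) then 1 else 0 := by
  have hsum : ((items e).map (coinCount e H ε C)).sum ≤ T := by
    refine le_trans (List.sum_le_card_nsmul _ (Fintype.card G) ?_) (le_trans ?_ hT)
    · intro k hk
      obtain ⟨g, -, rfl⟩ := List.mem_map.1 hk
      exact coinCount_le e H ε C g
    · simp [items]
  rw [firstHalf_candidates e H _ (acceptProb_one e H ε C)]
  have h1 := avg_kept (coinCount e H ε C) (candidates e H) (items e) (items_nodup e) T hsum
    fun A => if E (H.thinned (acceptProb e H ε C) A) then 1 else 0
  have h2 : (candidates e H).filter (· ∈ items e) = candidates e H :=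
    filter_true_of_mem fun g _ => mem_items e g
  rw [h2] at h1
  have h3 : sampleExp (candidates e H) (fun g => (1 / 2) ^ coinCount e H ε C g)
      (fun A => if E (H.thinned (acceptProb e H ε C) A) then 1 else 0) =
      sampleExp (candidates e H) (acceptProb e H ε C)
      (fun A => if E (H.thinned (acceptProb e H ε C) A) then 1 else 0) := by
    refine sampleExp_congr (fun s hs => ?_) fun _ _ => rfl
    simp only [candidates, mem_filter] at hs
    simp [acceptProb, hs.2.2]
  rw [← h3, ← h1, prob, avg, sum_boole]
  congr 2
  refine congrArg Finset.card ?_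
  ext ω
  simp only [mem_filter, mem_univ, true_and]
  obtain ⟨τ, t, he, -, hτ⟩ := sampler_runs e H ε C hH (List.ofFn ω) (by simpa using hT)
  rw [← hτ]
  constructor
  · rintro ⟨τ', t', he', hE⟩
    rwa [(he.deterministic he').1]
  · exact fun hE => ⟨τ, t, he, hE⟩

theorem sampler_haltsWithin (hH : H.IsUndirected) (C : ℕ) {T : ℕ}
    (hT : 6400 * Fintype.card G ^ 5 ≤ T) : HaltsWithin (sampler C) (input e H ε) T := by
  intro ω
  have hn : 1 ≤ Fintype.card G := Fintype.card_pos
  have : Fintype.card G * Fintype.card G ≤ 6400 * Fintype.card G ^ 5 := by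
    calc Fintype.card G * Fintype.card G = 1 * Fintype.card G ^ 2 := by ring
      _ ≤ 6400 * Fintype.card G ^ 5 := by gcongr <;> norm_num
  obtain ⟨τ, t, he, ht, -⟩ := sampler_runs e H ε C hH (List.ofFn ω) (by simp; omega)
  exact ⟨τ, t, he, ht.trans hT⟩

end RealRAM

namespace CayleyGraph

variable {G : Type u} [Group G] [Fintype G]

/-! ### The number of important generators -/

/-- The distance between `x` and its translate by `g`. -/
def genDist (x : G → ℝ) (g : G) : ℝ := √(genEnergy g x)

theorem genDist_nonneg (x : G → ℝ) (g : G) : 0 ≤ genDist x g := Real.sqrt_nonneg _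

theorem genDist_sq (x : G → ℝ) (g : G) : genDist x g ^ 2 = genEnergy g x :=
  Real.sq_sqrt (genEnergy_nonneg g x)

theorem genDist_one (x : G → ℝ) : genDist x 1 = 0 := by simp [genDist]

theorem genDist_inv (x : G → ℝ) (g : G) : genDist x g⁻¹ = genDist x g := by
  simp [genDist, genEnergy_inv]

/-- Right translation is an isometry of ℓ², so the displacement by `h` may be measured after
translating by `g`; the rest is the triangle inequality. -/
theorem genDist_mul_le (x : G → ℝ) (g h : G) : genDist x (g * h) ≤ genDist x g + genDist x h := by
  have key : ∀ f : G → ℝ, √(∑ u, f u ^ 2) = ‖WithLp.toLp 2 f‖ := by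
    intro f; simp [EuclideanSpace.norm_eq]
  have h2 : genDist x h = √(∑ u, (x (u * g) - x (u * g * h)) ^ 2) := by
    unfold genDist genEnergy
    congr 1
    exact (Fintype.sum_equiv (Equiv.mulRight g) _ _ fun u => rfl).symm
  rw [h2]
  unfold genDist genEnergy
  rw [key, key, key]
  refine le_trans (le_of_eq ?_) (norm_add_le _ _)
  congr 1
  ext u
  simp [mul_assoc]

variable [DecidableEq G]

/-- If more than `(k - 1) * 8 r ^ 2 / θ` generators have importance more than `θ`, then `2 ^ k`
elements are products of at most `k` of them. -/
theorem exists_products {H : CayleyGraph G} (hH : H.IsUndirected) {θ : ℝ} (hθ : 0 < θ) {r : ℕ} :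
    ∀ k ≤ r, ∀ A : Finset G,
      (∀ s ∈ A, ∃ x, θ * H.energy x < H.extWeight s * genEnergy s x) →
      ((k : ℝ) - 1) * (8 * r ^ 2) < #A * θ →
      ∃ P : Finset G, #P = 2 ^ k ∧ ∀ (x : G → ℝ) (δ : ℝ), (∀ a ∈ A, genDist x a ≤ δ) → 0 ≤ δ →
        ∀ p ∈ P, genDist x p ≤ k * δ := by
  intro k
  induction k with
  | zero =>
    intro _ A _ _
    refine ⟨{1}, by simp, fun x δ _ hδ p hp => ?_⟩
    rw [mem_singleton.1 hp, genDist_one]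
    simp
  | succ k ih =>
    intro hk A hA hcard
    have hr : (0 : ℝ) < r := by exact_mod_cast (show 0 < r by omega)
    push_cast at hcard
    have hne : A.Nonempty := by
      rw [nonempty_iff_ne_empty]
      rintro rfl
      have : 0 ≤ (k : ℝ) * (8 * r ^ 2) := by positivity
      simp at hcard
      linarith
    -- Since `s` is lightest, a generator with comparable displacement of `x` has at least
    -- comparable weighted energy.
    obtain ⟨s, hs, hmin⟩ := exists_min_image A H.extWeight hne
    obtain ⟨x, hx⟩ := hA s hs
    have hE := hH.energy_nonneg x
    have hpos : 0 < H.extWeight s * genEnergy s x := lt_of_le_of_lt (by positivity) hx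
    have hDs : 0 < genEnergy s x := pos_of_mul_pos_right hpos (hH.extWeight_nonneg s)
    have hws : 0 < H.extWeight s := pos_of_mul_pos_left hpos (genEnergy_nonneg s x)
    -- The generators that displace `x` by at least a `1 / (2 r)` part of what `s` does. Their
    -- weighted energies add up to at most twice the energy of `x`, so they are few.
    set T := A.filter fun t => genEnergy s x ≤ (2 * r) ^ 2 * genEnergy t x with hT
    have hTcard : #T * θ ≤ 8 * r ^ 2 := by
      have h1 : #T * (H.extWeight s * genEnergy s x) ≤ (2 * r) ^ 2 * (2 * H.energy x) := by
        calc #T * (H.extWeight s * genEnergy s x)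
            = ∑ t ∈ T, H.extWeight s * genEnergy s x := by simp
          _ ≤ ∑ t ∈ T, (2 * r) ^ 2 * (H.extWeight t * genEnergy t x) := by
              refine sum_le_sum fun t ht => ?_
              rw [hT, mem_filter] at ht
              calc H.extWeight s * genEnergy s x
                  ≤ H.extWeight t * ((2 * r) ^ 2 * genEnergy t x) := by
                    have := hmin t ht.1
                    have := hH.extWeight_nonneg t
                    gcongr
                    exact ht.2
                _ = _ := by ring
          _ ≤ ∑ t, (2 * r) ^ 2 * (H.extWeight t * genEnergy t x) := by
              refine sum_le_sum_of_subset_of_nonneg (subset_univ _) fun t _ _ => ?_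
              have := hH.extWeight_nonneg t
              have := genEnergy_nonneg t x
              positivity
          _ = _ := by rw [energy_eq, ← mul_sum]; ring
      refine le_of_mul_le_mul_right ?_ hpos
      calc #T * θ * (H.extWeight s * genEnergy s x)
          = #T * (H.extWeight s * genEnergy s x) * θ := by ring
        _ ≤ (2 * r) ^ 2 * (2 * H.energy x) * θ := by gcongr
        _ = 8 * r ^ 2 * (θ * H.energy x) := by ring
        _ ≤ 8 * r ^ 2 * (H.extWeight s * genEnergy s x) := by gcongr
    have hTA : T ⊆ A := filter_subset _ _
    -- The induction hypothesis bounds displacements of every function, so it may be used with this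
    -- `x`, which varies with the stage.
    obtain ⟨P, hP, hPd⟩ := ih (by omega) (A \ T) (fun t ht => hA t (sdiff_subset ht)) (by
      rw [cast_card_sdiff hTA]
      linarith)
    have hdist : ∀ p ∈ P, genDist x p ≤ k * (genDist x s / (2 * r)) := by
      refine hPd x _ (fun t ht => ?_) (div_nonneg (genDist_nonneg x s) (by positivity))
      rw [mem_sdiff, hT, mem_filter, not_and, not_le] at ht
      have h1 := ht.2 ht.1
      rw [le_div_iff₀ (by positivity)]
      refine (pow_le_pow_iff_left₀ (mul_nonneg (genDist_nonneg x t) (by positivity))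
        (genDist_nonneg x s) two_ne_zero).1 ?_
      rw [mul_pow, genDist_sq, genDist_sq]
      linarith
    have hs0 : 0 < genDist x s := Real.sqrt_pos.2 hDs
    -- If `s * p'` were in `P`, then `s` would be a quotient of two elements of `P` and would
    -- displace `x` by at most `k / r < 1` times its own displacement.
    have hdisj : Disjoint P (P.image (s * ·)) := by
      rw [disjoint_left]
      intro p hp hpi
      obtain ⟨p', hp', rfl⟩ := mem_image.1 hpi
      have h1 := genDist_mul_le x (s * p') p'⁻¹
      rw [mul_inv_cancel_right, genDist_inv] at h1
      have h2 := hdist _ hp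
      have h3 := hdist _ hp'
      have h4 : (k : ℝ) * (genDist x s / (2 * r)) * (2 * r) = k * genDist x s := by
        field_simp
      have h5 : (k : ℝ) < r := by exact_mod_cast hk
      nlinarith
    refine ⟨P ∪ P.image (s * ·), ?_, fun y δ hδ hδ0 p hp => ?_⟩
    · rw [card_union_of_disjoint hdisj, card_image_of_injective _ (mul_right_injective s), hP]
      ring
    · have hP' := hPd y δ (fun a ha => hδ a (sdiff_subset ha)) hδ0
      push_cast
      rcases mem_union.1 hp with hp | hp
      · have := hP' p hp
        linarith
      · obtain ⟨p', hp', rfl⟩ := mem_image.1 hp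
        have h1 := genDist_mul_le y s p'
        have h2 := hP' p' hp'
        have h3 := hδ s hs
        linarith

/-- Few generators have large importance. -/
theorem card_important_le {H : CayleyGraph G} (hH : H.IsUndirected) {θ : ℝ} (hθ : 0 < θ) {r : ℕ}
    (hr : Fintype.card G < 2 ^ r) (A : Finset G)
    (hA : ∀ s ∈ A, ∃ x, θ * H.energy x < H.extWeight s * genEnergy s x) :
    #A * θ ≤ 8 * r ^ 3 := by
  by_contra! hlt
  obtain ⟨P, hP, -⟩ := exists_products hH hθ r le_rfl A hA (by
    have : ((r : ℝ) - 1) * (8 * r ^ 2) ≤ 8 * r ^ 3 := by nlinarith [sq_nonneg (r : ℝ)]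
    linarith)
  have := P.card_le_univ
  omega

omit [Group G] [Fintype G] in
/-- A function with weak `ℓ¹` norm `N` on a set has sum at most `N` times a harmonic number. -/
theorem sum_le_harmonic {N : ℝ} (f : G → ℝ) :
    ∀ A : Finset G, (∀ θ > 0, #{s ∈ A | θ < f s} * θ ≤ N) → (∀ s ∈ A, 0 ≤ f s) →
      ∑ s ∈ A, f s ≤ N * harmonic #A := by
  intro A
  induction A using Finset.strongInduction with
  | H A ih =>
    intro hA hf
    rcases A.eq_empty_or_nonempty with rfl | hne
    · simp
    obtain ⟨s, hs, hmin⟩ := exists_min_image A f hne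
    -- All of `A` lies above each threshold less than the minimum, so the weak bound gives this in
    -- the limit. In the degenerate cases only `0 ≤ N` is used, which the threshold `1` provides.
    have hcard : #A * f s ≤ N := by
      rcases (hf s hs).eq_or_lt with h0 | h0
      · rw [← h0]
        have := hA 1 one_pos
        have : (0 : ℝ) ≤ #{s ∈ A | 1 < f s} := by positivity
        linarith
      · refine le_of_forall_lt_imp_le_of_dense fun a ha => ?_
        by_cases ha0 : a ≤ 0
        · have := hA 1 one_pos
          have : (0 : ℝ) ≤ #{s ∈ A | 1 < f s} := by positivity
          linarith
        · have hc : (0 : ℝ) < #A := by exact_mod_cast hne.card_pos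
          have hθ : a / #A < f s := by rwa [div_lt_iff₀ hc, mul_comm]
          have := hA (a / #A) (by push Not at ha0; positivity)
          rwa [filter_true_of_mem fun t ht => hθ.trans_le (hmin t ht), mul_div_cancel₀ _ hc.ne']
            at this
    have h1 := ih (A.erase s) (erase_ssubset hs) (fun θ hθ => le_trans (by
      gcongr; exact erase_subset _ _) (hA θ hθ)) fun t ht => hf t (mem_of_mem_erase ht)
    have hcard' : #A = #(A.erase s) + 1 := (card_erase_add_one hs).symm
    have hc : (0 : ℝ) < #A := by exact_mod_cast hne.card_pos
    rw [← add_sum_erase A f hs, hcard', harmonic_succ, ← hcard']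
    push_cast
    rw [mul_add]
    have : f s ≤ N * (#A : ℝ)⁻¹ := by
      rw [← div_eq_mul_inv, le_div_iff₀ hc]; linarith
    linarith

theorem harmonic_le_three_log {m : ℕ} (hm : 1 ≤ m) :
    (harmonic m : ℝ) ≤ 3 * Real.log (m + 1) := by
  have h1 := harmonic_le_one_add_log m
  have h2 : Real.log m ≤ Real.log (m + 1) := by
    apply Real.log_le_log
    · exact_mod_cast hm
    · linarith
  have h3 : Real.log 2 ≤ Real.log (m + 1) := by
    apply Real.log_le_log two_pos
    have : (1 : ℝ) ≤ m := by exact_mod_cast hm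
    linarith
  have := Real.log_two_gt_d9
  linarith

end CayleyGraph

namespace CayleyGraph

open Matrix

/-! ### Moments of sums of independent random matrices -/

section Matrix

variable {ι : Type*} [Fintype ι] [DecidableEq ι]

/-- Orthogonal diagonalization. -/
structure Diagonalizes (X U : Matrix ι ι ℝ) (d : ι → ℝ) : Prop where
  left : Uᵀ * U = 1
  right : U * Uᵀ = 1
  eq : X = U * diagonal d * Uᵀ

theorem exists_diagonalizes {X : Matrix ι ι ℝ} (hX : X.IsHermitian) :
    ∃ U d, Diagonalizes X U d := by
  refine ⟨hX.eigenvectorUnitary, hX.eigenvalues, ?_, ?_, ?_⟩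
  · simpa [star_eq_conjTranspose] using Unitary.coe_star_mul_self hX.eigenvectorUnitary
  · simpa [star_eq_conjTranspose] using Unitary.coe_mul_star_self hX.eigenvectorUnitary
  · have := hX.spectral_theorem
    simpa [Unitary.conjStarAlgAut_apply, star_eq_conjTranspose] using this

namespace Diagonalizes

variable {X U Y V : Matrix ι ι ℝ} {d e : ι → ℝ}

theorem mul_eq (h : Diagonalizes X U d) : Uᵀ * X = diagonal d * Uᵀ := by
  rw [h.eq, ← mul_assoc, ← mul_assoc, h.left, one_mul]

theorem mul_eq' (h : Diagonalizes X U d) : X * U = U * diagonal d := by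
  rw [h.eq, mul_assoc, h.left, mul_one]

theorem pow (h : Diagonalizes X U d) (k : ℕ) : Diagonalizes (X ^ k) U (d ^ k) := by
  refine ⟨h.left, h.right, ?_⟩
  induction k with
  | zero => simp [h.right]
  | succ k ih =>
    rw [pow_succ, ih, mul_assoc, h.mul_eq, ← mul_assoc, mul_assoc U, diagonal_mul_diagonal]
    rfl

theorem trace_eq (h : Diagonalizes X U d) : X.trace = ∑ i, d i := by
  rw [h.eq, trace_mul_cycle, h.left, one_mul, trace_diagonal]

/-- Written in the two eigenbases of `X` and of a second matrix, the trace becomes a weighted sum of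
squares that can be compared entry by entry. -/
theorem trace_mul_mul (h : Diagonalizes X U d) (hV : V * Vᵀ = 1) {B : Matrix ι ι ℝ}
    (hB : B.IsHermitian) : (B * B * X).trace = ∑ i, ∑ j, d i * (Uᵀ * B * V) i j ^ 2 := by
  have hB' : Bᵀ = B := by simpa using hB.eq
  have h1 : (B * B * X).trace = ((diagonal d * (Uᵀ * B * V)) * (Uᵀ * B * V)ᵀ).trace := by
    rw [transpose_mul, transpose_mul, transpose_transpose, hB']
    calc (B * B * X).trace = (B * (B * U * diagonal d) * Uᵀ).trace := by
          rw [h.eq]; simp only [mul_assoc]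
      _ = ((Uᵀ * B) * (B * U * diagonal d)).trace := by
          rw [trace_mul_cycle]
      _ = ((Uᵀ * B) * (V * Vᵀ) * (B * U * diagonal d)).trace := by rw [hV, mul_one]
      _ = ((Uᵀ * B * V * (Vᵀ * (B * U))) * diagonal d).trace := by simp only [mul_assoc]
      _ = _ := by rw [trace_mul_comm]; simp only [mul_assoc]
  rw [h1, Matrix.trace]
  refine sum_congr rfl fun i _ => ?_
  rw [diag_apply, mul_apply]
  refine sum_congr rfl fun j _ => ?_
  rw [diagonal_mul, transpose_apply]
  ring

end Diagonalizes

/-- The terms with exponents `i` and `2 * m - i` are paired: powers of `|a|` and `|b|` are ordered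
alike, so unmixing them increases the sum. The even total degree permits the absolute values. -/
theorem sum_pow_mul_pow_le (a b : ℝ) (m : ℕ) :
    ∑ i ∈ range (2 * m + 1), a ^ i * b ^ (2 * m - i) ≤
      ((2 * m + 1 : ℕ) : ℝ) / 2 * (a ^ (2 * m) + b ^ (2 * m)) := by
  have h1 : ∑ i ∈ range (2 * m + 1), a ^ i * b ^ (2 * m - i) =
      ∑ i ∈ range (2 * m + 1), a ^ (2 * m - i) * b ^ i := by
    rw [← sum_range_reflect]
    refine sum_congr rfl fun i hi => ?_
    have hi := mem_range.1 hi
    congr 2; omega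
  have h2 : ∑ i ∈ range (2 * m + 1), (a ^ i * b ^ (2 * m - i) + a ^ (2 * m - i) * b ^ i) ≤
      ∑ i ∈ range (2 * m + 1), (a ^ (2 * m) + b ^ (2 * m)) := by
    refine sum_le_sum fun i hi => ?_
    have hi := mem_range.1 hi
    have ea : a ^ (2 * m) = |a| ^ i * |a| ^ (2 * m - i) := by
      rw [← pow_add, show i + (2 * m - i) = 2 * m by omega, Even.pow_abs (even_two_mul m)]
    have eb : b ^ (2 * m) = |b| ^ i * |b| ^ (2 * m - i) := by
      rw [← pow_add, show i + (2 * m - i) = 2 * m by omega, Even.pow_abs (even_two_mul m)]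
    have h3 : a ^ i * b ^ (2 * m - i) ≤ |a| ^ i * |b| ^ (2 * m - i) := by
      rw [← abs_pow, ← abs_pow, ← abs_mul]; exact le_abs_self _
    have h4 : a ^ (2 * m - i) * b ^ i ≤ |a| ^ (2 * m - i) * |b| ^ i := by
      rw [← abs_pow, ← abs_pow, ← abs_mul]; exact le_abs_self _
    have h5 : 0 ≤ (|a| ^ i - |b| ^ i) * (|a| ^ (2 * m - i) - |b| ^ (2 * m - i)) := by
      rcases le_total |a| |b| with h | h
      · refine mul_nonneg_of_nonpos_of_nonpos (sub_nonpos.2 ?_) (sub_nonpos.2 ?_) <;> gcongr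
      · refine mul_nonneg (sub_nonneg.2 ?_) (sub_nonneg.2 ?_) <;> gcongr
    rw [ea, eb]
    linarith
  rw [sum_add_distrib, ← h1, sum_const, card_range, nsmul_eq_mul] at h2
  linarith

theorem sub_mul_pow_sub_le (a b : ℝ) (m : ℕ) :
    (a - b) * (a ^ (2 * m + 1) - b ^ (2 * m + 1)) ≤
      ((2 * m + 1 : ℕ) : ℝ) / 2 * (a ^ (2 * m) + b ^ (2 * m)) * (a - b) ^ 2 := by
  have h := (Commute.all a b).geom_sum₂_mul (2 * m + 1)
  rw [← h]
  have h2 := mul_le_mul_of_nonneg_right (sum_pow_mul_pow_le a b m) (sq_nonneg (a - b))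
  simp only [Nat.add_sub_cancel_right]
  linarith

/-- The mean value trace inequality. -/
theorem trace_sub_mul_pow_sub_le {X Y : Matrix ι ι ℝ} (hX : X.IsHermitian) (hY : Y.IsHermitian)
    (m : ℕ) : ((X - Y) * (X ^ (2 * m + 1) - Y ^ (2 * m + 1))).trace ≤
      ((2 * m + 1 : ℕ) : ℝ) / 2 * (((X - Y) * (X - Y) * X ^ (2 * m)).trace +
        ((X - Y) * (X - Y) * Y ^ (2 * m)).trace) := by
  obtain ⟨U, d, hU⟩ := exists_diagonalizes hX
  obtain ⟨V, e, hV⟩ := exists_diagonalizes hY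
  have hB : (X - Y).IsHermitian := hX.sub hY
  have hBt : (X - Y)ᵀ = X - Y := by simpa using hB.eq
  -- In the mixed eigenbases every difference of powers acts on entries as a scalar multiple of `Uᵀ
  -- * V`, which reduces the claim to `sub_mul_pow_sub_le` for pairs of eigenvalues.
  have hpow : ∀ k i j, (Uᵀ * (X ^ k - Y ^ k) * V) i j = (d i ^ k - e j ^ k) * (Uᵀ * V) i j := by
    intro k i j
    rw [mul_sub, sub_mul, (hU.pow k).mul_eq, mul_assoc Uᵀ (Y ^ k), (hV.pow k).mul_eq', mul_assoc,
      ← mul_assoc Uᵀ V, Matrix.sub_apply, diagonal_mul, mul_diagonal]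
    simp only [Pi.pow_apply]
    ring
  have hone : ∀ i j, (Uᵀ * (X - Y) * V) i j = (d i - e j) * (Uᵀ * V) i j := by
    intro i j; simpa using hpow 1 i j
  have h1 : ((X - Y) * (X ^ (2 * m + 1) - Y ^ (2 * m + 1))).trace =
      ∑ i, ∑ j, (Uᵀ * (X - Y) * V) i j * (Uᵀ * (X ^ (2 * m + 1) - Y ^ (2 * m + 1)) * V) i j := by
    set M := X ^ (2 * m + 1) - Y ^ (2 * m + 1)
    have hMt : Mᵀ = M := by
      have : M.IsHermitian := (hX.pow _).sub (hY.pow _)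
      simpa using this.eq
    have : ((X - Y) * M).trace = ((Uᵀ * (X - Y) * V) * (Uᵀ * M * V)ᵀ).trace := by
      rw [transpose_mul, transpose_mul, transpose_transpose, hMt]
      calc ((X - Y) * M).trace = ((X - Y) * M * (U * Uᵀ)).trace := by rw [hU.right, mul_one]
        _ = ((X - Y) * (M * U) * Uᵀ).trace := by simp only [mul_assoc]
        _ = (Uᵀ * (X - Y) * (M * U)).trace := by rw [trace_mul_cycle]
        _ = (Uᵀ * (X - Y) * (V * Vᵀ) * (M * U)).trace := by rw [hV.right, mul_one]
        _ = _ := by simp only [mul_assoc]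
    rw [this, Matrix.trace]
    refine sum_congr rfl fun i _ => ?_
    rw [diag_apply, mul_apply]
    exact sum_congr rfl fun j _ => rfl
  have h2 := (hU.pow (2 * m)).trace_mul_mul hV.right hB
  have h3 := (hV.pow (2 * m)).trace_mul_mul hU.right hB
  have h4 : ∀ i j, (Vᵀ * (X - Y) * U) j i = (Uᵀ * (X - Y) * V) i j := by
    intro i j
    rw [← transpose_apply (Uᵀ * (X - Y) * V), transpose_mul, transpose_mul, transpose_transpose,
      hBt, mul_assoc]
  rw [sum_comm] at h3
  rw [h1, h2, h3, ← sum_add_distrib, mul_sum]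
  refine sum_le_sum fun i _ => ?_
  rw [← sum_add_distrib, mul_sum]
  refine sum_le_sum fun j _ => ?_
  rw [h4, hpow, hone]
  have := mul_le_mul_of_nonneg_right (sub_mul_pow_sub_le (d i) (e j) m)
    (sq_nonneg ((Uᵀ * V) i j))
  simp only [Pi.pow_apply]
  linarith

/-- By cyclicity this is the trace of `A` conjugated by `X ^ m`. -/
theorem posSemidef_pow_mul_mul_pow {A X : Matrix ι ι ℝ} (hA : A.PosSemidef) (hX : X.IsHermitian)
    (m : ℕ) : 0 ≤ (A * X ^ (2 * m)).trace := by
  have h := (hA.mul_mul_conjTranspose_same (X ^ m)).trace_nonneg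
  rw [(hX.pow m).eq, mul_assoc, trace_mul_comm, mul_assoc, ← pow_add, ← two_mul] at h
  exact h

/-- A positive semidefinite `A` bounded by `b` satisfies `A ^ 2 ≤ b A`, because this holds for its
eigenvalues; even powers of `X` preserve the inequality under the trace. -/
theorem trace_mul_self_le {A X : Matrix ι ι ℝ} (hA : A.PosSemidef) {b : ℝ}
    (hb : (b • (1 : Matrix ι ι ℝ) - A).PosSemidef) (hX : X.IsHermitian) (m : ℕ) :
    (A * A * X ^ (2 * m)).trace ≤ b * (A * X ^ (2 * m)).trace := by
  obtain ⟨U, d, hU⟩ := exists_diagonalizes hA.1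
  have h0 : ∀ i, 0 ≤ d i := by
    have := hA.mul_mul_conjTranspose_same Uᵀ
    rw [conjTranspose_eq_transpose_of_trivial, transpose_transpose, hU.mul_eq, mul_assoc, hU.left,
      mul_one] at this
    exact posSemidef_diagonal_iff.1 this
  have h1 : ∀ i, 0 ≤ b - d i := by
    have := hb.mul_mul_conjTranspose_same Uᵀ
    rw [conjTranspose_eq_transpose_of_trivial, transpose_transpose, mul_sub, sub_mul, hU.mul_eq,
      mul_assoc (diagonal d), hU.left, mul_one, mul_smul_comm, mul_one, smul_mul_assoc, hU.left,
      smul_one_eq_diagonal, diagonal_sub] at this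
    exact posSemidef_diagonal_iff.1 this
  have h2 : (b • A - A * A).PosSemidef := by
    have : (diagonal fun i => d i * (b - d i)).PosSemidef :=
      posSemidef_diagonal_iff.2 fun i => mul_nonneg (h0 i) (h1 i)
    convert this.mul_mul_conjTranspose_same U using 1
    rw [conjTranspose_eq_transpose_of_trivial]
    have h3 : A * A = U * diagonal (fun i => d i * d i) * Uᵀ := by
      have := (hU.pow 2).eq
      rw [sq] at this
      rw [this]
      congr 3
      funext i
      simp [sq]
    have h4 : b • A = U * diagonal (fun i => b * d i) * Uᵀ := by
      conv_lhs => rw [hU.eq]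
      rw [← smul_mul_assoc, ← mul_smul_comm]
      congr 2
      ext i j
      by_cases hij : i = j
      · subst hij; simp
      · simp [hij]
    rw [h3, h4, ← sub_mul, ← mul_sub, diagonal_sub]
    congr 3
    funext i
    ring
  have h3 := posSemidef_pow_mul_mul_pow h2 hX m
  rw [sub_mul, trace_sub, smul_mul_assoc, trace_smul, smul_eq_mul] at h3
  linarith

/-- One eigenvalue at a time, lower moments are absorbed into higher ones. -/
theorem trace_absorb {X : Matrix ι ι ℝ} (hX : X.IsHermitian) (m : ℕ) {κ τ : ℝ} (hκ : 0 ≤ κ)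
    (hτ : 0 < τ) (h : κ * (τ + 2) ≤ τ ^ 2 / 2) :
    κ * ((X ^ (2 * m + 1)).trace + 2 * (X ^ (2 * m)).trace) ≤
      1 / 2 * (X ^ (2 * m + 2)).trace + 1 / 2 * (Fintype.card ι * τ ^ (2 * m + 2)) := by
  obtain ⟨U, d, hU⟩ := exists_diagonalizes hX
  rw [(hU.pow _).trace_eq, (hU.pow _).trace_eq, (hU.pow _).trace_eq]
  have e : (Fintype.card ι : ℝ) * τ ^ (2 * m + 2) = ∑ _i : ι, τ ^ (2 * m + 2) := by simp
  rw [e, mul_sum, mul_sum, ← sum_add_distrib, mul_sum, mul_sum, ← sum_add_distrib]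
  refine sum_le_sum fun i _ => ?_
  simp only [Pi.pow_apply]
  generalize d i = x
  have hev : x ^ (2 * m) = |x| ^ (2 * m) := (Even.pow_abs (even_two_mul m) x).symm
  have h1 : κ * (x ^ (2 * m + 1) + 2 * x ^ (2 * m)) ≤ κ * (|x| + 2) * |x| ^ (2 * m) := by
    rw [pow_succ, hev, mul_assoc]
    refine mul_le_mul_of_nonneg_left ?_ hκ
    have := mul_le_mul_of_nonneg_left (le_abs_self x) (pow_nonneg (abs_nonneg x) (2 * m))
    linarith
  have h2 : x ^ (2 * m + 2) = |x| ^ 2 * |x| ^ (2 * m) := by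
    rw [pow_add, hev, sq_abs]; ring
  rw [h2]
  have hx := abs_nonneg x
  -- A large eigenvalue is absorbed by half of its higher power, as `(|x| + 2) / |x| ^ 2` decreases
  -- and is small enough at `τ`. A small one contributes at most what `τ` would.
  rcases le_total τ |x| with hx' | hx'
  · have h3 : κ * (|x| + 2) ≤ |x| ^ 2 / 2 := by
      have : κ * (|x| + 2) * τ ^ 2 ≤ |x| ^ 2 / 2 * τ ^ 2 := by
        have a1 : |x| * τ ≤ |x| ^ 2 := by nlinarith
        have a2 : τ ^ 2 ≤ |x| ^ 2 := by nlinarith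
        have a3 := mul_le_mul_of_nonneg_left h (sq_nonneg |x|)
        have a4 : κ * ((|x| * τ) * τ + 2 * τ ^ 2) ≤ κ * (|x| ^ 2 * τ + 2 * |x| ^ 2) := by gcongr
        nlinarith
      exact le_of_mul_le_mul_right this (by positivity)
    have h4 := mul_le_mul_of_nonneg_right h3 (pow_nonneg hx (2 * m))
    have h5 : 0 ≤ τ ^ (2 * m + 2) := by positivity
    linarith
  · have h3 : κ * (|x| + 2) * |x| ^ (2 * m) ≤ κ * (τ + 2) * τ ^ (2 * m) := by gcongr
    have h4 : κ * (τ + 2) * τ ^ (2 * m) ≤ τ ^ 2 / 2 * τ ^ (2 * m) := by gcongr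
    have h5 : 0 ≤ |x| ^ 2 * |x| ^ (2 * m) := by positivity
    have h6 : τ ^ 2 / 2 * τ ^ (2 * m) = 1 / 2 * τ ^ (2 * m + 2) := by rw [pow_add]; ring
    linarith

/-- A small moment bounds the quadratic form. -/
theorem abs_dotProduct_le_of_trace {X : Matrix ι ι ℝ} (hX : X.IsHermitian) (m : ℕ) {ε : ℝ}
    (hε : 0 < ε) (h : (X ^ (2 * m + 2)).trace < ε ^ (2 * m + 2)) (y : ι → ℝ) :
    |y ⬝ᵥ X *ᵥ y| ≤ ε * (y ⬝ᵥ y) := by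
  obtain ⟨U, d, hU⟩ := exists_diagonalizes hX
  rw [(hU.pow _).trace_eq] at h
  have hev : Even (2 * m + 2) := ⟨m + 1, by ring⟩
  -- The exponent is even, so each eigenvalue is controlled by the whole trace.
  have hd : ∀ i, |d i| ≤ ε := by
    intro i
    have h1 : d i ^ (2 * m + 2) ≤ ∑ i, (d ^ (2 * m + 2)) i :=
      single_le_sum (f := fun i => d i ^ (2 * m + 2)) (fun j _ => hev.pow_nonneg _) (mem_univ i)
    rw [← hev.pow_abs] at h1
    exact (lt_of_pow_lt_pow_left₀ _ hε.le (h1.trans_lt h)).le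
  set z := Uᵀ *ᵥ y with hz
  have hzU : U *ᵥ z = y := by rw [hz, mulVec_mulVec, hU.right, one_mulVec]
  have h1 : y ⬝ᵥ X *ᵥ y = ∑ i, d i * z i ^ 2 := by
    rw [hU.eq, ← mulVec_mulVec, ← mulVec_mulVec, ← hz, dotProduct_mulVec, ← mulVec_transpose, ← hz,
      dotProduct]
    refine sum_congr rfl fun i _ => ?_
    rw [mulVec_diagonal]
    ring
  have h2 : y ⬝ᵥ y = ∑ i, z i ^ 2 := by
    conv_lhs => rw [← hzU]
    rw [dotProduct_mulVec, ← mulVec_transpose, hzU, ← hz, dotProduct]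
    exact sum_congr rfl fun i _ => (sq _).symm
  rw [h1, h2, mul_sum]
  refine (abs_sum_le_sum_abs _ _).trans (sum_le_sum fun i _ => ?_)
  rw [abs_mul, abs_of_nonneg (sq_nonneg (z i))]
  exact mul_le_mul_of_nonneg_right (hd i) (sq_nonneg _)

end Matrix

end CayleyGraph

/-! ### The moment bound and matrix concentration -/

namespace CayleyGraph

open Matrix

variable {ι : Type*} [Fintype ι] [DecidableEq ι] {G : Type u} [DecidableEq G]

/-- The deviation of the sum of the kept matrices, reweighted, from its expectation. -/
def deviation (R : Finset G) (q : G → ℝ) (B : G → Matrix ι ι ℝ) (T : Finset G) : Matrix ι ι ℝ :=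
  ∑ s ∈ R, ((if s ∈ T then 1 / q s else 0) - 1) • B s

omit [Fintype ι] [DecidableEq ι] in
theorem deviation_isHermitian {R : Finset G} (q : G → ℝ) {B : G → Matrix ι ι ℝ}
    (hB : ∀ s ∈ R, (B s).IsHermitian) (T : Finset G) : (deviation R q B T).IsHermitian := by
  rw [IsHermitian, deviation, conjTranspose_sum]
  refine sum_congr rfl fun s hs => ?_
  rw [conjTranspose_smul, (hB s hs).eq, star_trivial]

omit [Fintype ι] [DecidableEq ι] in
theorem deviation_insert {R : Finset G} (q : G → ℝ) (B : G → Matrix ι ι ℝ) {s : G} (hs : s ∈ R)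
    {T : Finset G} (hsT : s ∉ T) :
    deviation R q B (insert s T) - deviation R q B T = (1 / q s) • B s := by
  unfold deviation
  rw [← sum_sub_distrib, sum_eq_single_of_mem s hs]
  · rw [← sub_smul]; simp [hsT]
  · intro t _ ht
    simp [ht]

omit [DecidableEq ι] in
theorem trace_deviation_mul (R : Finset G) (q : G → ℝ) (B : G → Matrix ι ι ℝ) (T : Finset G)
    (M : Matrix ι ι ℝ) : (deviation R q B T * M).trace =
      ∑ s ∈ R, ((if s ∈ T then 1 / q s else 0) - 1) * (B s * M).trace := by
  simp only [deviation, Finset.sum_mul, trace_sum, smul_mul_assoc, trace_smul, smul_eq_mul]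

/-- The contribution of one generator to the moment. -/
theorem moment_term_le {R : Finset G} {q : G → ℝ} (hq : ∀ s ∈ R, 0 ≤ q s ∧ q s ≤ 1)
    {B : G → Matrix ι ι ℝ} (hB : ∀ s ∈ R, (B s).PosSemidef) {ρ : ℝ} (hρ : 0 ≤ ρ) {s : G}
    (hs : s ∈ R) (hs1 : q s = 1 ∨ ((q s * ρ) • (1 : Matrix ι ι ℝ) - B s).PosSemidef) (m : ℕ) :
    sampleExp R q (fun T => ((if s ∈ T then 1 / q s else 0) - 1) *
        (B s * deviation R q B T ^ (2 * m + 1)).trace) ≤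
      ((2 * m + 1 : ℕ) : ℝ) / 2 * ρ * sampleExp R q (fun T => ((if s ∈ T then 1 / q s else 0) + 1) *
        (B s * deviation R q B T ^ (2 * m)).trace) := by
  set X := deviation R q B with hXdef
  have hX : ∀ T, (X T).IsHermitian := deviation_isHermitian q fun s hs => (hB s hs).1
  set N : ℝ := ((2 * m + 1 : ℕ) : ℝ) / 2 with hN
  have hN0 : 0 ≤ N := by positivity
  have hpos : ∀ T, 0 ≤ (B s * X T ^ (2 * m)).trace := fun T =>
    posSemidef_pow_mul_mul_pow (hB s hs) (hX T) m
  -- All generators except `s` are fixed. The coefficient is then `1 / q s - 1` if `s` is kept and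
  -- `-1` if not.
  obtain ⟨R', hsR', rfl⟩ : ∃ R', s ∉ R' ∧ insert s R' = R := ⟨R.erase s, by simp, insert_erase hs⟩
  have hq' : ∀ t ∈ R', 0 ≤ q t ∧ q t ≤ 1 := fun t ht => hq t (mem_insert_of_mem ht)
  rw [sampleExp_insert hsR', sampleExp_insert hsR']
  have hnot : ∀ T ⊆ R', s ∉ T := fun T hT h => hsR' (hT h)
  have e1 : sampleExp R' q (fun T => ((if s ∈ T then 1 / q s else 0) - 1) *
      (B s * X T ^ (2 * m + 1)).trace) =
      sampleExp R' q (fun T => -(B s * X T ^ (2 * m + 1)).trace) :=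
    sampleExp_congr (fun _ _ => rfl) fun T hT => by simp [hnot T hT]
  have e2 : sampleExp R' q (fun T => ((if s ∈ T then 1 / q s else 0) + 1) *
      (B s * X T ^ (2 * m)).trace) =
      sampleExp R' q (fun T => (B s * X T ^ (2 * m)).trace) :=
    sampleExp_congr (fun _ _ => rfl) fun T hT => by simp [hnot T hT]
  simp only [mem_insert_self, if_true]
  rw [e1, e2]
  simp only [← sampleExp_const_mul]
  rw [← sampleExp_add, ← sampleExp_add, ← sampleExp_const_mul]
  refine sampleExp_mono hq' fun T hT => ?_
  have hp1 := hpos (insert s T)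
  have hp0 := hpos T
  obtain ⟨hq0, hq1⟩ := hq s (mem_insert_self _ _)
  -- A generator that is kept for sure does not deviate, so its left side is zero.
  rcases hs1 with h1 | h1
  · rw [h1]
    norm_num
    positivity
  rcases hq0.eq_or_lt with h0 | h0
  -- For `q s = 0` the hypothesis makes both `B s` and `-B s` positive semidefinite.
  · have hB0 : B s = 0 := by
      rw [← h0, zero_mul, zero_smul, zero_sub] at h1
      have t1 := h1.trace_nonneg
      have t2 := (hB s (mem_insert_self _ _)).trace_nonneg
      rw [trace_neg] at t1
      exact (hB s (mem_insert_self _ _)).trace_eq_zero_iff.1 (by linarith)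
    simp [hB0]
  · have hdev : X (insert s T) - X T = (1 / q s) • B s :=
      deviation_insert q B (mem_insert_self _ _) (hnot T hT)
    have key := trace_sub_mul_pow_sub_le (hX (insert s T)) (hX T) m
    rw [hdev, smul_mul_assoc, trace_smul, smul_mul_assoc, mul_smul_comm, smul_smul, smul_mul_assoc,
      smul_mul_assoc, trace_smul, trace_smul, mul_sub, trace_sub] at key
    simp only [smul_eq_mul] at key
    rw [← hN] at key
    have l1 := trace_mul_self_le (hB s (mem_insert_self _ _)) h1 (hX (insert s T)) m
    have l0 := trace_mul_self_le (hB s (mem_insert_self _ _)) h1 (hX T) m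
    have key2 : (B s * X (insert s T) ^ (2 * m + 1)).trace - (B s * X T ^ (2 * m + 1)).trace ≤
        N * ρ * ((B s * X (insert s T) ^ (2 * m)).trace + (B s * X T ^ (2 * m)).trace) := by
      have h3 : q s ^ 2 * (1 / q s) = q s := by field_simp
      have h4 : q s ^ 2 * (1 / q s * (1 / q s)) = 1 := by field_simp
      have k1 := mul_le_mul_of_nonneg_left key (sq_nonneg (q s))
      have k2 : q s * ((B s * X (insert s T) ^ (2 * m + 1)).trace -
          (B s * X T ^ (2 * m + 1)).trace) ≤
          N * ((B s * B s * X (insert s T) ^ (2 * m)).trace +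
            (B s * B s * X T ^ (2 * m)).trace) := by
        calc _ = q s ^ 2 * (1 / q s * ((B s * X (insert s T) ^ (2 * m + 1)).trace -
              (B s * X T ^ (2 * m + 1)).trace)) := by rw [← mul_assoc, h3]
          _ ≤ _ := k1
          _ = q s ^ 2 * (1 / q s * (1 / q s)) * (N * ((B s * B s * X (insert s T) ^ (2 * m)).trace +
            (B s * B s * X T ^ (2 * m)).trace)) := by ring
          _ = _ := by rw [h4, one_mul]
      refine le_of_mul_le_mul_left (k2.trans ?_) h0
      calc _ ≤ N * (q s * ρ * (B s * X (insert s T) ^ (2 * m)).trace +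
            q s * ρ * (B s * X T ^ (2 * m)).trace) := by gcongr
        _ = _ := by ring
    have h5 : q s * (1 / q s) = 1 := by field_simp
    have k3 := mul_le_mul_of_nonneg_left key2 (sub_nonneg.2 hq1)
    have k4 : 0 ≤ N * ρ * (B s * X (insert s T) ^ (2 * m)).trace * q s := by positivity
    -- The reweighting is unbiased: `q s * (1 / q s - 1) = 1 - q s`, so the two cases combine into
    -- `1 - q s` times a difference of traces.
    calc _ = (q s * (1 / q s) - q s) * (B s * X (insert s T) ^ (2 * m + 1)).trace -
          (1 - q s) * (B s * X T ^ (2 * m + 1)).trace := by ring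
      _ = (1 - q s) * ((B s * X (insert s T) ^ (2 * m + 1)).trace -
          (B s * X T ^ (2 * m + 1)).trace) := by rw [h5]; ring
      _ ≤ _ := k3
      _ ≤ N * ρ * ((1 + q s) * (B s * X (insert s T) ^ (2 * m)).trace +
          (1 - q s) * (B s * X T ^ (2 * m)).trace) := by linarith
      _ = N * ρ * ((q s * (1 / q s) + q s) * (B s * X (insert s T) ^ (2 * m)).trace +
          (1 - q s) * (B s * X T ^ (2 * m)).trace) := by rw [h5]
      _ = _ := by ring

/-- A bound for the moments of a sum of independent random matrices. -/
theorem moment_le {R : Finset G} {q : G → ℝ} (hq : ∀ s ∈ R, 0 ≤ q s ∧ q s ≤ 1)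
    {B : G → Matrix ι ι ℝ} (hB : ∀ s ∈ R, (B s).PosSemidef) {ρ : ℝ} (hρ : 0 ≤ ρ)
    (hs1 : ∀ s ∈ R, q s = 1 ∨ ((q s * ρ) • (1 : Matrix ι ι ℝ) - B s).PosSemidef)
    (hsum : (1 - ∑ s ∈ R, B s).PosSemidef) (m : ℕ) {τ : ℝ} (hτ : 0 < τ)
    (h : ((2 * m + 1 : ℕ) : ℝ) / 2 * ρ * (τ + 2) ≤ τ ^ 2 / 2) :
    sampleExp R q (fun T => (deviation R q B T ^ (2 * m + 2)).trace) ≤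
      Fintype.card ι * τ ^ (2 * m + 2) := by
  set X := deviation R q B with hXdef
  have hX : ∀ T, (X T).IsHermitian := deviation_isHermitian q fun s hs => (hB s hs).1
  set κ := ((2 * m + 1 : ℕ) : ℝ) / 2 * ρ with hκ
  have hκ0 : 0 ≤ κ := by positivity
  -- One factor of the deviation is expanded into its generators.
  have h1 : ∀ T, (X T ^ (2 * m + 2)).trace = ∑ s ∈ R, ((if s ∈ T then 1 / q s else 0) - 1) *
      (B s * X T ^ (2 * m + 1)).trace := by
    intro T
    rw [show 2 * m + 2 = (2 * m + 1) + 1 by ring, pow_succ', hXdef, trace_deviation_mul]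
  -- The coefficient is the one of the deviation plus `2`. The first part rebuilds a factor `X`; the
  -- second is bounded because the matrices add up to at most the identity.
  have h2 : ∀ T, ∑ s ∈ R, ((if s ∈ T then 1 / q s else 0) + 1) * (B s * X T ^ (2 * m)).trace ≤
      (X T ^ (2 * m + 1)).trace + 2 * (X T ^ (2 * m)).trace := by
    intro T
    have e1 : (X T ^ (2 * m + 1)).trace = ∑ s ∈ R, ((if s ∈ T then 1 / q s else 0) - 1) *
        (B s * X T ^ (2 * m)).trace := by
      rw [pow_succ', hXdef, trace_deviation_mul]
    have e2 := posSemidef_pow_mul_mul_pow hsum (hX T) m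
    rw [sub_mul, one_mul, trace_sub, Finset.sum_mul, trace_sum] at e2
    have e3 : ∑ s ∈ R, ((if s ∈ T then 1 / q s else 0) + 1) * (B s * X T ^ (2 * m)).trace =
        (X T ^ (2 * m + 1)).trace + 2 * ∑ s ∈ R, (B s * X T ^ (2 * m)).trace := by
      rw [e1, mul_sum, ← sum_add_distrib]
      exact sum_congr rfl fun s _ => by ring
    linarith
  have h3 : sampleExp R q (fun T => (X T ^ (2 * m + 2)).trace) ≤
      sampleExp R q (fun T => κ * ((X T ^ (2 * m + 1)).trace + 2 * (X T ^ (2 * m)).trace)) := by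
    calc sampleExp R q (fun T => (X T ^ (2 * m + 2)).trace)
        = ∑ s ∈ R, sampleExp R q (fun T => ((if s ∈ T then 1 / q s else 0) - 1) *
            (B s * X T ^ (2 * m + 1)).trace) := by
          rw [← sampleExp_sum]; exact sampleExp_congr (fun _ _ => rfl) fun T _ => h1 T
      _ ≤ ∑ s ∈ R, κ * sampleExp R q (fun T => ((if s ∈ T then 1 / q s else 0) + 1) *
            (B s * X T ^ (2 * m)).trace) :=
          sum_le_sum fun s hs => moment_term_le hq hB hρ hs (hs1 s hs) m
      _ = sampleExp R q (fun T => κ * ∑ s ∈ R, ((if s ∈ T then 1 / q s else 0) + 1) *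
            (B s * X T ^ (2 * m)).trace) := by
          rw [sampleExp_const_mul, sampleExp_sum, mul_sum]
      _ ≤ _ := sampleExp_mono hq fun T _ => mul_le_mul_of_nonneg_left (h2 T) hκ0
  have h4 := h3.trans (sampleExp_mono hq fun T _ => trace_absorb (hX T) m hκ0 hτ h)
  rw [sampleExp_add, sampleExp_const_mul, sampleExp_const] at h4
  linarith

/-- Matrix concentration. -/
theorem sampleExp_bad_le {R : Finset G} {q : G → ℝ} (hq : ∀ s ∈ R, 0 ≤ q s ∧ q s ≤ 1)
    {B : G → Matrix ι ι ℝ} (hB : ∀ s ∈ R, (B s).PosSemidef) {ρ : ℝ} (hρ : 0 ≤ ρ)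
    (hs1 : ∀ s ∈ R, q s = 1 ∨ ((q s * ρ) • (1 : Matrix ι ι ℝ) - B s).PosSemidef)
    (hsum : (1 - ∑ s ∈ R, B s).PosSemidef) (m : ℕ) {ε : ℝ} (hε : 0 < ε) (hε1 : ε < 1)
    (h : 20 * (m + 1) * ρ ≤ ε ^ 2) :
    sampleExp R q (fun T => open Classical in
      if ∀ y, |y ⬝ᵥ deviation R q B T *ᵥ y| ≤ ε * (y ⬝ᵥ y) then 0 else 1) ≤
      Fintype.card ι * (1 / 4) ^ (m + 1) := by
  classical
  have hX : ∀ T, (deviation R q B T).IsHermitian :=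
    deviation_isHermitian q fun s hs => (hB s hs).1
  -- Here `τ = ε / 2`. As `(2 m + 1) / 2 ≤ m + 1` and `τ + 2 ≤ 5 / 2`, the condition of the moment
  -- bound follows from `20 (m + 1) ρ ≤ ε ^ 2`.
  have h1 := moment_le hq hB hρ hs1 hsum m (half_pos hε) (by push_cast; nlinarith)
  have hpow : (0 : ℝ) < (1 / ε) ^ (2 * m + 2) := by positivity
  have hone : (1 / ε) ^ (2 * m + 2) * ε ^ (2 * m + 2) = 1 := by
    rw [← mul_pow, one_div_mul_cancel hε.ne', one_pow]
  -- Markov's inequality for the even moment.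
  calc _ ≤ sampleExp R q (fun T => (1 / ε) ^ (2 * m + 2) *
        (deviation R q B T ^ (2 * m + 2)).trace) := by
        refine sampleExp_mono hq fun T _ => ?_
        split_ifs with hT
        · refine mul_nonneg hpow.le ?_
          have := posSemidef_pow_mul_mul_pow (PosSemidef.one (n := ι) (R := ℝ)) (hX T) (m + 1)
          rwa [one_mul] at this
        · have : ε ^ (2 * m + 2) ≤ (deviation R q B T ^ (2 * m + 2)).trace := by
            by_contra! hlt
            exact hT (abs_dotProduct_le_of_trace (hX T) m hε hlt)
          calc (1 : ℝ) = (1 / ε) ^ (2 * m + 2) * ε ^ (2 * m + 2) := hone.symm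
            _ ≤ _ := mul_le_mul_of_nonneg_left this hpow.le
    _ ≤ (1 / ε) ^ (2 * m + 2) * (Fintype.card ι * (ε / 2) ^ (2 * m + 2)) := by
        rw [sampleExp_const_mul]; exact mul_le_mul_of_nonneg_left h1 hpow.le
    _ = (1 / ε) ^ (2 * m + 2) * ε ^ (2 * m + 2) * (Fintype.card ι * (1 / 2) ^ (2 * m + 2)) := by
        rw [div_eq_mul_one_div ε, mul_pow]; ring
    _ = _ := by
        rw [hone, one_mul, show 2 * m + 2 = 2 * (m + 1) by ring, pow_mul]; norm_num

end CayleyGraph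

/-! ### Normalization by the total form and the sampling theorem -/

namespace CayleyGraph

open Matrix

section Normalization

variable {ι : Type*} [Fintype ι] [DecidableEq ι] {G : Type u}

omit [DecidableEq ι] in
theorem dotProduct_conj_mulVec (P L : Matrix ι ι ℝ) (y : ι → ℝ) :
    y ⬝ᵥ (Pᵀ * L * P) *ᵥ y = (P *ᵥ y) ⬝ᵥ L *ᵥ (P *ᵥ y) := by
  rw [← mulVec_mulVec, ← mulVec_mulVec, dotProduct_mulVec, ← mulVec_transpose, transpose_transpose]

/-- Positive semidefinite matrices can be brought to a form in which their sum is at most the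
identity, without changing the values of their quadratic forms. -/
theorem exists_normalization (R : Finset G) {L : G → Matrix ι ι ℝ}
    (hL : ∀ s ∈ R, (L s).PosSemidef) :
    ∃ B : G → Matrix ι ι ℝ, (∀ s ∈ R, (B s).PosSemidef) ∧ (1 - ∑ s ∈ R, B s).PosSemidef ∧
      (∀ s ∈ R, ∀ c : ℝ, 0 ≤ c → (∀ x, x ⬝ᵥ L s *ᵥ x ≤ c * ∑ t ∈ R, x ⬝ᵥ L t *ᵥ x) →
        (c • (1 : Matrix ι ι ℝ) - B s).PosSemidef) ∧
      ∀ x : ι → ℝ, ∃ y, y ⬝ᵥ y = ∑ t ∈ R, x ⬝ᵥ L t *ᵥ x ∧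
        ∀ s ∈ R, y ⬝ᵥ B s *ᵥ y = x ⬝ᵥ L s *ᵥ x := by
  have hS : (∑ t ∈ R, L t).PosSemidef := posSemidef_sum R hL
  obtain ⟨U, d, hU⟩ := exists_diagonalizes hS.1
  have hsum : ∀ x : ι → ℝ, x ⬝ᵥ (∑ t ∈ R, L t) *ᵥ x = ∑ t ∈ R, x ⬝ᵥ L t *ᵥ x := by
    intro x
    rw [sum_mulVec, dotProduct_sum]
  have hd : ∀ i, 0 ≤ d i := by
    have := hS.mul_mul_conjTranspose_same Uᵀ
    rw [conjTranspose_eq_transpose_of_trivial, transpose_transpose, hU.mul_eq, mul_assoc, hU.left,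
      mul_one] at this
    exact posSemidef_diagonal_iff.1 this
  -- The convention `0⁻¹ = 0` yields a pseudoinverse square root, so a singular sum (a disconnected
  -- graph, constant functions) needs no separate treatment.
  set p : ι → ℝ := fun i => (√(d i))⁻¹ with hp
  set P := U * diagonal p with hP
  have hpd : ∀ i, p i * d i * p i = if d i = 0 then 0 else 1 := by
    intro i
    split_ifs with h
    · simp [h]
    · have h1 : 0 < √(d i) := Real.sqrt_pos.2 (lt_of_le_of_ne (hd i) (Ne.symm h))
      have h2 := Real.mul_self_sqrt (hd i)
      simp only [hp]
      field_simp
      rw [sq, h2]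
  have hPt : Pᵀ = diagonal p * Uᵀ := by rw [hP, transpose_mul, diagonal_transpose]
  have hPLP : Pᵀ * (∑ t ∈ R, L t) * P = diagonal fun i => if d i = 0 then 0 else 1 := by
    have h1 : diagonal p * (diagonal d * Uᵀ) * (U * diagonal p) =
        diagonal p * diagonal d * (Uᵀ * U) * diagonal p := by simp only [mul_assoc]
    rw [hPt, hP, mul_assoc (diagonal p), hU.mul_eq, h1, hU.left, mul_one, diagonal_mul_diagonal,
      diagonal_mul_diagonal]
    congr 1
    funext i
    exact hpd i
  have hB1 : (1 - ∑ s ∈ R, Pᵀ * L s * P).PosSemidef := by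
    rw [← Finset.sum_mul, ← Finset.mul_sum, hPLP, ← diagonal_one, diagonal_sub]
    refine posSemidef_diagonal_iff.2 fun i => ?_
    split_ifs <;> norm_num
  have hB0 : ∀ s ∈ R, (Pᵀ * L s * P).PosSemidef := by
    intro s hs
    have := (hL s hs).mul_mul_conjTranspose_same Pᵀ
    rwa [conjTranspose_eq_transpose_of_trivial, transpose_transpose] at this
  refine ⟨fun s => Pᵀ * L s * P, hB0, hB1, ?_, fun x => ?_⟩
  · intro s hs c hc h
    refine PosSemidef.of_dotProduct_mulVec_nonneg ?_ fun y => ?_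
    · refine IsHermitian.sub ?_ (hB0 s hs).1
      rw [IsHermitian, conjTranspose_smul, conjTranspose_one, star_trivial]
    · have h1 := h (P *ᵥ y)
      simp only [← dotProduct_conj_mulVec] at h1
      have h2 := hB1.dotProduct_mulVec_nonneg y
      rw [star_trivial, sub_mulVec, one_mulVec, dotProduct_sub, sum_mulVec, dotProduct_sum,
        sub_nonneg] at h2
      have h3 := mul_le_mul_of_nonneg_left h2 hc
      rw [star_trivial, sub_mulVec, dotProduct_sub, smul_mulVec, one_mulVec, dotProduct_smul,
        smul_eq_mul]
      linarith
  -- The square root of the total form applied to `x`, in eigencoordinates. Then `P *ᵥ y` is `x`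
  -- without its component in the kernel of the sum.
  · set y := diagonal (fun i => √(d i)) *ᵥ (Uᵀ *ᵥ x) with hy
    have hPy : x - P *ᵥ y = U *ᵥ (diagonal (fun i => if d i = 0 then 1 else 0) *ᵥ (Uᵀ *ᵥ x)) := by
      have h1 : x = U *ᵥ (diagonal (fun _ => 1) *ᵥ (Uᵀ *ᵥ x)) := by
        rw [diagonal_one, one_mulVec, mulVec_mulVec, hU.right, one_mulVec]
      have h2 : P *ᵥ y = U *ᵥ (diagonal (fun i => if d i = 0 then 0 else 1) *ᵥ (Uᵀ *ᵥ x)) := by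
        rw [hP, hy, ← mulVec_mulVec, mulVec_mulVec _ (diagonal p), diagonal_mul_diagonal]
        congr 3
        funext i
        split_ifs with h
        · simp [h]
        · have h1 : 0 < √(d i) := Real.sqrt_pos.2 (lt_of_le_of_ne (hd i) (Ne.symm h))
          simp only [hp]
          field_simp
      conv_lhs => rw [h1, h2]
      rw [← mulVec_sub, ← sub_mulVec, diagonal_sub]
      congr 3
      funext i
      split_ifs <;> norm_num
    -- A sum of nonnegative forms vanishes only where each of them does, so the lost component is
    -- invisible to every `L s`.
    have hker : ∀ s ∈ R, L s *ᵥ (x - P *ᵥ y) = 0 := by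
      have h0 : (∑ t ∈ R, L t) *ᵥ (x - P *ᵥ y) = 0 := by
        rw [hPy, mulVec_mulVec, hU.mul_eq', ← mulVec_mulVec, mulVec_mulVec _ (diagonal d),
          diagonal_mul_diagonal]
        have : (diagonal fun i => d i * if d i = 0 then (1 : ℝ) else 0) = 0 := by
          rw [← diagonal_zero]
          congr 1
          funext i
          split_ifs with h <;> simp [h]
        rw [this, zero_mulVec, mulVec_zero]
      have h1 := hsum (x - P *ᵥ y)
      rw [h0, dotProduct_zero] at h1
      intro s hs
      have h2 := (sum_eq_zero_iff_of_nonneg fun t ht => by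
        simpa using (hL t ht).dotProduct_mulVec_nonneg (x - P *ᵥ y)).1 h1.symm s hs
      exact ((hL s hs).dotProduct_mulVec_zero_iff _).1 (by simpa using h2)
    refine ⟨y, ?_, fun s hs => ?_⟩
    · rw [← hsum]
      conv_rhs => rw [hU.eq]
      rw [← mulVec_mulVec, ← mulVec_mulVec, dotProduct_mulVec x U, ← mulVec_transpose, hy,
        dotProduct, dotProduct]
      refine sum_congr rfl fun i _ => ?_
      rw [mulVec_diagonal, mulVec_diagonal]
      have := Real.mul_self_sqrt (hd i)
      linear_combination ((Uᵀ *ᵥ x) i) ^ 2 * this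
    · rw [dotProduct_conj_mulVec]
      have h1 := hker s hs
      rw [mulVec_sub, sub_eq_zero] at h1
      have hLt : (L s)ᵀ = L s := by simpa using (hL s hs).1.eq
      rw [← h1, dotProduct_mulVec, ← mulVec_transpose, hLt, ← h1, dotProduct_comm]

end Normalization

variable {G : Type u} [Group G] [Fintype G] [DecidableEq G]

/-! ### Sampling generators of a Cayley graph -/

/-- The difference operator of a generator. -/
def diffOp (s : G) : Matrix G G ℝ := 1 - Matrix.of fun u v => if v = u * s then 1 else 0

theorem dotProduct_diffOp (s : G) (x : G → ℝ) :
    x ⬝ᵥ ((diffOp s)ᵀ * diffOp s) *ᵥ x = genEnergy s x := by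
  have : diffOp s *ᵥ x = fun u => x u - x (u * s) := by
    funext u
    rw [diffOp, sub_mulVec, one_mulVec, Pi.sub_apply]
    simp [mulVec, dotProduct]
  rw [← mulVec_mulVec, dotProduct_mulVec, ← mulVec_transpose, transpose_transpose, this, genEnergy,
    dotProduct]
  exact sum_congr rfl fun u _ => (sq _).symm

/-- The weighted Laplacian of a pair of inverse generators. -/
def pairLaplacian (H : CayleyGraph G) (s : G) : Matrix G G ℝ :=
  (H.weight s * if s⁻¹ = s then 1 / 2 else 1) • ((diffOp s)ᵀ * diffOp s)

theorem dotProduct_pairLaplacian (H : CayleyGraph G) (s : G) (x : G → ℝ) :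
    x ⬝ᵥ H.pairLaplacian s *ᵥ x = H.weight s * pairEnergy s x := by
  rw [pairLaplacian, smul_mulVec, dotProduct_smul, dotProduct_diffOp, smul_eq_mul, pairEnergy]
  split_ifs <;> ring

theorem pairLaplacian_posSemidef (H : CayleyGraph G) {s : G} (hs : 0 ≤ H.weight s) :
    (H.pairLaplacian s).PosSemidef := by
  refine PosSemidef.smul ?_ ?_
  · rw [← conjTranspose_eq_transpose_of_trivial]
    exact posSemidef_conjTranspose_mul_self _
  · split_ifs <;> simp [hs]

section Thinned

variable {H : CayleyGraph G} {R T : Finset G} {q : G → ℝ}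

omit [Fintype G] in
theorem thinned_gens_subset (hH : H.IsUndirected) (hT : T ⊆ H.gens) :
    (H.thinned q T).gens ⊆ H.gens := by
  intro s hs
  simp only [thinned, mem_union, mem_image] at hs
  rcases hs with hs | ⟨t, ht, rfl⟩
  · exact hT hs
  · exact (hH t (hT ht)).2.1

omit [Fintype G] in
theorem thinned_isUndirected (hH : H.IsUndirected) (hT : T ⊆ H.gens)
    (hq : ∀ s ∈ H.gens, 0 ≤ q s ∧ q s⁻¹ = q s) : (H.thinned q T).IsUndirected := by
  intro s hs
  have hs' := thinned_gens_subset (q := q) hH hT hs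
  have hinv : s⁻¹ ∈ (H.thinned q T).gens := by
    simp only [thinned, RealRAM.mem_union_image_inv, inv_inv] at hs ⊢
    exact hs.symm
  obtain ⟨h1, h2⟩ := hq s hs'
  simp only [thinned] at hs hinv ⊢
  rw [if_pos hs, if_pos hinv, (hH s hs').2.2, h2]
  exact ⟨div_nonneg (hH s hs').1 h1, hinv, rfl⟩

theorem thinned_energy (hH : H.IsUndirected) (hR : IsHalf R H.gens) (hT : T ⊆ R)
    (hq : ∀ s ∈ H.gens, 0 ≤ q s ∧ q s⁻¹ = q s) (x : G → ℝ) :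
    (H.thinned q T).energy x =
      ∑ s ∈ R, (if s ∈ T then 1 / q s else 0) * (H.weight s * pairEnergy s x) := by
  have hT' : IsHalf T (H.thinned q T).gens := by
    refine ⟨subset_union_left, fun s hs => ?_, fun s hs hs' => hR.2.2 s (hT hs) (hT hs')⟩
    simpa only [thinned, RealRAM.mem_union_image_inv] using hs
  rw [energy_eq_sum_half (thinned_isUndirected hH (hT.trans hR.1) hq) hT']
  simp only [ite_mul, zero_mul]
  rw [sum_ite_mem, inter_eq_right.2 hT]
  refine sum_congr rfl fun s hs => ?_
  simp only [thinned]
  rw [if_pos (mem_union_left _ hs)]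
  ring

/-- The sampled graph is a spectral sparsifier with high probability. -/
theorem sampleExp_not_sparsifier_le (hH : H.IsUndirected) (hR : IsHalf R H.gens)
    (hq : ∀ s ∈ H.gens, (0 ≤ q s ∧ q s ≤ 1) ∧ q s⁻¹ = q s) {ρ : ℝ} (hρ : 0 ≤ ρ)
    (hs1 : ∀ s ∈ R, q s = 1 ∨ ∀ x, H.weight s * pairEnergy s x ≤ q s * ρ * H.energy x)
    (m : ℕ) {ε : ℝ} (hε : 0 < ε) (hε1 : ε < 1) (h : 20 * (m + 1) * ρ ≤ ε ^ 2) :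
    sampleExp R q (fun T => open Classical in
      if (H.thinned q T).IsSpectralSparsifier H ε then 0 else 1) ≤
      Fintype.card G * (1 / 4) ^ (m + 1) := by
  classical
  have hqR : ∀ s ∈ R, 0 ≤ q s ∧ q s ≤ 1 := fun s hs => (hq s (hR.1 hs)).1
  have hL : ∀ s ∈ R, (H.pairLaplacian s).PosSemidef := fun s hs =>
    pairLaplacian_posSemidef H (hH s (hR.1 hs)).1
  obtain ⟨B, hB, hsum, hle, hquad⟩ := exists_normalization R hL
  have hsumE : ∀ x, ∑ t ∈ R, x ⬝ᵥ H.pairLaplacian t *ᵥ x = H.energy x := by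
    intro x
    simp only [dotProduct_pairLaplacian, energy_eq_sum_half hH hR]
  simp only [hsumE] at hle hquad
  simp only [dotProduct_pairLaplacian] at hle hquad
  refine le_trans (sampleExp_mono hqR fun T hT => ?_) (sampleExp_bad_le hqR hB hρ
    (fun s hs => (hs1 s hs).imp id (hle s hs _ (mul_nonneg (hqR s hs).1 hρ))) hsum m hε hε1 h)
  by_cases hbad : ∀ y, |y ⬝ᵥ deviation R q B T *ᵥ y| ≤ ε * (y ⬝ᵥ y)
  · have : (H.thinned q T).IsSpectralSparsifier H ε := by
      intro x
      obtain ⟨y, hy, hyB⟩ := hquad x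
      have h1 := hbad y
      have h2 : y ⬝ᵥ deviation R q B T *ᵥ y = (H.thinned q T).energy x - H.energy x := by
        rw [thinned_energy hH hR hT fun s hs => ⟨(hq s hs).1.1, (hq s hs).2⟩,
          energy_eq_sum_half hH hR, ← sum_sub_distrib, deviation, sum_mulVec, dotProduct_sum]
        refine sum_congr rfl fun s hs => ?_
        rw [smul_mulVec, dotProduct_smul, hyB s hs, smul_eq_mul]
        ring
      rw [h2, hy, abs_le] at h1
      constructor <;> linarith [h1.1, h1.2]
    rw [if_pos this, if_pos hbad]
  · rw [if_neg hbad]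
    split_ifs <;> norm_num

omit [Group G] [Fintype G] in
-- One generator contributes the factor `1 + (e - 1) q ≤ 1 + 2 q ≤ exp (2 q)` to the exponential
-- moment.
theorem sampleExp_exp_card_le (hq : ∀ s ∈ R, 0 ≤ q s ∧ q s ≤ 1) :
    sampleExp R q (fun T => Real.exp #T) ≤ Real.exp (2 * ∑ s ∈ R, q s) := by
  induction R using Finset.induction_on with
  | empty => simp [sampleExp_empty]
  | insert s R hs ih =>
    have ih := ih fun t ht => hq t (mem_insert_of_mem ht)
    obtain ⟨h0, h1⟩ := hq s (mem_insert_self _ _)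
    have e1 : sampleExp R q (fun T => Real.exp #(insert s T)) =
        Real.exp 1 * sampleExp R q (fun T => Real.exp #T) := by
      rw [← sampleExp_const_mul]
      refine sampleExp_congr (fun _ _ => rfl) fun T hT => ?_
      rw [card_insert_of_notMem fun h => hs (hT h), Nat.cast_succ, add_comm, Real.exp_add]
    have hpos : 0 ≤ sampleExp R q (fun T => Real.exp #T) := by
      rw [← sampleExp_const R q 0]
      exact sampleExp_mono (fun t ht => hq t (mem_insert_of_mem ht)) fun T _ => (Real.exp_pos _).le
    have h3 := Real.exp_one_lt_d9
    have h4 := Real.add_one_le_exp (2 * q s)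
    rw [sampleExp_insert hs, e1, sum_insert hs, mul_add, Real.exp_add]
    calc _ = (q s * Real.exp 1 + (1 - q s)) * sampleExp R q (fun T => Real.exp #T) := by ring
      _ ≤ (2 * q s + 1) * sampleExp R q (fun T => Real.exp #T) := by
          exact mul_le_mul_of_nonneg_right (by norm_num at h3; nlinarith) hpos
      _ ≤ _ := mul_le_mul h4 ih hpos (Real.exp_pos _).le

omit [Group G] [Fintype G] in
/-- A Chernoff bound for the number of kept generators. -/
theorem sampleExp_card_gt_le (hq : ∀ s ∈ R, 0 ≤ q s ∧ q s ≤ 1) (M : ℝ) :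
    sampleExp R q (fun T => if (#T : ℝ) ≤ M then 0 else 1) ≤
      Real.exp (2 * ∑ s ∈ R, q s - M) := by
  calc _ ≤ sampleExp R q (fun T => Real.exp (-M) * Real.exp #T) := by
        refine sampleExp_mono hq fun T _ => ?_
        rw [← Real.exp_add]
        split_ifs with h
        · positivity
        · rw [← Real.exp_zero]
          apply Real.exp_le_exp.2
          push Not at h
          linarith
    _ ≤ Real.exp (-M) * Real.exp (2 * ∑ s ∈ R, q s) := by
        rw [sampleExp_const_mul]
        exact mul_le_mul_of_nonneg_left (sampleExp_exp_card_le hq) (Real.exp_pos _).le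
    _ = _ := by rw [← Real.exp_add]; congr 1; ring

end Thinned

theorem log_card_le (n : ℕ) : Real.log n ≤ Nat.clog 2 n := by
  rcases n.eq_zero_or_pos with rfl | hn
  · simp
  have h1 : (n : ℝ) ≤ 2 ^ Nat.clog 2 n := by exact_mod_cast Nat.le_pow_clog one_lt_two n
  have h2 := Real.log_le_log (by exact_mod_cast hn) h1
  rw [Real.log_pow] at h2
  have h3 := Real.log_two_lt_d9
  have h4 : (0 : ℝ) ≤ Nat.clog 2 n := by positivity
  nlinarith

theorem log_two_le_log {n : ℕ} (hn : 2 ≤ n) : 0.69 ≤ Real.log n := by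
  have h1 : Real.log 2 ≤ Real.log n := Real.log_le_log two_pos (by exact_mod_cast hn)
  have := Real.log_two_gt_d9
  norm_num at *
  linarith

theorem clog_le_log {n : ℕ} (hn : 2 ≤ n) : (Nat.clog 2 n : ℝ) ≤ 3 * Real.log n := by
  have h1 : (2 : ℝ) ^ (Nat.clog 2 n - 1) ≤ n := by
    exact_mod_cast (Nat.pow_pred_clog_lt_self one_lt_two hn).le
  have h2 := Real.log_le_log (by positivity) h1
  have hpos : 0 < Nat.clog 2 n := Nat.clog_pos one_lt_two hn
  rw [Real.log_pow, Nat.cast_sub hpos] at h2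
  have h3 := Real.log_two_gt_d9
  have h4 := log_two_le_log hn
  have h5 : (1 : ℝ) ≤ Nat.clog 2 n := by exact_mod_cast hpos
  norm_num at *
  nlinarith

omit [DecidableEq G] in
-- Both failure probabilities, for the spectrum and for the size, are at most `|G| ^ (-(c + 1))`; `2
-- ≤ |G|` absorbs the sum of the two.
theorem failure_le (hn : 2 ≤ Fintype.card G) (c : ℕ) {μ M : ℝ}
    (hM : 2 * μ + (c + 1) * Real.log (Fintype.card G) ≤ M) :
    (Fintype.card G : ℝ) * (1 / 4) ^ ((c + 2) * Nat.clog 2 (Fintype.card G)) +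
      Real.exp (2 * μ - M) ≤ 1 / (Fintype.card G : ℝ) ^ c := by
  set n := Fintype.card G
  have hn0 : (0 : ℝ) < n := by positivity
  have hn2 : (2 : ℝ) ≤ n := by exact_mod_cast hn
  have h1 : Real.exp (2 * μ - M) ≤ 1 / (n : ℝ) ^ (c + 1) := by
    calc Real.exp (2 * μ - M) ≤ Real.exp (-((c + 1 : ℕ) * Real.log n)) := by
          apply Real.exp_le_exp.2; push_cast; linarith
      _ = 1 / (n : ℝ) ^ (c + 1) := by
          rw [Real.exp_neg, Real.exp_nat_mul, Real.exp_log hn0, one_div]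
  have h2 : (n : ℝ) * (1 / 4) ^ ((c + 2) * Nat.clog 2 n) ≤ 1 / (n : ℝ) ^ (c + 1) := by
    have h3 : (n : ℝ) ≤ 2 ^ Nat.clog 2 n := by exact_mod_cast Nat.le_pow_clog one_lt_two n
    have h4 : (n : ℝ) ^ (2 * (c + 2)) ≤ 4 ^ ((c + 2) * Nat.clog 2 n) := by
      calc (n : ℝ) ^ (2 * (c + 2)) ≤ (2 ^ Nat.clog 2 n) ^ (2 * (c + 2)) := by gcongr
        _ = 4 ^ ((c + 2) * Nat.clog 2 n) := by
            rw [show (4 : ℝ) = 2 ^ 2 by norm_num, ← pow_mul, ← pow_mul]; congr 1; ring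
    rw [_root_.one_div_pow, mul_one_div, div_le_div_iff₀ (by positivity) (by positivity), one_mul]
    calc (n : ℝ) * n ^ (c + 1) = n ^ (c + 2) := by ring
      _ ≤ n ^ (2 * (c + 2)) := pow_le_pow_right₀ (by linarith) (by omega)
      _ ≤ _ := h4
  have h5 : 1 / (n : ℝ) ^ (c + 1) + 1 / (n : ℝ) ^ (c + 1) ≤ 1 / (n : ℝ) ^ c := by
    rw [← add_div, div_le_div_iff₀ (by positivity) (by positivity), pow_succ]
    have : (0 : ℝ) < n ^ c := by positivity
    nlinarith
  linarith

theorem IsSparsifierOfSize.mono {H' H : CayleyGraph G} {ε m m' : ℝ}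
    (h : H'.IsSparsifierOfSize H ε m) (hm : m ≤ m') : H'.IsSparsifierOfSize H ε m' :=
  ⟨h.1, h.2.1, h.2.2.1.trans hm, h.2.2.2⟩

/-- Importance sampling produces a small sparsifier with high probability. -/
theorem le_sampleExp_sparsifier (hn : 2 ≤ Fintype.card G) (c : ℕ) {H : CayleyGraph G}
    {R : Finset G} {q : G → ℝ} (hH : H.IsUndirected) (hR : IsHalf R H.gens)
    (hq : ∀ s ∈ H.gens, (0 ≤ q s ∧ q s ≤ 1) ∧ q s⁻¹ = q s) {ρ : ℝ} (hρ : 0 ≤ ρ)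
    (hs1 : ∀ s ∈ R, q s = 1 ∨ ∀ x, H.weight s * pairEnergy s x ≤ q s * ρ * H.energy x)
    {ε : ℝ} (hε : 0 < ε) (hε1 : ε < 1)
    (h : 20 * ((c + 2) * Nat.clog 2 (Fintype.card G)) * ρ ≤ ε ^ 2) {M : ℝ}
    (hM : 2 * ∑ s ∈ R, q s + (c + 1) * Real.log (Fintype.card G) ≤ M) :
    1 - 1 / (Fintype.card G : ℝ) ^ c ≤ sampleExp R q (fun T => open Classical in
      if (H.thinned q T).IsSparsifierOfSize H ε (2 * M) then 1 else 0) := by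
  classical
  have hqR : ∀ s ∈ R, 0 ≤ q s ∧ q s ≤ 1 := fun s hs => (hq s (hR.1 hs)).1
  have hpos : 0 < (c + 2) * Nat.clog 2 (Fintype.card G) :=
    Nat.mul_pos (by omega) (Nat.clog_pos one_lt_two hn)
  have h1 := sampleExp_not_sparsifier_le hH hR hq hρ hs1 ((c + 2) * Nat.clog 2 (Fintype.card G) - 1)
    hε hε1 (by rw [Nat.cast_sub hpos]; push_cast; simpa using h)
  rw [Nat.sub_add_cancel hpos] at h1
  have h2 := sampleExp_card_gt_le hqR M
  have h3 := failure_le hn c hM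
  -- The union bound. The inverses of the kept representatives at most double the size, hence `2 *
  -- M`.
  have h4 : sampleExp R q (fun _ => 1) ≤ sampleExp R q (fun T =>
      (if (H.thinned q T).IsSparsifierOfSize H ε (2 * M) then 1 else 0) +
      ((if (H.thinned q T).IsSpectralSparsifier H ε then 0 else 1) +
        if (#T : ℝ) ≤ M then 0 else 1)) := by
    refine sampleExp_mono hqR fun T hT => ?_
    by_cases hA : (H.thinned q T).IsSpectralSparsifier H ε
    · by_cases hB : (#T : ℝ) ≤ M
      · have : (H.thinned q T).IsSparsifierOfSize H ε (2 * M) := by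
          refine ⟨thinned_gens_subset hH (hT.trans hR.1), thinned_isUndirected hH (hT.trans hR.1)
            fun s hs => ⟨(hq s hs).1.1, (hq s hs).2⟩, ?_, hA⟩
          have : #(H.thinned q T).gens ≤ 2 * #T := by
            simp only [thinned]
            have := card_union_le T (T.image (·⁻¹))
            have := card_image_le (s := T) (f := (·⁻¹))
            omega
          calc (#(H.thinned q T).gens : ℝ) ≤ 2 * #T := by exact_mod_cast this
            _ ≤ 2 * M := by linarith
        rw [if_pos this]
        split_ifs
        norm_num
      · rw [if_neg hB]
        split_ifs <;> norm_num
    · rw [if_neg hA]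
      split_ifs <;> norm_num
  rw [sampleExp_const, sampleExp_add, sampleExp_add] at h4
  linarith

end CayleyGraph

namespace CayleyGraph

variable {G : Type u} [Group G] [Fintype G] [DecidableEq G]

/-! ### Size of the sample -/

/-- A weak-type bound on importances bounds their sum, up to a logarithmic factor. -/
theorem sum_le_of_important {H : CayleyGraph G} (hH : H.IsUndirected) (hne : H.gens.Nonempty)
    {r : ℕ} (hr : Fintype.card G < 2 ^ r) {f : G → ℝ} (hf : ∀ s ∈ H.gens, 0 ≤ f s) {B : ℝ}
    (hB : 0 < B) (h : ∀ θ > 0, ∀ s ∈ H.gens, θ < f s →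
      ∃ x, θ * H.energy x < B * (H.extWeight s * genEnergy s x)) :
    ∑ s ∈ H.gens, f s ≤ 24 * B * r ^ 3 * Real.log (#H.gens + 1) := by
  have h1 : ∀ θ > 0, #{s ∈ H.gens | θ < f s} * θ ≤ 8 * r ^ 3 * B := by
    intro θ hθ
    have := card_important_le hH (div_pos hθ hB) hr {s ∈ H.gens | θ < f s} (by
      intro s hs
      rw [mem_filter] at hs
      obtain ⟨x, hx⟩ := h θ hθ s hs.1 hs.2
      refine ⟨x, ?_⟩
      rw [div_mul_eq_mul_div, div_lt_iff₀ hB]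
      linarith)
    rwa [mul_div_assoc', div_le_iff₀ hB] at this
  have h2 := sum_le_harmonic f H.gens h1 hf
  have h3 := harmonic_le_three_log (card_pos.2 hne)
  have h4 : 0 ≤ 8 * (r : ℝ) ^ 3 * B := by positivity
  calc _ ≤ 8 * (r : ℝ) ^ 3 * B * harmonic #H.gens := h2
    _ ≤ 8 * (r : ℝ) ^ 3 * B * (3 * Real.log (#H.gens + 1)) := by gcongr
    _ = _ := by ring

theorem card_lt_two_pow_clog_succ (n : ℕ) : n < 2 ^ (Nat.clog 2 n + 1) :=
  (Nat.le_pow_clog one_lt_two n).trans_lt (Nat.pow_lt_pow_right one_lt_two (Nat.lt_succ_self _))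

theorem clog_succ_le_log {n : ℕ} (hn : 2 ≤ n) :
    ((Nat.clog 2 n + 1 : ℕ) : ℝ) ≤ 6 * Real.log n := by
  have h1 := clog_le_log hn
  have h2 : (1 : ℝ) ≤ Nat.clog 2 n := by exact_mod_cast Nat.clog_pos one_lt_two hn
  push_cast
  linarith

/-- The constant in the size of a sparsifier, if `∑ q` is bounded with constant `K` and the failure
probability with exponent `c`. -/
def sizeConst (K : ℝ) (c : ℕ) : ℝ := 4 * K + 40 + 20 * (c + 1)

theorem sizeConst_nonneg {K : ℝ} (hK : 0 ≤ K) (c : ℕ) : 0 ≤ sizeConst K c := by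
  unfold sizeConst; positivity

/-- Both logarithms are at least `0.69` and `ε < 1`, so `10 Z` exceeds `1` and `log n`. The additive
terms are absorbed this way into the constant. -/
theorem size_le {n m : ℕ} (hn : 2 ≤ n) (hm : 1 ≤ m) (c : ℕ) {ε : ℝ} (hε : 0 < ε) (hε1 : ε < 1)
    {K μ : ℝ} (hμ : μ ≤ 1 + K * (Real.log n ^ 4 * Real.log (m + 1) / ε ^ 2)) :
    2 * (2 * μ + (c + 1) * Real.log n) ≤
      sizeConst K c * Real.log n ^ 4 * Real.log (m + 1) / ε ^ 2 := by
  set Z := Real.log n ^ 4 * Real.log (m + 1) / ε ^ 2 with hZ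
  have h1 := log_two_le_log hn
  have h2 : 0.69 ≤ Real.log (m + 1) := by
    have := log_two_le_log (n := m + 1) (by omega)
    rwa [Nat.cast_succ] at this
  have h3 : Real.log n ^ 4 * Real.log (m + 1) ≤ Z := by
    rw [hZ, le_div_iff₀ (by positivity)]
    refine mul_le_of_le_one_right (by positivity) ?_
    exact pow_le_one₀ hε.le hε1.le
  have h4 : Real.log n * 0.1 ≤ Real.log n ^ 4 * Real.log (m + 1) := by
    have h5 : (0.1 : ℝ) ≤ Real.log n ^ 3 * Real.log (m + 1) := by
      calc (0.1 : ℝ) ≤ 0.69 ^ 3 * 0.69 := by norm_num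
        _ ≤ _ := by gcongr
    calc _ ≤ Real.log n * (Real.log n ^ 3 * Real.log (m + 1)) := by gcongr
      _ = _ := by ring
  have h6 : (c + 1) * Real.log n ≤ (c + 1) * (10 * Z) := by
    have : Real.log n ≤ 10 * Z := by linarith
    gcongr
  have h7 : 1 ≤ 10 * Z := by
    have h5 : (0.1 : ℝ) ≤ Real.log n ^ 4 * Real.log (m + 1) := by
      calc (0.1 : ℝ) ≤ 0.69 ^ 4 * 0.69 := by norm_num
        _ ≤ _ := by gcongr
    linarith
  have h8 : sizeConst K c * Real.log n ^ 4 * Real.log (m + 1) / ε ^ 2 = sizeConst K c * Z := by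
    rw [hZ]; ring
  rw [h8, sizeConst]
  linarith

theorem energy_eq_zero_of_gens_eq_empty {H : CayleyGraph G} (h : H.gens = ∅) (x : G → ℝ) :
    H.energy x = 0 := by
  simp [energy, h]

/-- Importance sampling with a bound on the expected size. The case of a trivial group and that of
an empty set of generators are included. -/
theorem le_sampleExp_sparsifier_of_size (c : ℕ) {H : CayleyGraph G} {R : Finset G} {q : G → ℝ}
    (hH : H.IsUndirected) (hR : IsHalf R H.gens)
    (hq : ∀ s ∈ H.gens, (0 ≤ q s ∧ q s ≤ 1) ∧ q s⁻¹ = q s) {ε : ℝ} (hε : 0 < ε) (hε1 : ε < 1)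
    {K : ℝ} (main : 2 ≤ Fintype.card G → H.gens.Nonempty → ∃ ρ, 0 ≤ ρ ∧
      (∀ s ∈ R, q s = 1 ∨ ∀ x, H.weight s * pairEnergy s x ≤ q s * ρ * H.energy x) ∧
      20 * ((c + 2) * Nat.clog 2 (Fintype.card G)) * ρ ≤ ε ^ 2 ∧
      ∑ s ∈ H.gens, q s ≤
        1 + K * (Real.log (Fintype.card G) ^ 4 * Real.log (#H.gens + 1) / ε ^ 2)) :
    1 - 1 / (Fintype.card G : ℝ) ^ c ≤ sampleExp R q (fun T => open Classical in
      if (H.thinned q T).IsSparsifierOfSize H ε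
        (sizeConst K c * Real.log (Fintype.card G) ^ 4 * Real.log (#H.gens + 1) / ε ^ 2)
      then 1 else 0) := by
  classical
  have hqR : ∀ s ∈ R, 0 ≤ q s ∧ q s ≤ 1 := fun s hs => (hq s (hR.1 hs)).1
  rcases lt_or_ge (Fintype.card G) 2 with hn | hn
  -- For the trivial group the required probability is `0`.
  · have hn1 : Fintype.card G = 1 := le_antisymm (by omega) Fintype.card_pos
    rw [hn1, Nat.cast_one, one_pow, div_one, sub_self]
    refine (sampleExp_const R q 0).symm.trans_le (sampleExp_mono hqR fun T _ => ?_)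
    split_ifs <;> norm_num
  rcases H.gens.eq_empty_or_nonempty with hS | hS
  -- Without generators the size bound is `0`, as `log (0 + 1) = 0`, and the empty graph attains it.
  · have hR0 : R = ∅ := subset_empty.1 (hS ▸ hR.1)
    have hT : (H.thinned q ∅).gens = ∅ := by simp [thinned]
    have : (H.thinned q ∅).IsSparsifierOfSize H ε
        (sizeConst K c * Real.log (Fintype.card G) ^ 4 * Real.log (#H.gens + 1) / ε ^ 2) := by
      refine ⟨by simp [hT], fun s hs => by simp [hT] at hs, by simp [hT, hS], fun x => ?_⟩
      simp [energy_eq_zero_of_gens_eq_empty hT, energy_eq_zero_of_gens_eq_empty hS]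
    rw [hR0, sampleExp_empty, if_pos this]
    have : (0 : ℝ) ≤ 1 / (Fintype.card G : ℝ) ^ c := by positivity
    linarith
  obtain ⟨ρ, hρ, hs1, h, hsum⟩ := main hn hS
  have h1 := le_sampleExp_sparsifier hn c hH hR hq hρ hs1 hε hε1 h le_rfl
  refine h1.trans (sampleExp_mono hqR fun T _ => ?_)
  have h2 := size_le hn (card_pos.2 hS) c hε hε1 ((sum_le_sum_of_subset_of_nonneg hR.1
    fun s hs _ => (hq s hs).1.1).trans hsum)
  split_ifs with h3 h4 h4
  · exact le_rfl
  · exact absurd (h3.mono h2) h4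
  · norm_num
  · exact le_rfl

end CayleyGraph

/-! ### Guarantees of the sampling program -/

namespace RealRAM

open CayleyGraph

variable {G : Type u} [Group G] [Fintype G] [DecidableEq G]

/-- The expected number of generators kept by the program. -/
theorem sum_acceptProb_le (e : G ≃ Fin (Fintype.card G)) {H : CayleyGraph G}
    (hH : H.IsUndirected) {ε : ℝ} (hε : 0 < ε) {C : ℕ} (hC : 0 < C)
    (hn : 2 ≤ Fintype.card G) (hne : H.gens.Nonempty) :
    ∑ s ∈ H.gens, acceptProb e H ε C s ≤ 1 + 31104 * C *
      (Real.log (Fintype.card G) ^ 4 * Real.log (#H.gens + 1) / ε ^ 2) := by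
  generalize hn' : (Fintype.card G : ℝ) = N
  set l := Nat.clog 2 (Fintype.card G) with hl
  have hl0 : (0 : ℝ) < l := by exact_mod_cast Nat.clog_pos one_lt_two hn
  have hC0 : (0 : ℝ) < C := by exact_mod_cast hC
  -- Probabilities at the truncation level carry no information on importance and are set to zero.
  -- There are at most `|G|` of them, each at most `1 / |G|`, which is the summand `1`.
  set f : G → ℝ := fun s => if acceptProb e H ε C s ≤ (1 / 2) ^ l then 0 else acceptProb e H ε C s
  have hf : ∀ s ∈ H.gens, 0 ≤ f s := by
    intro s _
    simp only [f]
    split_ifs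
    · exact le_rfl
    · exact (acceptProb_mem e H ε C s).1
  have hsum := sum_le_of_important hH hne (card_lt_two_pow_clog_succ _) hf
    (B := 2 * (C * l) / ε ^ 2) (by positivity) (by
      intro θ hθ s _ hlt
      simp only [f] at hlt
      split_ifs at hlt with hq
      · linarith
      obtain ⟨x, hx⟩ := (acceptProb_upper e H ε C s).resolve_left hq
      refine ⟨x, ?_⟩
      rw [div_mul_eq_mul_div, lt_div_iff₀ (by positivity)]
      calc θ * H.energy x * ε ^ 2 ≤ acceptProb e H ε C s * H.energy x * ε ^ 2 := by
            have := hH.energy_nonneg x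
            gcongr
        _ = acceptProb e H ε C s * ε ^ 2 * H.energy x := by ring
        _ < _ := hx)
  have h1 : ∑ s ∈ H.gens, acceptProb e H ε C s ≤ ∑ s ∈ H.gens, ((1 / 2) ^ l + f s) := by
    refine sum_le_sum fun s _ => ?_
    simp only [f]
    split_ifs with h
    · linarith
    · have : (0 : ℝ) ≤ (1 / 2) ^ l := by positivity
      linarith
  have h2 : (#H.gens : ℝ) * (1 / 2) ^ l ≤ 1 := by
    have h3 : (#H.gens : ℝ) ≤ 2 ^ l := by
      exact_mod_cast (card_le_univ H.gens).trans (Nat.le_pow_clog one_lt_two _)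
    rw [one_div_pow, mul_one_div, div_le_one (by positivity)]
    exact h3
  rw [sum_add_distrib, sum_const, nsmul_eq_mul] at h1
  have hlog : 0 ≤ Real.log (#H.gens + 1) := Real.log_nonneg (by simp)
  have hlogn : 0 ≤ Real.log N := hn' ▸ Real.log_natCast_nonneg _
  -- The constant is `24 * 2 * 3 * 6 ^ 3`, from `l ≤ 3 log |G|` and `l + 1 ≤ 6 log |G|`.
  have h4 : 24 * (2 * (C * (l : ℝ)) / ε ^ 2) * ((l + 1 : ℕ) : ℝ) ^ 3 * Real.log (#H.gens + 1) ≤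
      31104 * C * (Real.log N ^ 4 * Real.log (#H.gens + 1) / ε ^ 2) := by
    calc _ ≤ 24 * (2 * (C * (3 * Real.log N)) / ε ^ 2) * (6 * Real.log N) ^ 3 *
          Real.log (#H.gens + 1) := by
          have h5 := clog_le_log hn
          have h6 := clog_succ_le_log hn
          rw [hn'] at h5 h6
          gcongr
      _ = _ := by ring
  linarith

/-- The probabilities used by the program suffice for sparsification. -/
theorem le_sampleExp_acceptProb (c : ℕ) (e : G ≃ Fin (Fintype.card G)) {H : CayleyGraph G}
    (hH : H.IsUndirected) {ε : ℝ} (hε : 0 < ε) (hε1 : ε < 1) :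
    1 - 1 / (Fintype.card G : ℝ) ^ c ≤
      sampleExp (firstHalf e H.gens) (acceptProb e H ε (20 * (c + 2))) (fun T => open Classical in
        if (H.thinned (acceptProb e H ε (20 * (c + 2))) T).IsSparsifierOfSize H ε
          (sizeConst (31104 * (20 * (c + 2) : ℕ)) c * Real.log (Fintype.card G) ^ 4 *
            Real.log (#H.gens + 1) / ε ^ 2) then 1 else 0) := by
  have hR : IsHalf (firstHalf e H.gens) H.gens := isHalf_firstHalf e fun s hs => (hH s hs).2.1
  refine le_sampleExp_sparsifier_of_size c hH hR
    (fun s _ => ⟨acceptProb_mem e H ε _ s, acceptProb_inv e ε hH _ s⟩) hε hε1 fun hn hne => ?_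
  have hl0 : (0 : ℝ) < Nat.clog 2 (Fintype.card G) := by
    exact_mod_cast Nat.clog_pos one_lt_two hn
  -- The largest `ρ` that the concentration bound admits; `C = 20 (c + 2)` is chosen so that the
  -- guarantee of `acceptProb_lower` is the bound required with this `ρ`.
  refine ⟨ε ^ 2 / (20 * ((c + 2) * Nat.clog 2 (Fintype.card G))), by positivity, fun s hs => ?_,
    (mul_div_cancel₀ _ (by positivity)).le, sum_acceptProb_le e hH hε (by omega) hn hne⟩
  refine (acceptProb_lower e H ε (20 * (c + 2)) s).imp id fun h x => ?_
  have hs' := hR.1 hs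
  have h1 := h x
  rw [extWeight, if_pos hs'] at h1
  have h2 := mul_le_mul_of_nonneg_left (pairEnergy_le s x) (hH s hs').1
  have h3 : acceptProb e H ε (20 * (c + 2)) s *
      (ε ^ 2 / (20 * ((c + 2) * Nat.clog 2 (Fintype.card G)))) * H.energy x =
      acceptProb e H ε (20 * (c + 2)) s * ε ^ 2 * H.energy x /
        (20 * ((c + 2) * Nat.clog 2 (Fintype.card G))) := by ring
  rw [h3, le_div_iff₀ (by positivity)]
  push_cast at h1
  calc _ ≤ H.weight s * genEnergy s x * (20 * ((c + 2) * Nat.clog 2 (Fintype.card G))) := by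
        gcongr
    _ ≤ _ := by linarith

theorem time_le {n d : ℕ} (hn : 0 < n) (hd : 6400 ≤ d) : 6400 * n ^ 5 ≤ d * n ^ d :=
  Nat.mul_le_mul hd (Nat.pow_le_pow_right hn (by omega))

theorem sq_le_time {n d : ℕ} (hn : 0 < n) (hd : 6400 ≤ d) : n * n ≤ d * n ^ d := by
  calc n * n = 1 * n ^ 2 := by ring
    _ ≤ d * n ^ d := Nat.mul_le_mul (by omega) (Nat.pow_le_pow_right hn (by omega))

/-- The program finds sparsifiers in polynomial time with high probability. -/
theorem sampler_sparsifies (c : ℕ) (e : G ≃ Fin (Fintype.card G)) {H : CayleyGraph G}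
    (hH : H.IsUndirected) {ε : ℝ} (hε : 0 < ε) (hε1 : ε < 1) :
    Sparsifies (sampler (20 * (c + 2))) c 6400 e H ε
      (sizeConst (31104 * (20 * (c + 2) : ℕ)) c * Real.log (Fintype.card G) ^ 4 *
        Real.log (#H.gens + 1) / ε ^ 2) := by
  classical
  refine ⟨sampler_haltsWithin e H ε hH _ (time_le Fintype.card_pos le_rfl), ?_⟩
  rw [prob_sampler e ε hH _ (sq_le_time Fintype.card_pos le_rfl) fun H' => H'.IsSparsifierOfSize H ε
      (sizeConst (31104 * (20 * (c + 2) : ℕ)) c * Real.log (Fintype.card G) ^ 4 *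
        Real.log (#H.gens + 1) / ε ^ 2)]
  exact (le_sampleExp_acceptProb c e hH hε hε1).trans (le_of_eq (by congr!))

theorem Sparsifies.mono {p : Program} {c d : ℕ} {e : G ≃ Fin (Fintype.card G)} {H : CayleyGraph G}
    {ε m m' : ℝ} (h : Sparsifies p c d e H ε m) (hm : m ≤ m') : Sparsifies p c d e H ε m' := by
  classical
  refine ⟨h.1, h.2.trans ?_⟩
  unfold prob
  refine div_le_div_of_nonneg_right (Nat.cast_le.2 (card_le_card fun ω => ?_)) (by positivity)
  simp only [mem_filter, mem_univ, true_and]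
  rintro ⟨τ, t, he, hs⟩
  exact ⟨τ, t, he, CayleyGraph.IsSparsifierOfSize.mono hs hm⟩

/-- The probabilistic method: success has probability at least `1 - 1 / |G| ≥ 1 / 2`. -/
theorem Sparsifies.exists {p : Program} {d : ℕ} {e : G ≃ Fin (Fintype.card G)}
    {H : CayleyGraph G} {ε m : ℝ} (hn : 2 ≤ Fintype.card G) (h : Sparsifies p 1 d e H ε m) :
    ∃ H', CayleyGraph.IsSparsifierOfSize H' H ε m := by
  classical
  by_contra! hno
  have h1 := h.2
  have h2 : prob p (input e H ε) (d * Fintype.card G ^ d)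
      (fun τ => (output e τ).IsSparsifierOfSize H ε m) = 0 := by
    simp [prob, hno]
  rw [h2, pow_one, sub_nonpos, le_div_iff₀ (by positivity), one_mul] at h1
  have : (2 : ℝ) ≤ Fintype.card G := by exact_mod_cast hn
  linarith

end RealRAM

namespace CayleyGraph

variable {G : Type u} [Group G] [Fintype G] [DecidableEq G]

/-! ### Importances in unweighted Cayley graphs -/

omit [Fintype G] [DecidableEq G] in
theorem unweighted_isUndirected {S : Finset G} (hS : ∀ s ∈ S, s⁻¹ ∈ S) :
    (unweighted S).IsUndirected := fun s hs => ⟨zero_le_one, hS s hs, rfl⟩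

omit [DecidableEq G] in
theorem exists_isHalf {S : Finset G} (hS : ∀ s ∈ S, s⁻¹ ∈ S) : ∃ R, IsHalf R S :=
  ⟨_, isHalf_firstHalf (Fintype.equivFin G) hS⟩

theorem pairEnergy_inv (s : G) (x : G → ℝ) : pairEnergy s⁻¹ x = pairEnergy s x := by
  simp only [pairEnergy, genEnergy_inv, inv_inv, eq_comm]

theorem energy_unweighted_pair (s : G) (x : G → ℝ) :
    (unweighted {s, s⁻¹}).energy x = pairEnergy s x := by
  have hS : ∀ t ∈ ({s, s⁻¹} : Finset G), t⁻¹ ∈ ({s, s⁻¹} : Finset G) := by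
    intro t ht
    rw [mem_insert, mem_singleton] at ht
    rcases ht with rfl | rfl <;> simp
  have hR : IsHalf {s} (unweighted {s, s⁻¹}).gens := by
    refine ⟨by simp [unweighted], fun t ht => ?_, fun t ht ht' => ?_⟩
    · simp only [unweighted, mem_insert, mem_singleton] at ht
      rcases ht with rfl | rfl <;> simp
    · simp only [mem_singleton] at ht ht'
      rw [ht', ht]
  rw [energy_eq_sum_half (unweighted_isUndirected hS) hR, sum_singleton]
  exact one_mul _

variable {S : Finset G}

theorem pairEnergy_le_energy (hS : ∀ s ∈ S, s⁻¹ ∈ S) {s : G} (hs : s ∈ S) (x : G → ℝ) :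
    pairEnergy s x ≤ (unweighted S).energy x := by
  obtain ⟨R, hR⟩ := exists_isHalf hS
  rw [energy_eq_sum_half (unweighted_isUndirected hS) hR]
  have key : ∀ t ∈ R, pairEnergy t x ≤ ∑ t ∈ R, (unweighted S).weight t * pairEnergy t x := by
    intro t ht
    have := single_le_sum (f := fun t => (unweighted S).weight t * pairEnergy t x)
      (fun t _ => mul_nonneg zero_le_one (pairEnergy_nonneg t x)) ht
    exact (one_mul _).symm.trans_le this
  rcases hR.2.1 s hs with h | h
  · exact key s h
  · rw [← pairEnergy_inv]
    exact key _ h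

theorem score_eq (s : G) (x : G → ℝ) :
    score S s x = pairEnergy s x / (unweighted S).energy x := by
  rw [score, energy_unweighted_pair]

theorem importance_inv (s : G) : importance S s⁻¹ = importance S s := by
  simp only [importance, score_eq, pairEnergy_inv]

variable (hS : ∀ s ∈ S, s⁻¹ ∈ S)
include hS

theorem score_nonneg (s : G) (x : G → ℝ) : 0 ≤ score S s x := by
  rw [score_eq]
  exact div_nonneg (pairEnergy_nonneg s x) ((unweighted_isUndirected hS).energy_nonneg x)

theorem score_le_importance {s : G} (hs : s ∈ S) (x : G → ℝ) : score S s x ≤ importance S s := by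
  refine le_ciSup (f := score S s) ⟨1, ?_⟩ x
  rintro _ ⟨y, rfl⟩
  rw [score_eq]
  exact div_le_one_of_le₀ (pairEnergy_le_energy hS hs y)
    ((unweighted_isUndirected hS).energy_nonneg y)

theorem importance_nonneg (s : G) : 0 ≤ importance S s := Real.iSup_nonneg (score_nonneg hS s)

theorem le_importance {s : G} (hs : s ∈ S) {a : ℝ} {x : G → ℝ} (hx : 0 < (unweighted S).energy x)
    (h : a * (unweighted S).energy x ≤ pairEnergy s x) : a ≤ importance S s := by
  refine le_trans ?_ (score_le_importance hS hs x)
  rwa [score_eq, le_div_iff₀ hx]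

/-- Where the energy of the graph vanishes the score is a default `0`, but there the energy of each
generator vanishes too. -/
theorem pairEnergy_le_importance_mul {s : G} (hs : s ∈ S) (x : G → ℝ) :
    pairEnergy s x ≤ importance S s * (unweighted S).energy x := by
  rcases ((unweighted_isUndirected hS).energy_nonneg x).eq_or_lt with h | h
  · rw [← h, mul_zero, h]
    exact pairEnergy_le_energy hS hs x
  · have := score_le_importance hS hs x
    rwa [score_eq, div_le_iff₀ h] at this

theorem importance_le {s : G} {b : ℝ} (hb : 0 ≤ b)
    (h : ∀ x, pairEnergy s x ≤ b * (unweighted S).energy x) : importance S s ≤ b := by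
  refine Real.iSup_le (fun x => ?_) hb
  rw [score_eq]
  exact div_le_of_le_mul₀ ((unweighted_isUndirected hS).energy_nonneg x) hb (h x)

theorem exists_of_lt_importance {s : G} {θ : ℝ} (hθ : 0 < θ) (h : θ < importance S s) :
    ∃ x, θ * (unweighted S).energy x < pairEnergy s x := by
  obtain ⟨x, hx⟩ := exists_lt_of_lt_ciSup h
  rw [score_eq] at hx
  refine ⟨x, ?_⟩
  rcases ((unweighted_isUndirected hS).energy_nonneg x).eq_or_lt with h0 | h0
  · rw [← h0, div_zero] at hx
    linarith
  · rwa [lt_div_iff₀ h0] at hx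

theorem sum_importance_le (hn : 2 ≤ Fintype.card G) (hne : S.Nonempty) :
    ∑ s ∈ S, importance S s ≤ 5184 * Real.log (Fintype.card G) ^ 3 * Real.log (#S + 1) := by
  have h := sum_le_of_important (unweighted_isUndirected hS) hne
    (card_lt_two_pow_clog_succ (Fintype.card G)) (f := importance S)
    (fun s _ => importance_nonneg hS s) one_pos (by
      intro θ hθ s hs hlt
      obtain ⟨x, hx⟩ := exists_of_lt_importance hS hθ hlt
      refine ⟨x, ?_⟩
      rw [extWeight, if_pos hs, one_mul]
      exact hx.trans_le ((pairEnergy_le s x).trans_eq (one_mul _).symm))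
  have hlog : 0 ≤ Real.log (#S + 1) := Real.log_nonneg (by simp)
  calc _ ≤ 24 * 1 * ((Nat.clog 2 (Fintype.card G) + 1 : ℕ) : ℝ) ^ 3 * Real.log (#S + 1) := h
    _ ≤ 24 * 1 * (6 * Real.log (Fintype.card G)) ^ 3 * Real.log (#S + 1) := by
        have := clog_succ_le_log hn
        gcongr
    _ = _ := by ring

omit hS in
theorem genEnergy_single_le (g : G) : genEnergy g (Pi.single 1 1) ≤ 2 := by
  have h1 : ∑ u : G, (Pi.single 1 1 : G → ℝ) u = 1 := by simp [Finset.sum_pi_single']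
  have h2 : ∑ u : G, (Pi.single 1 1 : G → ℝ) (u * g) = 1 :=
    (Fintype.sum_equiv (Equiv.mulRight g) _ _ fun _ => rfl).trans h1
  have h3 : (2 : ℝ) = ∑ u : G, ((Pi.single 1 1 : G → ℝ) u + (Pi.single 1 1 : G → ℝ) (u * g)) := by
    rw [sum_add_distrib, h1, h2]; norm_num
  rw [h3, genEnergy]
  refine sum_le_sum fun u _ => ?_
  simp only [Pi.single_apply]
  split_ifs <;> norm_num

omit hS in
theorem le_genEnergy_single {s : G} (hs : s ≠ 1) : 2 ≤ genEnergy s (Pi.single 1 1) := by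
  have hne : (1 : G) ≠ s⁻¹ := fun h => hs (by simpa using h.symm)
  have h1 := sum_le_sum_of_subset_of_nonneg (subset_univ {1, s⁻¹})
    fun u _ _ => sq_nonneg ((Pi.single 1 1 : G → ℝ) u - (Pi.single 1 1 : G → ℝ) (u * s))
  rw [sum_pair hne] at h1
  refine le_trans (le_of_eq ?_) h1
  simp [hs]
  norm_num

/-- The test function is the indicator of `1`: the pair has energy at least `1` on it, the whole
graph at most `|G|`. So the truncation of the program is never far above the true importance. -/
theorem inv_card_le_importance {s : G} (hs : s ∈ S) (hs1 : s ≠ 1) :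
    1 / (Fintype.card G : ℝ) ≤ importance S s := by
  have h1 : 1 ≤ pairEnergy s (Pi.single 1 1) := by
    have := genEnergy_le s (Pi.single 1 1)
    have := le_genEnergy_single hs1
    linarith
  have h2 := pairEnergy_le_energy hS hs (Pi.single 1 1)
  refine le_importance hS hs (x := Pi.single 1 1) (by linarith) (le_trans ?_ h1)
  rw [one_div_mul_eq_div, div_le_one (by positivity), energy_eq]
  have h3 : ∑ g : G, (unweighted S).extWeight g * genEnergy g (Pi.single 1 1) ≤ ∑ _g : G, 2 := by
    refine sum_le_sum fun g _ => ?_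
    have h4 := genEnergy_nonneg g (Pi.single 1 1)
    have h5 : (unweighted S).extWeight g ≤ 1 := by
      rw [extWeight]
      split_ifs
      · exact le_rfl
      · exact zero_le_one
    exact (mul_le_of_le_one_left h4 h5).trans (genEnergy_single_le g)
  rw [sum_const, card_univ, nsmul_eq_mul] at h3
  linarith

/-! ### Importance sampling -/

omit hS in
omit [Fintype G] in
theorem sampleProb_eq (R : Finset G) (q : G → ℝ) (E : CayleyGraph G → Prop) :
    sampleProb R q E = sampleExp R q fun T => open Classical in
      if E ((unweighted S).thinned q T) then 1 else 0 := by
  rw [sampleProb, sum_filter, sampleExp]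
  simp only [mul_ite, mul_one, mul_zero]
  rfl

theorem keepProb_mem {C : ℝ} (hC : 0 ≤ C) (ε : ℝ) (s : G) :
    0 ≤ keepProb C S ε s ∧ keepProb C S ε s ≤ 1 := by
  have := importance_nonneg hS s
  have := Real.log_natCast_nonneg (Fintype.card G)
  exact ⟨le_min (by positivity) zero_le_one, min_le_right _ _⟩

/-- With `ρ = ε ^ 2 / (C log |G|)` the definition of the probabilities is the hypothesis of the
concentration bound. The `60` is its `20` times the `3` in `clog_le_log`. -/
theorem le_sampleProb_keepProb (c : ℕ) {R : Finset G} (hR : IsHalf R S) {C : ℝ}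
    (hC : 60 * (c + 2) ≤ C) {ε : ℝ} (hε : 0 < ε) (hε1 : ε < 1) :
    1 - 1 / (Fintype.card G : ℝ) ^ c ≤ sampleProb R (keepProb C S ε) fun H' =>
      H'.IsSparsifierOfSize (unweighted S) ε
        (sizeConst (5184 * C) c * Real.log (Fintype.card G) ^ 4 * Real.log (#S + 1) / ε ^ 2) := by
  have hC0 : 0 < C := lt_of_lt_of_le (by positivity) hC
  rw [sampleProb_eq (S := S)]
  refine le_sampleExp_sparsifier_of_size c (H := unweighted S) (unweighted_isUndirected hS) hR
    (fun s _ => ⟨keepProb_mem hS hC0.le ε s, by rw [keepProb, keepProb, importance_inv]⟩) hε hε1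
    fun hn hne => ?_
  have hlog : 0 < Real.log (Fintype.card G) := by
    have := log_two_le_log hn
    linarith
  refine ⟨ε ^ 2 / (C * Real.log (Fintype.card G)), by positivity, fun s hs => ?_, ?_, ?_⟩
  · rcases min_choice (C * importance S s * Real.log (Fintype.card G) / ε ^ 2) 1 with h | h
    · right
      intro x
      have h1 : keepProb C S ε s * (ε ^ 2 / (C * Real.log (Fintype.card G))) = importance S s := by
        rw [keepProb, h]
        field_simp
      rw [h1]
      exact (one_mul _).trans_le (pairEnergy_le_importance_mul hS (hR.1 hs) x)
    · exact .inl h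
  · rw [mul_div_assoc', div_le_iff₀ (by positivity), mul_comm]
    have h1 := clog_le_log hn
    refine mul_le_mul_of_nonneg_left ?_ (sq_nonneg ε)
    calc 20 * ((c + 2) * (Nat.clog 2 (Fintype.card G) : ℝ)) ≤
          20 * ((c + 2) * (3 * Real.log (Fintype.card G))) := by gcongr
      _ = 60 * (c + 2) * Real.log (Fintype.card G) := by ring
      _ ≤ _ := by gcongr
  · calc ∑ s ∈ S, keepProb C S ε s ≤
          ∑ s ∈ S, C * Real.log (Fintype.card G) / ε ^ 2 * importance S s :=
        sum_le_sum fun s _ => (min_le_left _ _).trans_eq (by ring)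
      _ ≤ C * Real.log (Fintype.card G) / ε ^ 2 *
          (5184 * Real.log (Fintype.card G) ^ 3 * Real.log (#S + 1)) := by
        rw [← mul_sum]
        gcongr
        exact sum_importance_le hS hn hne
      _ = 5184 * C * (Real.log (Fintype.card G) ^ 4 * Real.log (#S + 1) / ε ^ 2) := by ring
      _ ≤ _ := le_add_of_nonneg_left zero_le_one

end CayleyGraph

/-! ### The program's probabilities compared with the importances -/

namespace RealRAM

open CayleyGraph

variable {G : Type u} [Group G] [Fintype G] [DecidableEq G] (e : G ≃ Fin (Fintype.card G))
  {S : Finset G} (hS : ∀ s ∈ S, s⁻¹ ∈ S) {s : G} (hs : s ∈ S) {ε : ℝ} (hε : 0 < ε) {C : ℕ}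
include hS hs hε

theorem keepProb_le_acceptProb : keepProb C S ε s ≤ acceptProb e (unweighted S) ε C s := by
  rcases acceptProb_lower e (unweighted S) ε C s with h | h
  · rw [h]
    exact min_le_right _ _
  · refine (min_le_left _ _).trans ?_
    have h0 := (acceptProb_mem e (unweighted S) ε C s).1
    have h1 := importance_nonneg hS s
    rw [div_le_iff₀ (by positivity)]
    have h2 : C * importance S s * Real.log (Fintype.card G) ≤
        C * Nat.clog 2 (Fintype.card G) * importance S s := by
      rw [mul_right_comm]
      gcongr
      exact log_card_le _
    refine h2.trans ?_
    rcases (show (0 : ℝ) ≤ C * Nat.clog 2 (Fintype.card G) by positivity).eq_or_lt with h3 | h3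
    · rw [← h3, zero_mul]
      positivity
    · rw [mul_comm, ← le_div_iff₀ h3]
      refine importance_le hS (by positivity) fun x => ?_
      rw [div_mul_eq_mul_div, le_div_iff₀ h3, mul_comm]
      have h4 := h x
      rw [extWeight, if_pos (show s ∈ (unweighted S).gens from hs)] at h4
      refine le_trans (mul_le_mul_of_nonneg_left ?_ h3.le) h4
      exact (pairEnergy_le s x).trans_eq (one_mul _).symm

/-- The `12` collects `2` from the halving, `3` from the rounded logarithm and `2` from involutions.
The `+ 2` covers truncated probabilities, which are at most `1 / |G|`, hence at most the importance.
The identity has probability `0`. -/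
theorem acceptProb_le_keepProb (hε1 : ε < 1) :
    acceptProb e (unweighted S) ε C s ≤ keepProb (12 * C + 2) S ε s := by
  refine le_min ?_ (acceptProb_mem e (unweighted S) ε C s).2
  have hi := importance_nonneg hS s
  have hl := Real.log_natCast_nonneg (Fintype.card G)
  by_cases hs1 : s = 1
  · rw [hs1, acceptProb_one, ← hs1]
    positivity
  have hn : 2 ≤ Fintype.card G := by
    have : Nontrivial G := ⟨s, 1, hs1⟩
    exact Fintype.one_lt_card
  rw [le_div_iff₀ (by positivity)]
  have h0 := (acceptProb_mem e (unweighted S) ε C s).1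
  rcases acceptProb_upper e (unweighted S) ε C s with h | ⟨x, hx⟩
  · have h1 : (1 / 2 : ℝ) ^ Nat.clog 2 (Fintype.card G) ≤ 1 / Fintype.card G := by
      rw [one_div_pow]
      refine one_div_le_one_div_of_le (by positivity) ?_
      exact_mod_cast Nat.le_pow_clog one_lt_two (Fintype.card G)
    have h2 := inv_card_le_importance hS hs hs1
    have h3 := log_two_le_log hn
    have h4 : acceptProb e (unweighted S) ε C s * ε ^ 2 ≤ acceptProb e (unweighted S) ε C s :=
      mul_le_of_le_one_right h0 (pow_le_one₀ hε.le hε1.le)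
    have h5 : importance S s * 1 ≤ importance S s * (2 * Real.log (Fintype.card G)) := by
      gcongr
      linarith
    have h6 : 0 ≤ C * importance S s * Real.log (Fintype.card G) := by positivity
    linarith
  · have h1 := pairEnergy_le_importance_mul hS hs x
    have h2 := genEnergy_le s x
    have h3 := clog_le_log hn
    rw [extWeight, if_pos (show s ∈ (unweighted S).gens from hs)] at hx
    have hx' : acceptProb e (unweighted S) ε C s * ε ^ 2 * (unweighted S).energy x <
        2 * (C * Nat.clog 2 (Fintype.card G)) * genEnergy s x := by
      simpa [unweighted] using hx
    have hE : 0 ≤ (unweighted S).energy x := (unweighted_isUndirected hS).energy_nonneg x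
    have h4 : 2 * (C * (Nat.clog 2 (Fintype.card G) : ℝ)) * genEnergy s x ≤
        2 * (C * (3 * Real.log (Fintype.card G))) *
          (2 * (importance S s * (unweighted S).energy x)) := by
      have := genEnergy_nonneg s x
      gcongr
      linarith
    have h5 : acceptProb e (unweighted S) ε C s * ε ^ 2 * (unweighted S).energy x <
        12 * C * importance S s * Real.log (Fintype.card G) * (unweighted S).energy x := by
      linarith
    have h6 := lt_of_mul_lt_mul_right h5 hE
    have h7 : 0 ≤ 2 * importance S s * Real.log (Fintype.card G) := by positivity
    linarith

omit hs hε in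
theorem prob_sampler_unweighted (ε : ℝ) (C : ℕ) {T : ℕ}
    (hT : Fintype.card G * Fintype.card G ≤ T) (E : CayleyGraph G → Prop) :
    prob (sampler C) (input e (unweighted S) ε) T (fun τ => E (output e τ)) =
      sampleProb (firstHalf e S) (acceptProb e (unweighted S) ε C) E := by
  classical
  rw [prob_sampler e ε (unweighted_isUndirected hS) C hT E, sampleProb_eq (S := S)]
  congr!

end RealRAM

/-! ### From the common size bound to the stated ones -/

theorem log_card_gens_le {n m : ℕ} (hm : m ≤ n) {K ε : ℝ} (hK : 0 ≤ K) :
    K * Real.log n ^ 4 * Real.log (m + 1) / ε ^ 2 ≤ 2 * K * Real.log n ^ 5 / ε ^ 2 := by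
  rcases le_or_gt n 1 with hn | hn
  · interval_cases n <;> simp
  have h1 : Real.log (m + 1) ≤ 2 * Real.log n := by
    have h2 : ((m + 1 : ℕ) : ℝ) ≤ (n ^ 2 : ℕ) := by
      exact_mod_cast (by nlinarith : m + 1 ≤ n ^ 2)
    have h3 := Real.log_le_log (by positivity) h2
    push_cast at h3
    rwa [Real.log_pow] at h3
  have h4 := Real.log_natCast_nonneg n
  refine div_le_div_of_nonneg_right ?_ (by positivity)
  calc _ ≤ K * Real.log n ^ 4 * (2 * Real.log n) := by gcongr
    _ = _ := by ring

end

theorem theorem1 :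
    -- existence of sparsifiers for polynomially bounded weights
    (∀ a : ℕ, ∃ K : ℝ, ∀ (G : Type u) [Group G] [Fintype G] [DecidableEq G] (H : CayleyGraph G),
      H.IsUndirected → H.HasPolyWeights a → ∀ ε : ℝ, 0 < ε → ε < 1 →
        ∃ H' : CayleyGraph G,
          H'.IsSparsifierOfSize H ε (K * Real.log (Fintype.card G) ^ 5 / ε ^ 2)) ∧
    -- they are found in polynomial time, with high probability
    (∀ a c : ℕ, ∃ (p : RealRAM.Program) (d : ℕ) (K : ℝ),
      ∀ (G : Type u) [Group G] [Fintype G] [DecidableEq G] (e : G ≃ Fin (Fintype.card G))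
        (H : CayleyGraph G), H.IsUndirected → H.HasPolyWeights a → ∀ ε : ℝ, 0 < ε → ε < 1 →
          RealRAM.Sparsifies p c d e H ε (K * Real.log (Fintype.card G) ^ 5 / ε ^ 2)) ∧
    -- unweighted graphs: importance sampling succeeds with high probability
    (∀ c : ℕ, ∃ C₀ : ℝ, ∀ C : ℝ, C₀ ≤ C → ∃ K : ℝ,
      ∀ (G : Type u) [Group G] [Fintype G] [DecidableEq G] (S R : Finset G),
        (∀ s ∈ S, s⁻¹ ∈ S) → CayleyGraph.IsHalf R S → ∀ ε : ℝ, 0 < ε → ε < 1 →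
          1 - 1 / (Fintype.card G : ℝ) ^ c ≤
            CayleyGraph.sampleProb R (CayleyGraph.keepProb C S ε) fun H' =>
              H'.IsSparsifierOfSize (CayleyGraph.unweighted S) ε
                (K * Real.log (Fintype.card G) ^ 4 * Real.log (#S + 1) / ε ^ 2)) ∧
    -- unweighted graphs: importance sampling, with the probabilities determined up to constant
    -- factors, runs in polynomial time and succeeds with high probability
    (∀ c : ℕ, ∃ (p : RealRAM.Program) (d : ℕ) (K C C' : ℝ), 0 < C ∧ C ≤ C' ∧
      ∀ (G : Type u) [Group G] [Fintype G] [DecidableEq G] (e : G ≃ Fin (Fintype.card G))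
        (S : Finset G), (∀ s ∈ S, s⁻¹ ∈ S) → ∀ ε : ℝ, 0 < ε → ε < 1 →
          RealRAM.Sparsifies p c d e (CayleyGraph.unweighted S) ε
              (K * Real.log (Fintype.card G) ^ 4 * Real.log (#S + 1) / ε ^ 2) ∧
            ∃ (R : Finset G) (q : G → ℝ), CayleyGraph.IsHalf R S ∧
              (∀ s ∈ S, q s⁻¹ = q s ∧ CayleyGraph.keepProb C S ε s ≤ q s ∧
                q s ≤ CayleyGraph.keepProb C' S ε s) ∧
              ∀ E : CayleyGraph G → Prop,
                RealRAM.prob p (RealRAM.input e (CayleyGraph.unweighted S) ε)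
                    (d * Fintype.card G ^ d) (fun τ => E (RealRAM.output e τ)) =
                  CayleyGraph.sampleProb R q E) ∧
    -- arbitrary weights that are at least `1`
    (∀ c : ℕ, ∃ (p : RealRAM.Program) (d : ℕ) (K : ℝ),
      ∀ (G : Type u) [Group G] [Fintype G] [DecidableEq G] (e : G ≃ Fin (Fintype.card G))
        (H : CayleyGraph G) (W : ℝ), H.IsUndirected →
          (∀ s ∈ H.gens, 1 ≤ H.weight s ∧ H.weight s ≤ W) → ∀ ε : ℝ, 0 < ε → ε < 1 →
            RealRAM.Sparsifies p c d e H ε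
              (K * Real.log (Fintype.card G) ^ 4 * Real.log (#H.gens * W / ε + 1) / ε ^ 2)) := by
  refine ⟨fun a => ⟨2 * CayleyGraph.sizeConst (31104 * (20 * (1 + 2) : ℕ)) 1, ?_⟩,
    fun a c => ⟨RealRAM.sampler (20 * (c + 2)), 6400,
      2 * CayleyGraph.sizeConst (31104 * (20 * (c + 2) : ℕ)) c, ?_⟩,
    fun c => ⟨60 * (c + 2), fun C hC => ⟨CayleyGraph.sizeConst (5184 * C) c, ?_⟩⟩,
    fun c => ⟨RealRAM.sampler (20 * (c + 2)), 6400,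
      CayleyGraph.sizeConst (31104 * (20 * (c + 2) : ℕ)) c, (20 * (c + 2) : ℕ),
      12 * (20 * (c + 2) : ℕ) + 2, by positivity, ?_, ?_⟩,
    fun c => ⟨RealRAM.sampler (20 * (c + 2)), 6400,
      CayleyGraph.sizeConst (31104 * (20 * (c + 2) : ℕ)) c, ?_⟩⟩
  · intro G _ _ _ H hH _ ε hε hε1
    rcases le_or_gt (Fintype.card G) 1 with hn | hn
    -- The bound is `0` here since `log 1 = 0`, and all energies vanish, so the empty graph is a
    -- sparsifier.
    · have := Fintype.card_le_one_iff_subsingleton.1 hn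
      have h0 : ∀ (H : CayleyGraph G) x, H.energy x = 0 := by
        intro H x
        simp [CayleyGraph.energy, Subsingleton.elim _ (1 : G)]
      have h1 : Fintype.card G = 1 := le_antisymm hn Fintype.card_pos
      exact ⟨⟨∅, 0⟩, by simp, fun s hs => by simp at hs, by simp [h1], fun x => by simp [h0]⟩
    · obtain ⟨H', hH'⟩ :=
        (RealRAM.sampler_sparsifies 1 (Fintype.equivFin G) hH hε hε1).exists hn
      exact ⟨H', hH'.mono (log_card_gens_le (card_le_univ _)
        (CayleyGraph.sizeConst_nonneg (by positivity) 1))⟩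
  · intro G _ _ _ e H hH _ ε hε hε1
    exact (RealRAM.sampler_sparsifies c e hH hε hε1).mono
      (log_card_gens_le (card_le_univ _) (CayleyGraph.sizeConst_nonneg (by positivity) c))
  · intro G _ _ _ S R hS hR ε hε hε1
    exact CayleyGraph.le_sampleProb_keepProb hS c hR hC hε hε1
  · have : (0 : ℝ) ≤ (20 * (c + 2) : ℕ) := by positivity
    linarith
  · intro G _ _ _ e S hS ε hε hε1
    refine ⟨RealRAM.sampler_sparsifies c e (CayleyGraph.unweighted_isUndirected hS) hε hε1,
      CayleyGraph.firstHalf e S, RealRAM.acceptProb e (CayleyGraph.unweighted S) ε (20 * (c + 2)),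
      CayleyGraph.isHalf_firstHalf e hS, fun s hs =>
        ⟨RealRAM.acceptProb_inv e ε (CayleyGraph.unweighted_isUndirected hS) _ s,
        RealRAM.keepProb_le_acceptProb e hS hs hε, RealRAM.acceptProb_le_keepProb e hS hs hε hε1⟩,
      fun E => RealRAM.prob_sampler_unweighted e hS ε _
        (RealRAM.sq_le_time Fintype.card_pos le_rfl) E⟩
  · intro G _ _ _ e H W hH hW ε hε hε1
    refine (RealRAM.sampler_sparsifies c e hH hε hε1).mono ?_
    have hK : 0 ≤ CayleyGraph.sizeConst (31104 * (20 * (c + 2) : ℕ)) c :=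
      CayleyGraph.sizeConst_nonneg (by positivity) c
    have hl := Real.log_natCast_nonneg (Fintype.card G)
    refine div_le_div_of_nonneg_right (mul_le_mul_of_nonneg_left ?_ (by positivity)) (by positivity)
    -- It remains to see `|S| ≤ |S| W / ε`. A generator yields `1 ≤ W`, hence `ε ≤ W`; without
    -- generators both sides are `0`.
    refine Real.log_le_log (by positivity) (add_le_add ?_ le_rfl)
    rcases H.gens.eq_empty_or_nonempty with h | ⟨s, hs⟩
    · simp [h]
    · rw [le_div_iff₀ hε]
      have hW1 := (hW s hs).1.trans (hW s hs).2
      exact mul_le_mul_of_nonneg_left (hε1.le.trans hW1) (by positivity)
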